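/- **Setting.** Let $\mathcal M=(S,s_{\mathrm{init}},A,P,L)$ be a finite MDP over a set $AP$ of atomic propositions, with a nonempty set $A(s)$ of enabled actions for each state $s$, $P(\cdot\mid s,\alpha)$ a distribution on $S$ if $\alpha\in A(s)$ and $0$ otherwise, and $L:S\to 2^{AP}$; put $\mathrm{Succ}(s,\alpha)=\{t: P(t\mid s,\alpha)>0\}$. A finite-memory policy $\pi_{\mathrm{fin}}=(M,\mathrm{start},\Delta,\mathrm{act})$ has a finite set $M$ of modes, $\mathrm{start}:S\to M$, $\Delta:M\times S\to M$, and distributions $\mathrm{act}(m,s,\cdot)$ on $A$ supported in $A(s)$. It induces the Markov chain $\mathcal M_{\pi_{\mathrm{fin}}}$ on $M\times S$ with label $L(s)$ in $\langle m,s\rangle$, that moves from $\langle m,s\rangle$ to $\langle\Delta(m,s),t\rangle$ with probability $\sum_{\alpha\in A(s)}\mathrm{act}(m,s,\alpha)P(t\mid s,\alpha)$. PCTL* path formulas are $\psi ::= \mathit{true}\mid a\mid\neg\psi\mid\psi\wedge\psi\mid \mathsf P_{\sim z}\psi\mid \mathsf X\psi\mid\psi\,\mathsf U\,\psi$ with ${\sim}\in\{<,\le,>,\ge\}$,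 $z\in[0,1]$; state formulas are those without $\mathsf X,\mathsf U$ outside $\mathsf P$; classical formulas contain no $\mathsf P,\mathsf X,\mathsf U$; $\mathit{false}=\neg\mathit{true}$. The semantics over runs and states of the chain is the usual one, and $\mathcal M,\pi_{\mathrm{fin}}\models\phi$ means that $\phi$ holds in $\langle \mathrm{start}(s_{\mathrm{init}}),s_{\mathrm{init}}\rangle$. Let $\overline\sim$ be the complementary comparison and $[\sim]$ the reversed one. **Programs.** A program is a set of constraints $e_1\bowtie e_2$, ${\bowtie}\in\{<,\le,>,\ge,\doteq\}$, between arithmetic expressions; all variables range over $[0,1]$. There are variables $x^\alpha_{ms}$ (for the probability of $\alpha$ in $\langle m,s\rangle$) and $x_u^F$ for nodes $u$ and labelled formulas $F=\langle m,s\rangle:\Psi$, $\Psi$ a set of path formulas read conjunctively. The policy domain of a program $\Gamma$ is the set of $\langle m,s\rangle$ such that some $x^\alpha_{ms}$ occurs in $\Gamma$. Put $\mathrm{Prescribed}(\Gamma)=\{\alpha:(x_{ms}^\alpha>0)\in\Gamma\}$. **Inference rules**, for a leaf $u$ labelled $\Gamma\vdash\langle m,s\rangle:\Psi$ with pivot $F$,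 in decreasing order of preference. "$\psi\Rightarrow\Psi_1$" means: if $\psi\in\Psi$, add a child $u_1$ with pivot $F_1=\langle m,s\rangle:\Psi_1\cup(\Psi\setminus\{\psi\})$ and constraint $x_u^F\doteq x_{u_1}^{F_1}$. "$\psi\Rightarrow\Psi_1\mid\Psi_2$" is the same with two children and $x_u^F\doteq x_{u_1}^{F_1}+x_{u_2}^{F_2}$, added in the last child. (1) $\psi\Rightarrow\emptyset$ for $\psi$ classical and true in $L(s)$. (2) If some classical $\psi\in\Psi$ is false in $L(s)$: add $x_u^F\doteq0$ and close with ✗. (3) If $\Psi=\emptyset$: add $x_u^F\doteq1$ and close with ✓. (4) $\neg\neg\psi\Rightarrow\{\psi\}$. (5) $\neg\mathsf P_{\sim z}\psi\Rightarrow\{\mathsf P_{\overline\sim z}\psi\}$. (6) $\mathsf P_{\sim z}\neg\psi\Rightarrow\{\mathsf P_{[\sim]1-z}\psi\}$. (7) $\psi_1\wedge\psi_2\Rightarrow\{\psi_1,\psi_2\}$. (8) $\neg(\psi_1\wedge\psi_2)\Rightarrow\{\neg\psi_1\}\mid\{\psi_1,\neg\psi_2\}$. (9) $\mathsf P_{\ge0}\psi,\mathsf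 P_{\le1}\psi\Rightarrow\{\mathit{true}\}$; $\mathsf P_{>1}\psi,\mathsf P_{<0}\psi\Rightarrow\{\mathit{false}\}$; $\mathsf P_{\ge v}\mathsf P_{\sim z}\psi\Rightarrow\{\mathsf P_{\sim z}\psi\}$ if $v\ne0$; $\mathsf P_{>v}\mathsf P_{\sim z}\psi\Rightarrow\{\mathsf P_{\sim z}\psi\}$ if $v\ne1$; $\mathsf P_{\le v}\mathsf P_{\sim z}\psi\Rightarrow\{\mathsf P_{\ge1-v}\mathsf P_{\overline\sim z}\psi\}$; $\mathsf P_{<v}\mathsf P_{\sim z}\psi\Rightarrow\{\mathsf P_{>1-v}\mathsf P_{\overline\sim z}\psi\}$. (10) $\mathsf P_{\sim z}\psi\Rightarrow\{\psi\}$ if ${\sim}\in\{>,\ge\}$ and $\psi$ is a state formula. (11) $\mathsf P_{\sim z}\psi\Rightarrow\{\neg\psi\}$ if ${\sim}\in\{<,\le\}$ and $\psi$ is a state formula. (12) If $\mathsf P_{\sim z}\psi\in\Psi$ and $\Gamma$ contains neither $\gamma_l=(x_{u'}^{\langle m,s\rangle:\{\psi\}}\sim z)$ nor $\gamma_r=(x_{u'}^{\langle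 m,s\rangle:\{\psi\}}\mathrel{\overline\sim}z)$ for any node $u'$: run the procedure recursively on $\emptyset\vdash\langle m,s\rangle:\{\psi\}$ with a new root $u'$ and result $\Gamma'$, and replace $\Gamma$ by $\Gamma\cup\Gamma'\cup\{\gamma_l\}$ or $\Gamma\cup\Gamma'\cup\{\gamma_r\}$ (don't-know choice). (13) $\mathsf P_{\sim z}\psi\Rightarrow\emptyset$ if $\gamma_l\in\Gamma$ for some $u'$. (14) If $\mathsf P_{\sim z}\psi\in\Psi$ and $\gamma_r\in\Gamma$ for some $u'$: add $x_u^F\doteq0$ and close with ✗. (15) $\psi_1\mathsf U\psi_2\Rightarrow\{\psi_2\}\mid\{\psi_1,\neg\psi_2,\mathsf X(\psi_1\mathsf U\psi_2)\}$. (16) $\neg(\psi_1\mathsf U\psi_2)\Rightarrow\{\neg\psi_1,\neg\psi_2\}\mid\{\psi_1,\neg\psi_2,\mathsf X\neg(\psi_1\mathsf U\psi_2)\}$. (17) $\neg\mathsf X\psi\Rightarrow\{\mathsf X\neg\psi\}$. The remaining rules require $F$ poised: $\Psi=\mathsf X\Psi'=\{\mathsf X\psi:\psi\in\Psi'\}$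 with $\Psi'\neq\emptyset$. (18) If $\alpha\in A(s)$ and neither $x_{ms}^\alpha\doteq0$ nor $x^\alpha_{ms}>0$ is in $\Gamma$: add one of them (don't-know choice). (19) Add $\sum_{\alpha\in\mathrm{Prescribed}(\Gamma)}x^\alpha_{ms}\doteq1$ unless it is in $\Gamma$. (20) If $u$ is yes-blocked by $v$: add $x_u^F\doteq x_v^F$ and close with Yes-Loop and a backlink to $v$. (21) Likewise with No-Loop if $u$ is no-blocked by $v$. (22) For the elements $t_1,\dots,t_k$ (in any order) of $\bigcup_{\alpha\in\mathrm{Prescribed}(\Gamma)}\mathrm{Succ}(s,\alpha)$, add children $u_t$ ($\mathsf X$-successors) with pivots $F_t=\langle\Delta(m,s),t\rangle:\Psi'$, and in the last one the constraint $x_u^F\doteq\sum_{\alpha\in\mathrm{Prescribed}(\Gamma)}x_{ms}^\alpha\cdot\sum_{t\in\mathrm{Succ}(s,\alpha)}P(t\mid s,\alpha)\,x_{u_t}^{F_t}$. Rules (12), (18), (19) only enlarge the program at the node $u$, the others create children (closing creates a leaf labelled ✗, ✓, Yes-Loop or No-Loop). For nodes on one branch write $v<w$ if $v$ is a proper ancestor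 of $w$. A leaf $w$ is *yes-blocked* by $v<w$ if $v,w$ have the same pivot and for each $\mathsf X(\psi_1\mathsf U\psi_2)\in\Psi_v$ there is $x$ with $v<x\le w$ and $\psi_2\in\Psi_x$. It is *no-blocked* by $u$ if for some $v$ with $u<v<w$ all three have the same pivot and for each $\mathsf X(\psi_1\mathsf U\psi_2)\in\Psi_u$: if $\psi_2\in\Psi_x$ for some $v<x\le w$, then $\psi_2\in\Psi_y$ for some $u<y\le v$. **Result of a derivation.** Let $T$ be the finished tableau (every branch closed or without further rule) after the don't-know choices have been made. A *0-deadend* is a node whose subtree has no edge to an $\mathsf X$-successor and all of whose leaves are ✗; $0(T)$ is the set of all nodes in subtrees of 0-deadends. A node $u$ is *ambiguous* if its subtree has no ✓ leaf and no $\mathsf X$-successor that is a 0-deadend. It is the *root of a BSCC* if its pivot is poised, it is ambiguous, and $\mathrm{Subtree}(u)\setminus 0(T)$ is a bottom strongly connected component of the graph of tree edges and backlinks on $T\setminus0(T)$. The result $\Gamma_T$ is the union of the programs at the leaves of $T$ together with, for each root $u$ of a BSCC, with pivot $F$, the constraint $x_u^F\doteq1$ if the subtree of $u$ has a Yes-Loop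 leaf and $x_u^F\doteq0$ otherwise. **Theorem (Completeness).** Let $\mathcal M$ be an MDP, $\pi_{\mathrm{fin}}=(M,\mathrm{start},\Delta,\mathrm{act})$ a finite-memory policy, and $\phi$ a state formula with $\mathcal M,\pi_{\mathrm{fin}}\models\phi$. Let $F_0=\langle \mathrm{start}(s_{\mathrm{init}}),s_{\mathrm{init}}\rangle:\{\phi\}$. Then, whichever applicable inferences with the most preferred rule are applied to the leaves, some sequence of don't-know choices leads from the initial sequent $\{x_{u_0}^{F_0}\doteq1\}\vdash F_0$ (at the root $u_0$) to a finite finished tableau whose result $\Gamma_{\mathrm{final}}$ has a solution $\sigma$ such that $\sigma(x_{ms}^\alpha)=\mathrm{act}(m,s,\alpha)$ for every $\langle m,s\rangle$ in the policy domain of $\Gamma_{\mathrm{final}}$ and every $\alpha\in A$. Moreover, every policy $\pi_{\mathrm{fin}}(\sigma)=(M,\mathrm{start},\Delta,\mathrm{act}_\sigma)$ completed by $\sigma$, that is, with $\mathrm{act}_\sigma(m,s,\alpha)=\sigma(x_{ms}^\alpha)$ on the policy domain of $\Gamma_{\mathrm{final}}$ and arbitrary elsewhere, satisfies $\mathcal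 M,\pi_{\mathrm{fin}}(\sigma)\models\phi$. -/

import Mathlib

namespace PCTLSynth

/-! ## Markov decision processes and finite-memory policies -/

/-- A Markov decision process with states `S`, actions `A` and atomic propositions `AP`;
`enabled s` is the set of actions enabled in `s`, and `P s α t` is the probability of moving to `t`
when `α` is applied in `s`. -/
structure MDP (S A AP : Type*) [Fintype S] where
  init : S
  enabled : S → Set A
  P : S → A → S → ℝ
  label : S → Set AP
  enabled_nonempty : ∀ s, (enabled s).Nonempty
  P_nonneg : ∀ s α t, 0 ≤ P s α t
  P_sum_enabled : ∀ s, ∀ α ∈ enabled s, ∑ t, P s α t = 1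
  P_sum_disabled : ∀ s, ∀ α ∉ enabled s, ∑ t, P s α t = 0

/-- A partially specified finite-memory policy: modes `M`, initial modes and mode transitions. -/
structure PartialPolicy (S M : Type*) where
  start : S → M
  delta : M → S → M

/-- A fully specified finite-memory policy. -/
structure Policy {S A AP : Type*} [Fintype S] [Fintype A] (D : MDP S A AP) (M : Type*)
    extends PartialPolicy S M where
  act : M → S → A → ℝ
  act_nonneg : ∀ m s α, 0 ≤ act m s α
  act_sum : ∀ m s, ∑ α, act m s α = 1
  act_enabled : ∀ m s α, 0 < act m s α → α ∈ D.enabled s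

/-! ## Finite Markov chains and their run measures -/

/-- A finite labelled Markov chain. -/
structure Chain (Q AP : Type*) [Fintype Q] where
  trans : Q → Q → ℝ
  label : Q → Set AP
  trans_nonneg : ∀ p q, 0 ≤ trans p q
  trans_sum : ∀ p, ∑ q, trans p q = 1

namespace Chain

variable {Q AP : Type*} [Fintype Q]

/-- The distribution of the next state. -/
noncomputable def next (C : Chain Q AP) (p : Q) : PMF Q :=
  PMF.ofFintype (fun q => ENNReal.ofReal (C.trans p q)) (by
    rw [← ENNReal.ofReal_sum_of_nonneg (fun q _ => C.trans_nonneg p q), C.trans_sum p,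
      ENNReal.ofReal_one])

/-- The one-step kernel, reading a history up to time `n` and using only its last state.
The finite type `Q` carries the discrete σ-algebra. -/
noncomputable def kernel (C : Chain Q AP) (n : ℕ) :
    letI : MeasurableSpace Q := ⊤
    ProbabilityTheory.Kernel ((i : Finset.Iic n) → (fun _ : ℕ => Q) i) Q :=
  letI : MeasurableSpace Q := ⊤
  haveI : MeasurableSingletonClass Q := ⟨fun _ => trivial⟩
  (ProbabilityTheory.Kernel.ofFunOfCountable (fun p : Q => (C.next p).toMeasure)).comap
    (fun h : (i : Finset.Iic n) → (fun _ : ℕ => Q) i => h ⟨n, Finset.mem_Iic.2 le_rfl⟩)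
    (measurable_pi_apply _)

theorem isMarkovKernel_kernel (C : Chain Q AP) (n : ℕ) :
    letI : MeasurableSpace Q := ⊤
    ProbabilityTheory.IsMarkovKernel (C.kernel n) := by
  letI : MeasurableSpace Q := ⊤
  haveI : MeasurableSingletonClass Q := ⟨fun _ => trivial⟩
  exact ⟨fun h => PMF.toMeasure.isProbabilityMeasure (C.next (h ⟨n, Finset.mem_Iic.2 le_rfl⟩))⟩

/-- The law of the chain started in `p`, a probability measure on infinite state sequences
(Ionescu-Tulcea theorem). -/
noncomputable def runMeasure (C : Chain Q AP) (p : Q) :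
    letI : MeasurableSpace Q := ⊤
    MeasureTheory.Measure (ℕ → Q) :=
  letI : MeasurableSpace Q := ⊤
  haveI := C.isMarkovKernel_kernel
  ProbabilityTheory.Kernel.traj (X := fun _ => Q) C.kernel 0 (fun _ => p)

/-- The infinite sequence `r` is a run of the chain. Times are counted from `0`. -/
def IsRun (C : Chain Q AP) (r : ℕ → Q) : Prop := ∀ i, 0 < C.trans (r i) (r (i + 1))

/-- The probability of the set of runs from `p` that lie in `E`. -/
noncomputable def Pr (C : Chain Q AP) (p : Q) (E : Set (ℕ → Q)) : ℝ :=
  letI : MeasurableSpace Q := ⊤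
  (C.runMeasure p {r | C.IsRun r ∧ r 0 = p ∧ r ∈ E}).toReal

end Chain

/-- The Markov chain induced by an MDP and a finite-memory policy; its states are the policy
states `(m, s)`. -/
noncomputable def inducedChain {S A AP M : Type*} [Fintype S] [Fintype A] [Fintype M]
    (D : MDP S A AP) (π : Policy D M) : Chain (M × S) AP where
  trans := open Classical in fun p q =>
    if q.1 = π.delta p.1 p.2 then
      ∑ α ∈ Finset.univ.filter (fun α => α ∈ D.enabled p.2), π.act p.1 p.2 α * D.P p.2 α q.2
    else 0
  label := fun p => D.label p.2
  trans_nonneg := by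
    intro p q
    split_ifs
    · exact Finset.sum_nonneg fun α _ => mul_nonneg (π.act_nonneg _ _ _) (D.P_nonneg _ _ _)
    · exact le_rfl
  trans_sum := by
    classical
    intro p
    have h0 : ∀ α, α ∉ D.enabled p.2 → π.act p.1 p.2 α = 0 := fun α hα =>
      le_antisymm (not_lt.1 fun h => hα (π.act_enabled _ _ _ h)) (π.act_nonneg _ _ _)
    rw [Fintype.sum_prod_type, Finset.sum_comm]
    simp only [Finset.sum_ite_eq', Finset.mem_univ, if_true]
    rw [Finset.sum_comm]
    have h1 : ∀ α ∈ Finset.univ.filter (fun α => α ∈ D.enabled p.2),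
        ∑ t, π.act p.1 p.2 α * D.P p.2 α t = π.act p.1 p.2 α := by
      intro α hα
      rw [← Finset.mul_sum, D.P_sum_enabled _ _ (Finset.mem_filter.1 hα).2, mul_one]
    rw [Finset.sum_congr rfl h1, ← π.act_sum p.1 p.2]
    refine Finset.sum_subset (Finset.filter_subset _ _) fun α _ hα => h0 α fun h => hα ?_
    exact Finset.mem_filter.2 ⟨Finset.mem_univ _, h⟩

/-! ## PCTL* -/

/-- The comparison symbols of the probability operator. -/
inductive Cmp
  | lt | le | gt | ge

namespace Cmp

/-- The meaning of a comparison symbol. -/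
def Holds : Cmp → ℝ → ℝ → Prop
  | lt, x, y => x < y
  | le, x, y => x ≤ y
  | gt, x, y => x > y
  | ge, x, y => x ≥ y

/-- The complementary comparison. -/
def compl : Cmp → Cmp
  | lt => ge
  | le => gt
  | gt => le
  | ge => lt

/-- The comparison with its direction reversed. -/
def flip : Cmp → Cmp
  | lt => gt
  | le => ge
  | gt => lt
  | ge => le

end Cmp

/-- PCTL* path formulas. The state formulas are those satisfying `Formula.IsState`. -/
inductive Formula (AP : Type*)
  | tt : Formula AP
  | atom (a : AP) : Formula AP
  | neg (ψ : Formula AP) : Formula AP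
  | and (ψ₁ ψ₂ : Formula AP) : Formula AP
  | prob (c : Cmp) (z : unitInterval) (ψ : Formula AP) : Formula AP
  | next (ψ : Formula AP) : Formula AP
  | untl (ψ₁ ψ₂ : Formula AP) : Formula AP

namespace Formula

variable {AP : Type*}

/-- State formulas. -/
def IsState : Formula AP → Prop
  | tt => True
  | atom _ => True
  | neg ψ => ψ.IsState
  | and ψ₁ ψ₂ => ψ₁.IsState ∧ ψ₂.IsState
  | prob _ _ _ => True
  | next _ => False
  | .untl _ _ => False

/-- Classical formulas: no probability operator and no temporal operator. -/
def IsClassical : Formula AP → Prop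
  | tt => True
  | atom _ => True
  | neg ψ => ψ.IsClassical
  | and ψ₁ ψ₂ => ψ₁.IsClassical ∧ ψ₂.IsClassical
  | prob _ _ _ => False
  | next _ => False
  | .untl _ _ => False

/-- Truth of a classical formula in an interpretation (irrelevant for other formulas). -/
def EvalClassical (I : Set AP) : Formula AP → Prop
  | tt => True
  | atom a => a ∈ I
  | neg ψ => ¬ ψ.EvalClassical I
  | and ψ₁ ψ₂ => ψ₁.EvalClassical I ∧ ψ₂.EvalClassical I
  | prob _ _ _ => False
  | next _ => False
  | .untl _ _ => False

/-- The formula `false`. -/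
def ff : Formula AP := neg tt

end Formula

section Semantics

variable {Q AP : Type*} [Fintype Q]

/-- Satisfaction of a path formula by a run; `r (k + ·)` is the suffix of `r` from time `k`. -/
def RunSat (C : Chain Q AP) : Formula AP → (ℕ → Q) → Prop
  | .tt, _ => True
  | .atom a, r => a ∈ C.label (r 0)
  | .neg ψ, r => ¬ RunSat C ψ r
  | .and ψ₁ ψ₂, r => RunSat C ψ₁ r ∧ RunSat C ψ₂ r
  | .prob c z ψ, r => c.Holds (C.Pr (r 0) {r' | RunSat C ψ r'}) z
  | .next ψ, r => RunSat C ψ (fun i => r (1 + i))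
  | .untl ψ₁ ψ₂, r => ∃ n, RunSat C ψ₂ (fun i => r (n + i)) ∧
      ∀ k < n, RunSat C ψ₁ (fun i => r (k + i))

/-- Satisfaction of a state formula in a state (irrelevant for proper path formulas). -/
def StateSat (C : Chain Q AP) (p : Q) : Formula AP → Prop
  | .tt => True
  | .atom a => a ∈ C.label p
  | .neg φ => ¬ StateSat C p φ
  | .and φ₁ φ₂ => StateSat C p φ₁ ∧ StateSat C p φ₂
  | .prob c z ψ => c.Holds (C.Pr p {r | RunSat C ψ r}) z
  | .next _ => False
  | .untl _ _ => False

/-- A state formula holds of a run iff it holds in its first state. -/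
theorem runSat_iff_stateSat (C : Chain Q AP) (r : ℕ → Q) (φ : Formula AP) (hφ : φ.IsState) :
    RunSat C φ r ↔ StateSat C (r 0) φ := by
  induction φ with
  | tt => simp [RunSat, StateSat]
  | atom a => simp [RunSat, StateSat]
  | neg ψ ih => simp [RunSat, StateSat, ih hφ]
  | and ψ₁ ψ₂ ih₁ ih₂ => simp [RunSat, StateSat, ih₁ hφ.1, ih₂ hφ.2]
  | prob c z ψ ih => simp [RunSat, StateSat]
  | next ψ ih => exact hφ.elim
  | untl ψ₁ ψ₂ ih₁ ih₂ => exact hφ.elim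

end Semantics

/-- The MDP with the policy satisfies the state formula. -/
def Models {S A AP M : Type*} [Fintype S] [Fintype A] [Fintype M]
    (D : MDP S A AP) (π : Policy D M) (φ : Formula AP) : Prop :=
  StateSat (inducedChain D π) (π.start D.init, D.init) φ

/-! ## Labelled formulas, variables and nonlinear programs -/

/-- A labelled formula `⟨m, s⟩ : Ψ`, where the set `Ψ` is read conjunctively. -/
structure LForm (S M AP : Type*) where
  mode : M
  state : S
  fmls : Set (Formula AP)

/-- Nodes are named by their access path: `child i` goes to the `i`-th child inside a tableau, and
`call χ` goes to the root of the tableau that is derived recursively for the `P`-formula `χ`. -/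
inductive Step (AP : Type*)
  | child (i : ℕ)
  | call (χ : Formula AP)

/-- Node names. -/
abbrev Name (AP : Type*) := List (Step AP)

/-- Variables: `prob u F` is the probability of the labelled formula `F` at the node `u`, and
`act m s α` is the probability of applying `α` in the policy state `⟨m, s⟩`. -/
inductive Var (S A M AP : Type*)
  | prob (u : Name AP) (F : LForm S M AP)
  | act (m : M) (s : S) (α : A)

/-- Arithmetic expressions over variables `V`. -/
inductive Expr (V : Type*)
  | const (c : ℝ)
  | var (x : V)
  | add (e₁ e₂ : Expr V)
  | sub (e₁ e₂ : Expr V)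
  | mul (e₁ e₂ : Expr V)
  | div (e₁ e₂ : Expr V)

namespace Expr

variable {V : Type*}

/-- The value of an expression. -/
noncomputable def eval (σ : V → ℝ) : Expr V → ℝ
  | const c => c
  | var x => σ x
  | add e₁ e₂ => e₁.eval σ + e₂.eval σ
  | sub e₁ e₂ => e₁.eval σ - e₂.eval σ
  | mul e₁ e₂ => e₁.eval σ * e₂.eval σ
  | div e₁ e₂ => e₁.eval σ / e₂.eval σ

/-- The variable `x` occurs in the expression. -/
def Occurs (x : V) : Expr V → Prop
  | const _ => False
  | var y => x = y
  | add e₁ e₂ => e₁.Occurs x ∨ e₂.Occurs x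
  | sub e₁ e₂ => e₁.Occurs x ∨ e₂.Occurs x
  | mul e₁ e₂ => e₁.Occurs x ∨ e₂.Occurs x
  | div e₁ e₂ => e₁.Occurs x ∨ e₂.Occurs x

/-- The sum of a finite family of expressions. -/
noncomputable def sum {ι : Type*} (s : Finset ι) (e : ι → Expr V) : Expr V :=
  (s.toList.map e).foldr add (const 0)

end Expr

/-- The relation symbols of constraints. -/
inductive CRel
  | cmp (c : Cmp)
  | eq

/-- The meaning of a relation symbol. -/
def CRel.Holds : CRel → ℝ → ℝ → Prop
  | cmp c, x, y => c.Holds x y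
  | eq, x, y => x = y

/-- Constraints. -/
structure Constr (V : Type*) where
  lhs : Expr V
  rel : CRel
  rhs : Expr V

/-- A (nonlinear) program is a set of constraints. -/
abbrev Program (S A M AP : Type*) := Set (Constr (Var S A M AP))

section Programs

variable {S A M AP : Type*}

/-- Solutions of a program; all variables range over `[0, 1]`. -/
def IsSolution (Γ : Program S A M AP) (σ : Var S A M AP → ℝ) : Prop :=
  (∀ x, σ x ∈ Set.Icc (0 : ℝ) 1) ∧ ∀ γ ∈ Γ, γ.rel.Holds (γ.lhs.eval σ) (γ.rhs.eval σ)

/-- The policy domain of a program: the policy states `⟨m, s⟩` such that some action variable of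
`⟨m, s⟩` occurs in it. -/
def policyDomain (Γ : Program S A M AP) : Set (M × S) :=
  {p | ∃ γ ∈ Γ, ∃ α, γ.lhs.Occurs (.act p.1 p.2 α) ∨ γ.rhs.Occurs (.act p.1 p.2 α)}

/-- The variable of a labelled formula at a node, as an expression. -/
def xF (u : Name AP) (F : LForm S M AP) : Expr (Var S A M AP) := .var (.prob u F)

/-- The variable of an action in a policy state, as an expression. -/
def xA (m : M) (s : S) (α : A) : Expr (Var S A M AP) := .var (.act m s α)

/-- Comparing the probability of `⟨m, s⟩ : {ψ}` at the node `u` with the number `z`. -/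
def cmpConstr (u : Name AP) (m : M) (s : S) (ψ : Formula AP) (c : Cmp) (z : unitInterval) :
    Constr (Var S A M AP) :=
  ⟨xF u ⟨m, s, {ψ}⟩, .cmp c, .const z⟩

/-- Membership of such a comparison in a program modulo node names. -/
def HasCmp (Γ : Program S A M AP) (m : M) (s : S) (ψ : Formula AP) (c : Cmp)
    (z : unitInterval) : Prop :=
  ∃ u, cmpConstr u m s ψ c z ∈ Γ

/-- The action `α` is not applied in `⟨m, s⟩`. -/
def actZero (m : M) (s : S) (α : A) : Constr (Var S A M AP) := ⟨xA m s α, .eq, .const 0⟩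

/-- The action `α` is applied in `⟨m, s⟩` with nonzero probability. -/
def actPos (m : M) (s : S) (α : A) : Constr (Var S A M AP) := ⟨xA m s α, .cmp .gt, .const 0⟩

/-- The actions prescribed in `⟨m, s⟩` by a program. -/
noncomputable def prescribed [Fintype A] (Γ : Program S A M AP) (m : M) (s : S) : Finset A :=
  open Classical in Finset.univ.filter (fun α => actPos m s α ∈ Γ)

/-- The prescribed actions have total probability one. -/
noncomputable def prescribedConstr [Fintype A] (Γ : Program S A M AP) (m : M) (s : S) :
    Constr (Var S A M AP) :=
  ⟨Expr.sum (prescribed Γ m s) (fun α => xA m s α), .eq, .const 1⟩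

/-- The states reachable from `s` with nonzero probability by applying `α`. -/
noncomputable def succ [Fintype S] (D : MDP S A AP) (s : S) (α : A) : Finset S :=
  open Classical in Finset.univ.filter (fun t => 0 < D.P s α t)

end Programs

/-! ## Inference rules -/

/-- The name and the pivot of a node labelled with a sequent. -/
structure Anc (S M AP : Type*) where
  name : Name AP
  pivot : LForm S M AP

/-- The leaf of a branch under construction, labelled with the sequent `prog ⊢ pivot`;
`anc` lists its proper ancestors. Don't-know rules only enlarge the program, so their conclusions
are regarded as the same node, with a larger program. -/
structure Leaf (S A M AP : Type*) extends Anc S M AP where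
  prog : Program S A M AP
  anc : List (Anc S M AP)

/-- Pseudo-sequents; the loop ones carry the name of the node their backlink points to. -/
inductive Pseudo (AP : Type*)
  | cross
  | check
  | yesLoop (v : Name AP)
  | noLoop (v : Name AP)

/-- What an inference rule does to a leaf `Γ ⊢ ⟨m, s⟩ : Ψ`. -/
inductive Outcome (S A M AP : Type*)
  /-- One conclusion, a pseudo-sequent with program `Γ, γ`. -/
  | close (γ : Constr (Var S A M AP)) (k : Pseudo AP)
  /-- Union branching into the given pivots; the program is `Γ, γ` in the last conclusion and `Γ`
  in the others. `byX` records that this is the rule for transitions into successor states. -/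
  | union (byX : Bool) (concl : List (LForm S M AP)) (γ : Constr (Var S A M AP))
  /-- Don't-know branching with programs `Γ, γl` and `Γ, γr`. -/
  | dontKnow (γl γr : Constr (Var S A M AP))
  /-- One conclusion, with the same pivot and the program `Γ, γ`. -/
  | extend (γ : Constr (Var S A M AP))
  /-- Recursive call for `P_{c z} ψ`, followed by don't-know branching on its truth value. -/
  | call (c : Cmp) (z : unitInterval) (ψ : Formula AP)

section Rules

variable {S A M AP : Type*}

/-- The name of the `i`-th child of a node. -/
def childName (u : Name AP) (i : ℕ) : Name AP := u ++ [Step.child i]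

/-- `u` is a proper ancestor of `v`, for nodes `u` and `v` on a branch. -/
def Name.Above (u v : Name AP) : Prop := u <+: v ∧ u ≠ v

namespace Leaf

/-- The pivot of the leaf with the formula `ψ` replaced by the formulas in `Ψ`. -/
def replace (l : Leaf S A M AP) (ψ : Formula AP) (Ψ : Set (Formula AP)) : LForm S M AP :=
  ⟨l.pivot.mode, l.pivot.state, Ψ ∪ (l.pivot.fmls \ {ψ})⟩

/-- The unary union rule with conclusion pivot `F`; the probabilities of premise and conclusion
are equated. -/
def one (l : Leaf S A M AP) (F : LForm S M AP) : Outcome S A M AP :=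
  .union false [F] ⟨xF l.name l.pivot, .eq, xF (childName l.name 0) F⟩

/-- The binary union rule with conclusion pivots `F` and `G`; the probabilities of the conclusions
are added up. -/
def two (l : Leaf S A M AP) (F G : LForm S M AP) : Outcome S A M AP :=
  .union false [F, G] ⟨xF l.name l.pivot, .eq,
    .add (xF (childName l.name 0) F) (xF (childName l.name 1) G)⟩

/-- The probability of the pivot is the number `c`. -/
def pivotEq (l : Leaf S A M AP) (c : ℝ) : Constr (Var S A M AP) :=
  ⟨xF l.name l.pivot, .eq, .const c⟩

end Leaf

/-- Poised pivots: `{X ψ₁, …, X ψₙ}` with `n ≥ 1`. -/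
def LForm.Poised (F : LForm S M AP) : Prop :=
  F.fmls.Nonempty ∧ ∀ ψ ∈ F.fmls, ∃ χ, ψ = Formula.next χ

/-- The set `Ψ` when the formula set of the pivot is `X Ψ`. -/
def LForm.unnext (F : LForm S M AP) : Set (Formula AP) := {ψ | Formula.next ψ ∈ F.fmls}

/-- `w` is yes-blocked by its ancestor `v`. -/
def Leaf.YesBlocked (w : Leaf S A M AP) (v : Anc S M AP) : Prop :=
  v ∈ w.anc ∧ v.pivot = w.pivot ∧
    ∀ ψ₁ ψ₂, Formula.next (.untl ψ₁ ψ₂) ∈ v.pivot.fmls →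
      ∃ x ∈ w.toAnc :: w.anc, v.name.Above x.name ∧ ψ₂ ∈ x.pivot.fmls

/-- `w` is no-blocked by its ancestor `u`. -/
def Leaf.NoBlocked (w : Leaf S A M AP) (u : Anc S M AP) : Prop :=
  u ∈ w.anc ∧ ∃ v ∈ w.anc, u.name.Above v.name ∧ u.pivot = v.pivot ∧ v.pivot = w.pivot ∧
    ∀ ψ₁ ψ₂, Formula.next (.untl ψ₁ ψ₂) ∈ u.pivot.fmls →
      (∃ x ∈ w.toAnc :: w.anc, v.name.Above x.name ∧ ψ₂ ∈ x.pivot.fmls) →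
      ∃ y ∈ w.toAnc :: w.anc,
        u.name.Above y.name ∧ (y.name = v.name ∨ y.name.Above v.name) ∧ ψ₂ ∈ y.pivot.fmls

/-- The simplification equivalences for `P`-formulas, from left to right. -/
inductive Simplifies : Cmp → unitInterval → Formula AP → Formula AP → Prop
  | ge_zero (ψ) : Simplifies .ge 0 ψ .tt
  | gt_one (ψ) : Simplifies .gt 1 ψ .ff
  | le_one (ψ) : Simplifies .le 1 ψ .tt
  | lt_zero (ψ) : Simplifies .lt 0 ψ .ff
  | ge_prob (u c z ψ) : u ≠ 0 → Simplifies .ge u (.prob c z ψ) (.prob c z ψ)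
  | gt_prob (u c z ψ) : u ≠ 1 → Simplifies .gt u (.prob c z ψ) (.prob c z ψ)
  | le_prob (u c z ψ) :
      Simplifies .le u (.prob c z ψ) (.prob .ge (unitInterval.symm u) (.prob c.compl z ψ))
  | lt_prob (u c z ψ) :
      Simplifies .lt u (.prob c z ψ) (.prob .gt (unitInterval.symm u) (.prob c.compl z ψ))

/-- The rule for transitions into successor states, where `ts` enumerates the successor states
under the prescribed actions. -/
noncomputable def nextOutcome [Fintype S] [Fintype A] (D : MDP S A AP) (π : PartialPolicy S M)
    (l : Leaf S A M AP) (ts : List S) : Outcome S A M AP :=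
  open Classical in
  let m := l.pivot.mode
  let s := l.pivot.state
  let concl : S → LForm S M AP := fun t => ⟨π.delta m s, t, l.pivot.unnext⟩
  .union true (ts.map concl) ⟨xF l.name l.pivot, .eq,
    Expr.sum (prescribed l.prog m s) (fun α => .mul (xA m s α)
      (Expr.sum (succ D s α) (fun t =>
        .mul (.const (D.P s α t)) (xF (childName l.name (ts.idxOf t)) (concl t)))))⟩

/-- `Rule D π l n o`: the inference rule of preference rank `n` (lower ranks are preferred) is
applicable to the leaf `l` with outcome `o`. -/
inductive Rule [Fintype S] [Fintype A] (D : MDP S A AP) (π : PartialPolicy S M)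
    (l : Leaf S A M AP) : ℕ → Outcome S A M AP → Prop
  | top (ψ) : ψ ∈ l.pivot.fmls → ψ.IsClassical → ψ.EvalClassical (D.label l.pivot.state) →
      Rule D π l 0 (l.one (l.replace ψ ∅))
  | cross (ψ) : ψ ∈ l.pivot.fmls → ψ.IsClassical → ¬ ψ.EvalClassical (D.label l.pivot.state) →
      Rule D π l 1 (.close (l.pivotEq 0) .cross)
  | check : l.pivot.fmls = ∅ →
      Rule D π l 2 (.close (l.pivotEq 1) .check)
  | negNeg (ψ) : .neg (.neg ψ) ∈ l.pivot.fmls →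
      Rule D π l 3 (l.one (l.replace (.neg (.neg ψ)) {ψ}))
  | negP (c z ψ) : .neg (.prob c z ψ) ∈ l.pivot.fmls →
      Rule D π l 4 (l.one (l.replace (.neg (.prob c z ψ)) {.prob c.compl z ψ}))
  | pNeg (c z ψ) : .prob c z (.neg ψ) ∈ l.pivot.fmls →
      Rule D π l 5
        (l.one (l.replace (.prob c z (.neg ψ)) {.prob c.flip (unitInterval.symm z) ψ}))
  | and (ψ₁ ψ₂) : .and ψ₁ ψ₂ ∈ l.pivot.fmls →
      Rule D π l 6 (l.one (l.replace (.and ψ₁ ψ₂) {ψ₁, ψ₂}))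
  | negAnd (ψ₁ ψ₂) : .neg (.and ψ₁ ψ₂) ∈ l.pivot.fmls →
      Rule D π l 7 (l.two (l.replace (.neg (.and ψ₁ ψ₂)) {.neg ψ₁})
        (l.replace (.neg (.and ψ₁ ψ₂)) {ψ₁, .neg ψ₂}))
  | p1 (c z ψ ψ') : .prob c z ψ ∈ l.pivot.fmls → Simplifies c z ψ ψ' →
      Rule D π l 8 (l.one (l.replace (.prob c z ψ) {ψ'}))
  | p2 (c z ψ) : .prob c z ψ ∈ l.pivot.fmls → ψ.IsState → c = .gt ∨ c = .ge →
      Rule D π l 9 (l.one (l.replace (.prob c z ψ) {ψ}))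
  | p3 (c z ψ) : .prob c z ψ ∈ l.pivot.fmls → ψ.IsState → c = .lt ∨ c = .le →
      Rule D π l 10 (l.one (l.replace (.prob c z ψ) {.neg ψ}))
  | p (c z ψ) : .prob c z ψ ∈ l.pivot.fmls →
      ¬ HasCmp l.prog l.pivot.mode l.pivot.state ψ c z →
      ¬ HasCmp l.prog l.pivot.mode l.pivot.state ψ c.compl z →
      Rule D π l 11 (.call c z ψ)
  | pTop (c z ψ) : .prob c z ψ ∈ l.pivot.fmls →
      HasCmp l.prog l.pivot.mode l.pivot.state ψ c z →
      Rule D π l 12 (l.one (l.replace (.prob c z ψ) ∅))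
  | pCross (c z ψ) : .prob c z ψ ∈ l.pivot.fmls →
      HasCmp l.prog l.pivot.mode l.pivot.state ψ c.compl z →
      Rule D π l 13 (.close (l.pivotEq 0) .cross)
  | untl (ψ₁ ψ₂) : .untl ψ₁ ψ₂ ∈ l.pivot.fmls →
      Rule D π l 14 (l.two (l.replace (.untl ψ₁ ψ₂) {ψ₂})
        (l.replace (.untl ψ₁ ψ₂) {ψ₁, .neg ψ₂, .next (.untl ψ₁ ψ₂)}))
  | negUntl (ψ₁ ψ₂) : .neg (.untl ψ₁ ψ₂) ∈ l.pivot.fmls →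
      Rule D π l 15 (l.two (l.replace (.neg (.untl ψ₁ ψ₂)) {.neg ψ₁, .neg ψ₂})
        (l.replace (.neg (.untl ψ₁ ψ₂)) {ψ₁, .neg ψ₂, .next (.neg (.untl ψ₁ ψ₂))}))
  | negNext (ψ) : .neg (.next ψ) ∈ l.pivot.fmls →
      Rule D π l 16 (l.one (l.replace (.neg (.next ψ)) {.next (.neg ψ)}))
  | a (α) : l.pivot.Poised → α ∈ D.enabled l.pivot.state →
      actZero l.pivot.mode l.pivot.state α ∉ l.prog →
      actPos l.pivot.mode l.pivot.state α ∉ l.prog →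
      Rule D π l 17 (.dontKnow (actZero l.pivot.mode l.pivot.state α)
        (actPos l.pivot.mode l.pivot.state α))
  | prescribed : l.pivot.Poised →
      prescribedConstr l.prog l.pivot.mode l.pivot.state ∉ l.prog →
      Rule D π l 18 (.extend (prescribedConstr l.prog l.pivot.mode l.pivot.state))
  | yesLoop (v) : l.pivot.Poised → l.YesBlocked v →
      Rule D π l 19
        (.close ⟨xF l.name l.pivot, .eq, xF v.name l.pivot⟩ (.yesLoop v.name))
  | noLoop (v) : l.pivot.Poised → l.NoBlocked v →
      Rule D π l 20
        (.close ⟨xF l.name l.pivot, .eq, xF v.name l.pivot⟩ (.noLoop v.name))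
  | next (ts : List S) : l.pivot.Poised → ts.Nodup →
      (∀ t, t ∈ ts ↔ ∃ α ∈ prescribed l.prog l.pivot.mode l.pivot.state,
        t ∈ succ D l.pivot.state α) →
      Rule D π l 21 (nextOutcome D π l ts)

/-- Every leaf labelled with a sequent admits some inference rule. -/
theorem exists_rule [Fintype S] [Fintype A] (D : MDP S A AP) (π : PartialPolicy S M)
    (l : Leaf S A M AP) : ∃ n o, Rule D π l n o := by
  classical
  by_cases h0 : l.pivot.fmls = ∅
  · exact ⟨_, _, .check h0⟩
  by_cases hX : ∀ ψ ∈ l.pivot.fmls, ∃ χ, ψ = Formula.next χ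
  · refine ⟨_, _, .next (Finset.univ.filter (fun t => ∃ α ∈ prescribed l.prog l.pivot.mode
      l.pivot.state, t ∈ succ D l.pivot.state α)).toList
      ⟨Set.nonempty_iff_ne_empty.2 h0, hX⟩ (Finset.nodup_toList _) fun t => ?_⟩
    simp
  push Not at hX
  obtain ⟨ψ, hψ, hne⟩ := hX
  have classicalCase : ψ.IsClassical → ∃ n o, Rule D π l n o := fun hc => by
    by_cases he : ψ.EvalClassical (D.label l.pivot.state)
    · exact ⟨_, _, .top ψ hψ hc he⟩
    · exact ⟨_, _, .cross ψ hψ hc he⟩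
  cases ψ with
  | tt => exact classicalCase trivial
  | atom a => exact classicalCase trivial
  | and ψ₁ ψ₂ => exact ⟨_, _, .and ψ₁ ψ₂ hψ⟩
  | prob c z ψ =>
    by_cases h1 : HasCmp l.prog l.pivot.mode l.pivot.state ψ c z
    · exact ⟨_, _, .pTop c z ψ hψ h1⟩
    by_cases h2 : HasCmp l.prog l.pivot.mode l.pivot.state ψ c.compl z
    · exact ⟨_, _, .pCross c z ψ hψ h2⟩
    exact ⟨_, _, .p c z ψ hψ h1 h2⟩
  | next χ => exact absurd rfl (hne χ)
  | untl ψ₁ ψ₂ => exact ⟨_, _, .untl ψ₁ ψ₂ hψ⟩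
  | neg ψ =>
    cases ψ with
    | tt => exact classicalCase trivial
    | atom a => exact classicalCase trivial
    | neg ψ => exact ⟨_, _, .negNeg ψ hψ⟩
    | and ψ₁ ψ₂ => exact ⟨_, _, .negAnd ψ₁ ψ₂ hψ⟩
    | prob c z ψ => exact ⟨_, _, .negP c z ψ hψ⟩
    | next χ => exact ⟨_, _, .negNext χ hψ⟩
    | untl ψ₁ ψ₂ => exact ⟨_, _, .negUntl ψ₁ ψ₂ hψ⟩

/-- A strategy resolves the don't-care choices of the procedure: it selects for every leaf an
applicable inference with the most preferred rule. -/
structure Strategy [Fintype S] [Fintype A] (D : MDP S A AP) (π : PartialPolicy S M) where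
  pick : Leaf S A M AP → Outcome S A M AP
  admissible : ∀ l, ∃ n, Rule D π l n (pick l) ∧ ∀ n' o', Rule D π l n' o' → n ≤ n'

instance [Fintype S] [Fintype A] (D : MDP S A AP) (π : PartialPolicy S M) :
    Nonempty (Strategy D π) := by
  classical
  have h : ∀ l, ∃ o, ∃ n, Rule D π l n o ∧ ∀ n' o', Rule D π l n' o' → n ≤ n' := fun l => by
    obtain ⟨o, ho⟩ := Nat.find_spec (exists_rule D π l)
    exact ⟨o, _, ho, fun n' o' h' => Nat.find_min' _ ⟨o', h'⟩⟩
  choose f hf using h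
  exact ⟨⟨f, hf⟩⟩

end Rules

/-! ## Tableaux without don't-know branching, forcing and programs -/

/-- The label of a tableau node without its program. -/
inductive Label (S M AP : Type*)
  | seq (F : LForm S M AP)
  | pseudo (k : Pseudo AP)

/-- A tableau node: its name, its program, the rest of its label, and whether the rule for
transitions into successor states was applied to it. -/
structure TNode (S A M AP : Type*) where
  name : Name AP
  prog : Program S A M AP
  label : Label S M AP
  byX : Bool

/-- A tableau from which the don't-know branching has been removed, given by its nodes; the
tree structure is that of the node names. -/
abbrev Tab (S A M AP : Type*) := Set (TNode S A M AP)

namespace Tab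

variable {S A M AP : Type*}

/-- `b` is a child of `a`. -/
def IsChild (a b : TNode S A M AP) : Prop := ∃ i, b.name = childName a.name i

/-- The node `a` is a leaf. -/
def IsLeaf (T : Tab S A M AP) (a : TNode S A M AP) : Prop :=
  a ∈ T ∧ ∀ b ∈ T, ¬ IsChild a b

/-- The subtree rooted at `u`, without backlinks. -/
def subtree (T : Tab S A M AP) (u : TNode S A M AP) : Set (TNode S A M AP) :=
  {w | w ∈ T ∧ u.name <+: w.name}

/-- `b` is an `X`-successor of `a`. -/
def XLink (T : Tab S A M AP) (a b : TNode S A M AP) : Prop :=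
  a ∈ T ∧ b ∈ T ∧ a.byX = true ∧ IsChild a b

/-- `u` is a 0-deadend. -/
def ZeroDeadend (T : Tab S A M AP) (u : TNode S A M AP) : Prop :=
  u ∈ T ∧ (∀ a ∈ T.subtree u, ∀ b ∈ T.subtree u, ¬ T.XLink a b) ∧
    ∀ w ∈ T.subtree u, T.IsLeaf w → w.label = .pseudo .cross

/-- `u` is ambiguous. -/
def Ambiguous (T : Tab S A M AP) (u : TNode S A M AP) : Prop :=
  (∀ w ∈ T.subtree u, w.label ≠ .pseudo .check) ∧
    ∀ w ∈ T.subtree u, (∃ a, T.XLink a w) → ¬ T.ZeroDeadend w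

/-- The nodes in the 0-deadends. -/
def zero (T : Tab S A M AP) : Set (TNode S A M AP) := {w | ∃ d, T.ZeroDeadend d ∧ w ∈ T.subtree d}

/-- The edges of the graph for the analysis of strongly connected components: tree edges and
backlinks, where the nodes in 0-deadends are ignored. -/
def Edge (T : Tab S A M AP) (a b : TNode S A M AP) : Prop :=
  a ∈ T \ T.zero ∧ b ∈ T \ T.zero ∧
    (IsChild a b ∨ a.label = .pseudo (.yesLoop b.name) ∨ a.label = .pseudo (.noLoop b.name))

/-- `C` is strongly connected. -/
def StronglyConnected (T : Tab S A M AP) (C : Set (TNode S A M AP)) : Prop :=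
  ∀ a ∈ C, ∀ b ∈ C, Relation.ReflTransGen (fun x y => x ∈ C ∧ y ∈ C ∧ T.Edge x y) a b

/-- `C` is a bottom strongly connected component. -/
def IsBscc (T : Tab S A M AP) (C : Set (TNode S A M AP)) : Prop :=
  C ⊆ T \ T.zero ∧ T.StronglyConnected C ∧
    (∀ C', C ⊆ C' → C' ⊆ T \ T.zero → T.StronglyConnected C' → C' = C) ∧
    ∀ a ∈ C, ∀ b, Relation.ReflTransGen T.Edge a b → b ∈ C

/-- `u`, with pivot `F`, is the root of a bottom strongly connected component. -/
def IsBsccRoot (T : Tab S A M AP) (u : TNode S A M AP) (F : LForm S M AP) : Prop :=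
  u ∈ T ∧ u.label = .seq F ∧ F.Poised ∧ T.Ambiguous u ∧ T.IsBscc (T.subtree u \ T.zero)

/-- The subtree rooted at `u` has a leaf closed by a yes-loop. -/
def HasYesLoop (T : Tab S A M AP) (u : TNode S A M AP) : Prop :=
  ∃ w ∈ T.subtree u, ∃ v, w.label = .pseudo (.yesLoop v)

/-- The constraints that force probabilities at roots of bottom strongly connected components. -/
def force (T : Tab S A M AP) : Program S A M AP :=
  {γ | ∃ u F, T.IsBsccRoot u F ∧
    ((T.HasYesLoop u ∧ γ = ⟨xF u.name F, .eq, .const 1⟩) ∨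
      (¬ T.HasYesLoop u ∧ γ = ⟨xF u.name F, .eq, .const 0⟩))}

/-- The program of a tableau: the union of the programs of the leaves, and the forcing
constraints. -/
def gamma (T : Tab S A M AP) : Program S A M AP :=
  {γ | ∃ w, T.IsLeaf w ∧ γ ∈ w.prog} ∪ T.force

end Tab

/-! ## Derivations -/

section Derivations

variable {S A M AP : Type*}

namespace Leaf

/-- The leaf as a tableau node to which a rule has been applied. -/
def toNode (l : Leaf S A M AP) (byX : Bool) : TNode S A M AP :=
  ⟨l.name, l.prog, .seq l.pivot, byX⟩

/-- The leaf with constraints added to its program. -/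
def addConstrs (l : Leaf S A M AP) (Γ : Program S A M AP) : Leaf S A M AP :=
  { l with prog := l.prog ∪ Γ }

/-- The pseudo-sequent child of a leaf. -/
def closed (l : Leaf S A M AP) (γ : Constr (Var S A M AP)) (k : Pseudo AP) : TNode S A M AP :=
  ⟨childName l.name 0, l.prog ∪ {γ}, .pseudo k, false⟩

/-- The `i`-th conclusion of a union rule applied to a leaf. -/
def child (l : Leaf S A M AP) (concl : List (LForm S M AP)) (γ : Constr (Var S A M AP))
    (i : Fin concl.length) : Leaf S A M AP where
  name := childName l.name i
  pivot := concl.get i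
  prog := {γ' | γ' ∈ l.prog ∨ (i.val + 1 = concl.length ∧ γ' = γ)}
  anc := l.toAnc :: l.anc

/-- The name of the root of the recursive derivation for `P_{c z} ψ`. -/
def callName (l : Leaf S A M AP) (c : Cmp) (z : unitInterval) (ψ : Formula AP) : Name AP :=
  l.name ++ [Step.call (.prob c z ψ)]

/-- The initial leaf `∅ ⊢ ⟨m, s⟩ : {ψ}` of the recursive derivation for `P_{c z} ψ`. -/
def callLeaf (l : Leaf S A M AP) (c : Cmp) (z : unitInterval) (ψ : Formula AP) :
    Leaf S A M AP where
  name := l.callName c z ψ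
  pivot := ⟨l.pivot.mode, l.pivot.state, {ψ}⟩
  prog := ∅
  anc := []

end Leaf

/-- `Derives strat l T`: developing the leaf `l` by the strategy `strat`, some sequence of
don't-know choices yields the finished tableau `T` below (and including) `l`. -/
inductive Derives [Fintype S] [Fintype A] {D : MDP S A AP} {π : PartialPolicy S M}
    (strat : Strategy D π) : Leaf S A M AP → Tab S A M AP → Prop
  | close (l γ k) : strat.pick l = .close γ k →
      Derives strat l {l.toNode false, l.closed γ k}
  | union (l byX concl γ) (Ts : Fin (List.length concl) → Tab S A M AP) :
      strat.pick l = .union byX concl γ →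
      (∀ i, Derives strat (l.child concl γ i) (Ts i)) →
      Derives strat l ({l.toNode byX} ∪ ⋃ i, Ts i)
  | left (l γl γr T) : strat.pick l = .dontKnow γl γr →
      Derives strat (l.addConstrs {γl}) T → Derives strat l T
  | right (l γl γr T) : strat.pick l = .dontKnow γl γr →
      Derives strat (l.addConstrs {γr}) T → Derives strat l T
  | extend (l γ T) : strat.pick l = .extend γ →
      Derives strat (l.addConstrs {γ}) T → Derives strat l T
  | callLeft (l c z ψ T' T) : strat.pick l = .call c z ψ →
      Derives strat (l.callLeaf c z ψ) T' →
      Derives strat (l.addConstrs (Tab.gamma T' ∪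
        {cmpConstr (l.callName c z ψ) l.pivot.mode l.pivot.state ψ c z})) T →
      Derives strat l T
  | callRight (l c z ψ T' T) : strat.pick l = .call c z ψ →
      Derives strat (l.callLeaf c z ψ) T' →
      Derives strat (l.addConstrs (Tab.gamma T' ∪
        {cmpConstr (l.callName c z ψ) l.pivot.mode l.pivot.state ψ c.compl z})) T →
      Derives strat l T

/-- The initial leaf for a state formula `φ`, whose program forces `φ` to be true. -/
def initialLeaf [Fintype S] (D : MDP S A AP) (π : PartialPolicy S M) (φ : Formula AP) :
    Leaf S A M AP where
  name := []
  pivot := ⟨π.start D.init, D.init, {φ}⟩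
  prog := {⟨xF [] ⟨π.start D.init, D.init, {φ}⟩, .eq, .const 1⟩}
  anc := []

/-- `Γ` is a result `Gamma (Choose (Tableau …))` of the synthesis procedure for `φ`, where the
inference rules are applied as told by `strat`. -/
def IsFinalProgram [Fintype S] [Fintype A] {D : MDP S A AP} {π : PartialPolicy S M}
    (strat : Strategy D π) (φ : Formula AP) (Γ : Program S A M AP) : Prop :=
  ∃ T, Derives strat (initialLeaf D π φ) T ∧ Γ = Tab.gamma T

/-- `π'` is a policy completed by `σ`: its action probabilities are given by `σ` on the policy
domain of `Γ` and are arbitrary elsewhere. -/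
def IsCompletedBy [Fintype S] [Fintype A] {D : MDP S A AP} (π : PartialPolicy S M)
    (Γ : Program S A M AP) (σ : Var S A M AP → ℝ) (π' : Policy D M) : Prop :=
  π'.toPartialPolicy = π ∧
    ∀ m s, (m, s) ∈ policyDomain Γ → ∀ α, π'.act m s α = σ (.act m s α)

end Derivations

end PCTLSynth

open PCTLSynth

set_option linter.unusedSectionVars false


namespace PCTLSynth

/-! ## The run measure of a finite chain -/

/-! Every don't-know choice is resolved by what is true under `π`: an action is declared unused or
used according to `π.act`, and a comparison for a `P`-formula is chosen according to its actual
probability. The valuation `Policy.val` gives `x_u^F` the probability that a run from the policy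
state of `F` satisfies the formulas of `F`, whatever the node `u`, and gives each action variable
its probability under `π`. Three things have to be shown.

Termination (`exists_guided`). All pivots consist of formulas of a finite closure `cl φ`, recursive
calls lower the nesting of `P`, expansions lower a weight in which `X`-formulas count nothing, and
each transition from a poised node that is not blocked adds to a finite stock of facts about
repeated pivots (`exists_new_record`).

Solution (`Guided.sat`, `IsTree.sat_gamma`). The local equations hold because expansions are
equivalences with exclusive alternatives, transitions obey the law of total probability, and loops
equate probabilities of equal pivots. The forcing constraints need an analysis of runs. A run that
satisfies the pivot of a node can be followed through the tableau, either to a check leaf or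
forever, jumping back to an ancestor at each loop; the latter is an infinite `Walk`. The pivots of a
walk are all true exactly if every postponed until formula is fulfilled later (`Walk.fair_of_sat`,
`Walk.sat_of_fair`). In a bottom component each node is reached almost surely from every other one.
Hence if there is a yes-loop, almost every run has a walk that takes it infinitely often, which
fulfils all until formulas, and the probability is one (`IsComponent.pr_eq_one`). Without yes-loops,
a satisfying run would give a true walk that only takes no-loops. No-loops cut out detours without
losing fulfilments, so some node of the walk would be yes-blocked after all; the probability is zero
(`IsComponent.pr_eq_zero`).

Completed policies (`pr_eq_of_sound`, `Guided.right`). Let `π'` agree with `π` on the policy domain,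
and let `X` be the set of policy states where the two agree. Whether a check leaf is reached is
settled before the run leaves `X`. A run with an infinite walk stays in `X` forever, and the
fulfilment of until formulas along the walk does not mention the policy. On events of both kinds the
two chains have the same probabilities. By induction over recursive calls, all decisions about
`P`-formulas are therefore true for `π'` as well, and at the root `φ` has probability one under
`π'`. As the solution is given explicitly, no uniqueness of solutions is involved. -/

/-- The path without its first state. -/
def tail {Q : Type*} (r : ℕ → Q) : ℕ → Q := fun i => r (1 + i)

/-- The path with a state put in front. -/
def cons {Q : Type*} (p : Q) (r : ℕ → Q) : ℕ → Q
  | 0 => p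
  | i + 1 => r i

@[simp] theorem tail_cons {Q : Type*} (p : Q) (r : ℕ → Q) : tail (cons p r) = r := by
  funext i
  simp [tail, cons, Nat.add_comm 1 i]

@[simp] theorem cons_zero {Q : Type*} (p : Q) (r : ℕ → Q) : cons p r 0 = p := rfl

@[simp] theorem cons_succ {Q : Type*} (p : Q) (r : ℕ → Q) (i : ℕ) : cons p r (i + 1) = r i := rfl

theorem tail_apply {Q : Type*} (r : ℕ → Q) (i : ℕ) : tail r i = r (i + 1) := by
  simp [tail, Nat.add_comm]

theorem cons_tail {Q : Type*} (r : ℕ → Q) : cons (r 0) (tail r) = r := by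
  funext i
  cases i with
  | zero => rfl
  | succ i => simp [tail_apply]

/-- Finite state spaces carry the discrete σ-algebra. -/
@[reducible] def discreteMS (Q : Type*) : MeasurableSpace Q := ⊤

namespace Chain

open MeasureTheory ProbabilityTheory
open scoped ENNReal

section

attribute [local instance] discreteMS

variable {Q AP : Type*} [Fintype Q] (C : Chain Q AP)

instance instDiscrete (Q : Type*) : DiscreteMeasurableSpace Q := ⟨fun _ => trivial⟩

/-- Measurable sets of paths. -/
def Meas (E : Set (ℕ → Q)) : Prop := MeasurableSet E

theorem isProb_runMeasure (p : Q) : IsProbabilityMeasure (C.runMeasure p) := by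
  have := C.isMarkovKernel_kernel
  unfold runMeasure
  infer_instance

/-- The paths that agree with `a` up to time `n`. -/
def cyl (n : ℕ) (a : ℕ → Q) : Set (ℕ → Q) := {r | ∀ i ≤ n, r i = a i}

theorem measurable_cyl (n : ℕ) (a : ℕ → Q) : MeasurableSet (cyl n a) := by
  have : cyl n a = ⋂ i ∈ Finset.range (n + 1), (fun r : ℕ → Q => r i) ⁻¹' {a i} := by
    ext r; simp [cyl]
  rw [this]
  exact Finset.measurableSet_biInter _ fun i _ => measurable_pi_apply i (MeasurableSet.of_discrete)

theorem measurable_cons (p : Q) : Measurable (cons p) := by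
  refine measurable_pi_lambda _ fun i => ?_
  cases i with
  | zero => exact measurable_const
  | succ i => exact measurable_pi_apply i

theorem measurable_tail : Measurable (tail : (ℕ → Q) → (ℕ → Q)) :=
  measurable_pi_lambda _ fun i => measurable_pi_apply _

open Classical in
theorem runMeasure_cyl_zero (p : Q) (a : ℕ → Q) :
    C.runMeasure p (cyl 0 a) = if a 0 = p then 1 else 0 := by
  have hK := C.isMarkovKernel_kernel
  have h := Kernel.traj_map_frestrictLe_apply (X := fun _ => Q) (κ := C.kernel) 0 0 (fun _ => p)
  have hs : cyl 0 a = Preorder.frestrictLe (π := fun _ => Q) 0 ⁻¹'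
      {h | h ⟨0, Finset.mem_Iic.2 le_rfl⟩ = a 0} := by
    ext r; simp [cyl]
  have hm : MeasurableSet {h : (i : Finset.Iic 0) → (fun _ : ℕ => Q) i |
      h ⟨0, Finset.mem_Iic.2 le_rfl⟩ = a 0} := MeasurableSet.of_discrete
  unfold runMeasure
  rw [hs, ← Measure.map_apply (by fun_prop) hm, h, Kernel.partialTraj_self, Kernel.id_apply,
    Measure.dirac_apply' _ hm]
  simp [Set.indicator, eq_comm]

/-- The joint law of the path up to time `n` and the next state is a composition product with the
kernel, which is constant on the cylinder because it reads the last state only. -/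
theorem runMeasure_cyl_succ (p : Q) (n : ℕ) (a : ℕ → Q) :
    C.runMeasure p (cyl (n + 1) a) =
      C.runMeasure p (cyl n a) * ENNReal.ofReal (C.trans (a n) (a (n + 1))) := by
  classical
  have hK := C.isMarkovKernel_kernel
  have h := Kernel.partialTraj_compProd_eq_map_traj (X := fun _ => Q) (κ := C.kernel)
    (Nat.zero_le n) (x₀ := fun _ => p)
  have h' := Kernel.traj_map_frestrictLe_apply (X := fun _ => Q) (κ := C.kernel) 0 n (fun _ => p)
  let A : Set ((i : Finset.Iic n) → (fun _ : ℕ => Q) i) := {h | ∀ i, h i = a i}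
  have hA : MeasurableSet A := MeasurableSet.of_discrete
  have hB : MeasurableSet ({a (n + 1)} : Set Q) := MeasurableSet.of_discrete
  have hs : cyl (n + 1) a = (fun x : ℕ → Q => (Preorder.frestrictLe (π := fun _ => Q) n x, x (n + 1)))
      ⁻¹' (A ×ˢ {a (n + 1)}) := by
    ext r
    simp only [cyl, Set.mem_ofPred_eq, Set.mem_preimage, Set.mem_prod, Set.mem_singleton_iff, A]
    constructor
    · exact fun h => ⟨fun i => h i ((Finset.mem_Iic.1 i.2).trans (Nat.le_succ n)), h _ le_rfl⟩
    · rintro ⟨h1, h2⟩ i hi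
      rcases Nat.le_succ_iff.1 hi with hi | rfl
      · exact h1 ⟨i, Finset.mem_Iic.2 hi⟩
      · exact h2
  have hs' : cyl n a = Preorder.frestrictLe (π := fun _ => Q) n ⁻¹' A := by
    ext r
    simp only [cyl, Set.mem_ofPred_eq, Set.mem_preimage, A]
    exact ⟨fun h i => h i (Finset.mem_Iic.1 i.2), fun h i hi => h ⟨i, Finset.mem_Iic.2 hi⟩⟩
  unfold runMeasure
  rw [hs, ← Measure.map_apply (by fun_prop) (hA.prod hB), ← h, Measure.compProd_apply_prod hA hB,
    hs', ← Measure.map_apply (by fun_prop) hA, h']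
  have hc : ∀ x ∈ A, (C.kernel n) x {a (n + 1)} = ENNReal.ofReal (C.trans (a n) (a (n + 1))) := by
    intro x hx
    have hx' : x ⟨n, Finset.mem_Iic.2 le_rfl⟩ = a n := hx _
    change (C.next (x ⟨n, Finset.mem_Iic.2 le_rfl⟩)).toMeasure {a (n + 1)} = _
    rw [hx', PMF.toMeasure_apply_singleton _ _ hB]
    rfl
  rw [setLIntegral_congr_fun hA hc, setLIntegral_const, mul_comm]

/-- The empty set and the cylinders. -/
def cyls : Set (Set (ℕ → Q)) := {B | B = ∅ ∨ ∃ n a, B = cyl n a}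

/-- Two cylinders with a common path `r` meet in the cylinder around `r` of the larger length. -/
theorem isPiSystem_cyls : IsPiSystem (cyls : Set (Set (ℕ → Q))) := by
  rintro _ (rfl | ⟨n, a, rfl⟩) _ (rfl | ⟨m, b, rfl⟩) ⟨r, hr1, hr2⟩
  · exact hr1.elim
  · exact hr1.elim
  · exact hr2.elim
  · refine Or.inr ⟨max n m, r, ?_⟩
    ext s
    simp only [cyl, Set.mem_inter_iff, Set.mem_ofPred_eq] at *
    constructor
    · rintro ⟨h1, h2⟩ i hi
      rcases le_max_iff.1 hi with h | h
      · rw [h1 i h, hr1 i h]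
      · rw [h2 i h, hr2 i h]
    · intro h
      exact ⟨fun i hi => by rw [h i (hi.trans (le_max_left _ _)), hr1 i hi],
        fun i hi => by rw [h i (hi.trans (le_max_right _ _)), hr2 i hi]⟩

/-- As `Q` is finite, a condition on coordinate `i` is a finite union of cylinders, one for each
suitable word of length `i + 1`. -/
theorem generateFrom_cyls :
    (MeasurableSpace.pi : MeasurableSpace (ℕ → Q)) = MeasurableSpace.generateFrom cyls := by
  apply le_antisymm
  · refine iSup_le fun i => ?_
    rintro _ ⟨s, _, rfl⟩
    have : (fun r : ℕ → Q => r i) ⁻¹' s =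
        ⋃ h : {h : Fin (i + 1) → Q // h ⟨i, Nat.lt_succ_self i⟩ ∈ s},
          {r | ∀ j : Fin (i + 1), r j = h.1 j} := by
      ext r
      simp only [Set.mem_preimage, Set.mem_iUnion, Set.mem_ofPred_eq]
      constructor
      · exact fun h => ⟨⟨fun j => r j, h⟩, fun j => rfl⟩
      · rintro ⟨⟨h, hs⟩, hj⟩
        have := hj ⟨i, Nat.lt_succ_self i⟩
        simp only at this
        rwa [this]
    rw [this]
    -- The word is continued by its first letter, an arbitrary value that the cylinder up to time
    -- `i` does not see.
    refine MeasurableSet.iUnion fun h => MeasurableSpace.measurableSet_generateFrom (Or.inr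
      ⟨i, fun j => if hj : j < i + 1 then h.1 ⟨j, hj⟩ else h.1 ⟨0, Nat.succ_pos i⟩, ?_⟩)
    ext r
    simp only [cyl, Set.mem_ofPred_eq]
    constructor
    · intro hr j hj
      rw [dif_pos (Nat.lt_succ_of_le hj)]
      exact hr ⟨j, Nat.lt_succ_of_le hj⟩
    · intro hr j
      have := hr j (Nat.le_of_lt_succ j.2)
      rwa [dif_pos j.2] at this
  · apply MeasurableSpace.generateFrom_le
    rintro _ (rfl | ⟨n, a, rfl⟩)
    · exact MeasurableSet.empty
    · exact measurable_cyl n a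

/-- The Markov property at time one. -/
theorem runMeasure_eq_sum (p : Q) : C.runMeasure p =
    ∑ q, ENNReal.ofReal (C.trans p q) • (C.runMeasure q).map (cons p) := by
  classical
  have hP := C.isProb_runMeasure
  have hsum : ∑ q, ENNReal.ofReal (C.trans p q) = 1 := by
    rw [← ENNReal.ofReal_sum_of_nonneg fun q _ => C.trans_nonneg p q, C.trans_sum, ENNReal.ofReal_one]
  have hap : ∀ B, MeasurableSet B →
      (∑ q, ENNReal.ofReal (C.trans p q) • (C.runMeasure q).map (cons p)) B =
      ∑ q, ENNReal.ofReal (C.trans p q) * C.runMeasure q (cons p ⁻¹' B) := by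
    intro B hB
    rw [Measure.finsetSum_apply]
    refine Finset.sum_congr rfl fun q _ => ?_
    rw [Measure.smul_apply, Measure.map_apply (measurable_cons p) hB, smul_eq_mul]
  -- Finite measures that agree on cylinders are equal. Prepending `p` pulls a cylinder up to time
  -- `n + 1` that starts in `p` back to the cylinder up to time `n` around its tail; a cylinder that
  -- does not start in `p` is null on both sides.
  refine ext_of_generate_finite cyls generateFrom_cyls isPiSystem_cyls ?_ ?_
  · rintro _ (rfl | ⟨n, a, rfl⟩)
    · simp
    rw [hap _ (measurable_cyl n a)]
    by_cases ha : a 0 = p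
    · have hpre : ∀ n, cons p ⁻¹' cyl (n + 1) a = cyl n (tail a) := by
        intro n
        ext r
        simp only [cyl, Set.mem_preimage, Set.mem_ofPred_eq, tail_apply]
        constructor
        · exact fun h i hi => h (i + 1) (Nat.succ_le_succ hi)
        · intro h i hi
          cases i with
          | zero => exact ha.symm
          | succ i => exact h i (Nat.le_of_succ_le_succ hi)
      induction n with
      | zero =>
        have : cons p ⁻¹' cyl 0 a = Set.univ := by
          ext r; simp [cyl, ha]
        rw [runMeasure_cyl_zero, if_pos ha, this]
        simp [hsum]
      | succ n ih =>
        rw [runMeasure_cyl_succ, ih]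
        cases n with
        | zero =>
          have : cons p ⁻¹' cyl 0 a = Set.univ := by
            ext r; simp [cyl, ha]
          rw [this]
          simp only [measure_univ, mul_one, hsum, one_mul]
          rw [hpre]
          simp [runMeasure_cyl_zero, tail_apply, ha]
        | succ n =>
          simp only [hpre]
          rw [Finset.sum_mul]
          refine Finset.sum_congr rfl fun q _ => ?_
          rw [runMeasure_cyl_succ, tail_apply, tail_apply, mul_assoc]
    · have h0 : C.runMeasure p (cyl n a) = 0 := by
        refine measure_mono_null (t := cyl 0 a) (fun r hr i hi => hr i (hi.trans (Nat.zero_le n))) ?_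
        rw [runMeasure_cyl_zero, if_neg ha]
      have h1 : cons p ⁻¹' cyl n a = ∅ := by
        ext r
        simp only [cyl, Set.mem_preimage, Set.mem_ofPred_eq, Set.mem_empty_iff_false, iff_false]
        exact fun h => ha (h 0 (Nat.zero_le n)).symm
      rw [h0, h1]
      simp
  · rw [hap _ MeasurableSet.univ]
    simp [hsum]

theorem runMeasure_apply (p : Q) {B : Set (ℕ → Q)} (hB : Meas B) :
    C.runMeasure p B = ∑ q, ENNReal.ofReal (C.trans p q) * C.runMeasure q (cons p ⁻¹' B) := by
  conv_lhs => rw [runMeasure_eq_sum]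
  rw [Measure.finsetSum_apply]
  refine Finset.sum_congr rfl fun q _ => ?_
  rw [Measure.smul_apply, Measure.map_apply (measurable_cons p) hB, smul_eq_mul]

theorem ae_start (p : Q) : ∀ᵐ r ∂C.runMeasure p, r 0 = p := by
  have hP := C.isProb_runMeasure
  have h := C.runMeasure_cyl_zero p (fun _ => p)
  rw [if_pos rfl, ← prob_compl_eq_zero_iff (measurable_cyl 0 fun _ => p)] at h
  rw [ae_iff]
  refine measure_mono_null (fun r hr => ?_) h
  simpa [cyl] using hr

/-- At time zero, impossible successors carry no weight in `runMeasure_apply`; later times reduce to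
earlier ones by moving the start one step on. -/
theorem ae_isRun (p : Q) : ∀ᵐ r ∂C.runMeasure p, C.IsRun r := by
  unfold IsRun
  rw [ae_all_iff]
  intro i
  induction i generalizing p with
  | zero =>
    have hm : Meas {r : ℕ → Q | ¬ 0 < C.trans (r 0) (r 1)} :=
      (((measurable_pi_apply 0).prodMk (measurable_pi_apply 1)) :
        Measurable fun r : ℕ → Q => (r 0, r 1))
        (MeasurableSet.of_discrete (s := {x : Q × Q | ¬ 0 < C.trans x.1 x.2}))
    rw [ae_iff, runMeasure_apply _ _ hm]
    refine Finset.sum_eq_zero fun q _ => ?_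
    by_cases hq : 0 < C.trans p q
    · refine mul_eq_zero_of_right _ ?_
      have := C.ae_start q
      rw [ae_iff] at this
      refine measure_mono_null (fun r hr => ?_) this
      simp only [Set.mem_preimage, Set.mem_ofPred_eq, cons_zero, cons_succ] at hr ⊢
      exact fun h => hr (by rwa [h])
    · rw [ENNReal.ofReal_of_nonpos (not_lt.1 hq), zero_mul]
  | succ i ih =>
    have hm : Meas {r : ℕ → Q | ¬ 0 < C.trans (r (i + 1)) (r (i + 2))} :=
      (((measurable_pi_apply (i + 1)).prodMk (measurable_pi_apply (i + 2))) :
        Measurable fun r : ℕ → Q => (r (i + 1), r (i + 2)))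
        (MeasurableSet.of_discrete (s := {x : Q × Q | ¬ 0 < C.trans x.1 x.2}))
    rw [ae_iff, runMeasure_apply _ _ hm]
    refine Finset.sum_eq_zero fun q _ => mul_eq_zero_of_right _ ?_
    exact ae_iff.1 (ih q)

/-- Being a run from `p` is almost sure, so the restriction to such runs can be dropped, even if `E`
is not measurable. -/
theorem Pr_eq (p : Q) (E : Set (ℕ → Q)) : C.Pr p E = (C.runMeasure p E).toReal := by
  unfold Pr
  congr 1
  apply measure_congr
  filter_upwards [C.ae_start p, C.ae_isRun p] with r h1 h2
  exact propext ⟨fun h => h.2.2, fun h => ⟨h2, h1, h⟩⟩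

end

/-! ### Real-valued probabilities of events. -/

section

attribute [local instance] discreteMS

variable {Q AP : Type*} [Fintype Q] (C : Chain Q AP)

theorem Pr_nonneg (p : Q) (E : Set (ℕ → Q)) : 0 ≤ C.Pr p E := ENNReal.toReal_nonneg

theorem Pr_le_one (p : Q) (E : Set (ℕ → Q)) : C.Pr p E ≤ 1 := by
  have hP := C.isProb_runMeasure
  rw [Pr_eq]
  exact ENNReal.toReal_le_of_le_ofReal zero_le_one (by simpa using prob_le_one)

theorem Pr_congr {p : Q} {E E' : Set (ℕ → Q)}
    (h : ∀ r, C.IsRun r → r 0 = p → (r ∈ E ↔ r ∈ E')) : C.Pr p E = C.Pr p E' := by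
  rw [Pr_eq, Pr_eq]
  congr 1
  apply measure_congr
  filter_upwards [C.ae_start p, C.ae_isRun p] with r h1 h2
  exact propext (h r h2 h1)

theorem Pr_univ (p : Q) : C.Pr p Set.univ = 1 := by
  have hP := C.isProb_runMeasure
  rw [Pr_eq]; simp

theorem Pr_empty (p : Q) : C.Pr p ∅ = 0 := by
  rw [Pr_eq]; simp

theorem Pr_eq_one {p : Q} {E : Set (ℕ → Q)} (h : ∀ r, C.IsRun r → r 0 = p → r ∈ E) :
    C.Pr p E = 1 := by
  rw [← C.Pr_univ p]
  exact C.Pr_congr fun r h1 h2 => ⟨fun _ => trivial, fun _ => h r h1 h2⟩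

theorem Pr_eq_zero {p : Q} {E : Set (ℕ → Q)} (h : ∀ r, C.IsRun r → r 0 = p → r ∉ E) :
    C.Pr p E = 0 := by
  rw [← C.Pr_empty p]
  exact C.Pr_congr fun r h1 h2 => ⟨fun h3 => h r h1 h2 h3, fun h => h.elim⟩

theorem Pr_union {p : Q} {E E' : Set (ℕ → Q)} (hE' : Meas E')
    (h : ∀ r, r ∈ E → r ∈ E' → False) : C.Pr p (E ∪ E') = C.Pr p E + C.Pr p E' := by
  have hP := C.isProb_runMeasure
  rw [Pr_eq, Pr_eq, Pr_eq, measure_union (Set.disjoint_left.2 h) hE',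
    ENNReal.toReal_add (measure_ne_top _ _) (measure_ne_top _ _)]

theorem Pr_compl {p : Q} {E : Set (ℕ → Q)} (hE : Meas E) : C.Pr p Eᶜ = 1 - C.Pr p E := by
  have h := C.Pr_union (p := p) (E := Eᶜ) hE fun r h1 h2 => h1 h2
  rw [Set.compl_union_self, Pr_univ] at h
  linarith

theorem Pr_step (p : Q) {E : Set (ℕ → Q)} (hE : Meas E) :
    C.Pr p E = ∑ q, C.trans p q * C.Pr q (cons p ⁻¹' E) := by
  have hP := C.isProb_runMeasure
  rw [Pr_eq, runMeasure_apply _ _ hE, ENNReal.toReal_sum fun q _ =>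
    ENNReal.mul_ne_top ENNReal.ofReal_ne_top (measure_ne_top _ _)]
  refine Finset.sum_congr rfl fun q _ => ?_
  rw [ENNReal.toReal_mul, ENNReal.toReal_ofReal (C.trans_nonneg p q), Pr_eq]

theorem meas_tail {E : Set (ℕ → Q)} (hE : Meas E) : Meas {r | tail r ∈ E} := measurable_tail hE

theorem Pr_tail (p : Q) {E : Set (ℕ → Q)} (hE : Meas E) :
    C.Pr p {r | tail r ∈ E} = ∑ q, C.trans p q * C.Pr q E := by
  rw [C.Pr_step p (meas_tail hE)]
  refine Finset.sum_congr rfl fun q _ => ?_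
  congr 2
  ext r
  simp

theorem meas_coord (i : ℕ) (s : Set Q) : Meas {r : ℕ → Q | r i ∈ s} :=
  measurable_pi_apply i (MeasurableSet.of_discrete (s := s))

theorem Meas.compl {E : Set (ℕ → Q)} (hE : Meas E) : Meas Eᶜ := MeasurableSet.compl hE

theorem Meas.inter {E E' : Set (ℕ → Q)} (hE : Meas E) (hE' : Meas E') : Meas (E ∩ E') :=
  MeasurableSet.inter hE hE'

theorem Meas.iUnion {ι : Type*} [Countable ι] {E : ι → Set (ℕ → Q)} (hE : ∀ i, Meas (E i)) :
    Meas (⋃ i, E i) := MeasurableSet.iUnion hE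

theorem Meas.iInter {ι : Type*} [Countable ι] {E : ι → Set (ℕ → Q)} (hE : ∀ i, Meas (E i)) :
    Meas (⋂ i, E i) := MeasurableSet.iInter hE

theorem meas_const (P : Prop) : Meas {_r : ℕ → Q | P} := MeasurableSet.const P

/-- The paths without their first `n` states that lie in a measurable set. -/
theorem meas_shift (n : ℕ) {E : Set (ℕ → Q)} (hE : Meas E) :
    Meas {r : ℕ → Q | (fun i => r (n + i)) ∈ E} :=
  (measurable_pi_lambda (fun (r : ℕ → Q) i => r (n + i)) fun i => measurable_pi_apply _) hE

theorem Pr_mono {p : Q} {E E' : Set (ℕ → Q)} (h : E ⊆ E') : C.Pr p E ≤ C.Pr p E' := by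
  have hP := C.isProb_runMeasure
  rw [Pr_eq, Pr_eq]
  exact ENNReal.toReal_mono (measure_ne_top _ _) (measure_mono h)

theorem Pr_iUnion_zero {ι : Type*} [Countable ι] {p : Q} {E : ι → Set (ℕ → Q)} (h : ∀ n, C.Pr p (E n) = 0) :
    C.Pr p (⋃ n, E n) = 0 := by
  have hP := C.isProb_runMeasure
  rw [Pr_eq]
  have : C.runMeasure p (⋃ n, E n) = 0 := by
    refine measure_iUnion_null fun n => ?_
    have := h n
    rw [Pr_eq, ENNReal.toReal_eq_zero_iff] at this
    exact this.resolve_right (measure_ne_top _ _)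
  simp [this]

/-- This and its dual below compare the chains of two policies: equality along a monotone sequence
of events passes to the limit by continuity of measures. -/
theorem Pr_iUnion_congr {C C' : Chain Q AP} {p : Q} {E : ℕ → Set (ℕ → Q)} (hm : Monotone E)
    (h : ∀ n, C.Pr p (E n) = C'.Pr p (E n)) : C.Pr p (⋃ n, E n) = C'.Pr p (⋃ n, E n) := by
  have hP := C.isProb_runMeasure
  have hP' := C'.isProb_runMeasure
  have h1 := (ENNReal.tendsto_toReal (measure_ne_top (C.runMeasure p) _)).comp
    (tendsto_measure_iUnion_atTop (μ := C.runMeasure p) hm)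
  have h2 := (ENNReal.tendsto_toReal (measure_ne_top (C'.runMeasure p) _)).comp
    (tendsto_measure_iUnion_atTop (μ := C'.runMeasure p) hm)
  rw [Pr_eq, Pr_eq]
  refine tendsto_nhds_unique h1 (h2.congr fun n => ?_)
  have := h n
  rw [Pr_eq, Pr_eq] at this
  exact this.symm

theorem Pr_iInter_congr {C C' : Chain Q AP} {p : Q} {E : ℕ → Set (ℕ → Q)} (hE : ∀ n, Meas (E n))
    (hm : Antitone E) (h : ∀ n, C.Pr p (E n) = C'.Pr p (E n)) :
    C.Pr p (⋂ n, E n) = C'.Pr p (⋂ n, E n) := by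
  have h1 := Pr_iUnion_congr (C := C) (C' := C') (p := p) (E := fun n => (E n)ᶜ)
    (fun _ _ hij => Set.compl_subset_compl.2 (hm hij))
    (fun n => by rw [Pr_compl _ (hE n), Pr_compl _ (hE n), h n])
  have hI : Meas (⋂ n, E n) := Meas.iInter hE
  rw [← Set.compl_iInter, Pr_compl _ hI, Pr_compl _ hI] at h1
  linarith

end

end Chain

end PCTLSynth


namespace PCTLSynth

open Chain

/-! ## Semantics of PCTL* -/

namespace Cmp

theorem holds_compl (c : Cmp) (x y : ℝ) : c.compl.Holds x y ↔ ¬ c.Holds x y := by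
  cases c <;> simp [compl, Holds]

theorem holds_flip (c : Cmp) (x : ℝ) (z : unitInterval) :
    c.flip.Holds x (unitInterval.symm z) ↔ c.Holds (1 - x) z := by
  cases c <;> simp only [flip, Holds, unitInterval.coe_symm_eq] <;>
    constructor <;> intro h <;> linarith

end Cmp

section Semantics

variable {Q AP : Type*} [Fintype Q] (C : Chain Q AP)

theorem runSat_next (ψ : Formula AP) (r : ℕ → Q) : RunSat C (.next ψ) r ↔ RunSat C ψ (tail r) :=
  Iff.rfl

theorem runSat_untl (ψ₁ ψ₂ : Formula AP) (r : ℕ → Q) : RunSat C (.untl ψ₁ ψ₂) r ↔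
    RunSat C ψ₂ r ∨ (RunSat C ψ₁ r ∧ RunSat C (.untl ψ₁ ψ₂) (tail r)) := by
  have hs : ∀ n, (fun i => tail r (n + i)) = fun i => r (n + 1 + i) := fun n => by
    funext i; rw [tail_apply]; congr 1; omega
  have h0 : (fun i => r (0 + i)) = r := by funext i; simp
  simp only [RunSat]
  constructor
  · rintro ⟨n, h2, h1⟩
    cases n with
    | zero => rw [h0] at h2; exact Or.inl h2
    | succ n =>
      refine Or.inr ⟨?_, n, ?_, fun k hk => ?_⟩
      · have := h1 0 (Nat.succ_pos n)
        rwa [h0] at this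
      · rw [hs]; exact h2
      · rw [hs]; exact h1 (k + 1) (Nat.succ_lt_succ hk)
  · rintro (h2 | ⟨h1, n, hn, hk⟩)
    · exact ⟨0, by rwa [h0], fun k hk => absurd hk (Nat.not_lt_zero k)⟩
    · refine ⟨n + 1, ?_, fun k hk' => ?_⟩
      · rw [← hs]; exact hn
      · cases k with
        | zero => rwa [h0]
        | succ k => rw [← hs]; exact hk k (Nat.lt_of_succ_lt_succ hk')

theorem meas_runSat (ψ : Formula AP) : Meas {r | RunSat C ψ r} := by
  induction ψ with
  | tt => simpa [RunSat] using meas_const True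
  | atom a => exact meas_coord 0 {q | a ∈ C.label q}
  | neg ψ ih => exact ih.compl
  | and ψ₁ ψ₂ ih₁ ih₂ => exact ih₁.inter ih₂
  | prob c z ψ ih => exact meas_coord 0 {q | c.Holds (C.Pr q {r' | RunSat C ψ r'}) z}
  | next ψ ih => exact meas_tail ih
  | untl ψ₁ ψ₂ ih₁ ih₂ =>
    have : {r | RunSat C (.untl ψ₁ ψ₂) r} = ⋃ n, ({r | RunSat C ψ₂ (fun i => r (n + i))} ∩
        ⋂ k : Fin n, {r | RunSat C ψ₁ (fun i => r (k + i))}) := by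
      ext r
      simp only [RunSat, Set.mem_ofPred_eq, Set.mem_iUnion, Set.mem_inter_iff, Set.mem_iInter]
      exact exists_congr fun n => and_congr_right fun _ => ⟨fun h k => h k k.2, fun h k hk => h ⟨k, hk⟩⟩
    rw [this]
    exact Meas.iUnion fun n => (meas_shift n ih₂).inter (Meas.iInter fun k => meas_shift k ih₁)

/-- All formulas of a set hold of a run. -/
def Sat (Ψ : Set (Formula AP)) (r : ℕ → Q) : Prop := ∀ ψ ∈ Ψ, RunSat C ψ r

theorem meas_sat {Ψ : Set (Formula AP)} (h : Ψ.Finite) : Meas {r | Sat C Ψ r} := by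
  have : {r | Sat C Ψ r} = ⋂ ψ : Ψ, {r | RunSat C ψ r} := by
    ext r; simp [Sat]
  rw [this]
  have := h.countable.to_subtype
  exact Meas.iInter fun ψ => meas_runSat C ψ

theorem pr_neg (p : Q) (ψ : Formula AP) :
    C.Pr p {r | RunSat C (.neg ψ) r} = 1 - C.Pr p {r | RunSat C ψ r} :=
  C.Pr_compl (meas_runSat C ψ)

/-- The truth of a state formula depends on the first state only, so its probability is one or zero.
-/
theorem pr_state_one {ψ : Formula AP} (hψ : ψ.IsState) {r : ℕ → Q} (h : RunSat C ψ r) :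
    C.Pr (r 0) {r' | RunSat C ψ r'} = 1 := by
  refine C.Pr_eq_one fun r' _ h0 => ?_
  rw [Set.mem_ofPred_eq, runSat_iff_stateSat C r' ψ hψ, h0, ← runSat_iff_stateSat C r ψ hψ]
  exact h

theorem pr_state_zero {ψ : Formula AP} (hψ : ψ.IsState) {r : ℕ → Q} (h : ¬ RunSat C ψ r) :
    C.Pr (r 0) {r' | RunSat C ψ r'} = 0 := by
  refine C.Pr_eq_zero fun r' _ h0 => ?_
  rw [Set.mem_ofPred_eq, runSat_iff_stateSat C r' ψ hψ, h0, ← runSat_iff_stateSat C r ψ hψ]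
  exact h

theorem runSat_classical {ψ : Formula AP} (hψ : ψ.IsClassical) (r : ℕ → Q) :
    RunSat C ψ r ↔ ψ.EvalClassical (C.label (r 0)) := by
  induction ψ with
  | tt => simp [RunSat, Formula.EvalClassical]
  | atom a => simp [RunSat, Formula.EvalClassical]
  | neg ψ ih => simp only [RunSat, Formula.EvalClassical, ih hψ]
  | and ψ₁ ψ₂ ih₁ ih₂ => simp only [RunSat, Formula.EvalClassical, ih₁ hψ.1, ih₂ hψ.2]
  | prob c z ψ ih => exact hψ.elim
  | next ψ ih => exact hψ.elim
  | untl ψ₁ ψ₂ ih₁ ih₂ => exact hψ.elim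

theorem runSat_neg_prob (c : Cmp) (z : unitInterval) (ψ : Formula AP) (r : ℕ → Q) :
    RunSat C (.prob c.compl z ψ) r ↔ RunSat C (.neg (.prob c z ψ)) r :=
  Cmp.holds_compl _ _ _

theorem runSat_prob_neg (c : Cmp) (z : unitInterval) (ψ : Formula AP) (r : ℕ → Q) :
    RunSat C (.prob c z (.neg ψ)) r ↔ RunSat C (.prob c.flip (unitInterval.symm z) ψ) r := by
  simp only [RunSat]
  rw [Cmp.holds_flip, ← pr_neg]
  rfl

/-- A probability that is zero or one meets a lower bound exactly if it is one, except for the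
constant comparisons `> 1` and `≥ 0`. -/
theorem runSat_prob_pos {c : Cmp} {z : unitInterval} {ψ : Formula AP} (hψ : ψ.IsState)
    (h : (c = .gt ∧ z ≠ 1) ∨ (c = .ge ∧ z ≠ 0)) (r : ℕ → Q) :
    RunSat C (.prob c z ψ) r ↔ RunSat C ψ r := by
  by_cases hr : RunSat C ψ r
  · simp only [RunSat, pr_state_one C hψ hr, hr, iff_true]
    rcases h with ⟨rfl, hz⟩ | ⟨rfl, hz⟩
    · exact unitInterval.lt_one_iff_ne_one.2 hz
    · exact unitInterval.le_one'
  · simp only [RunSat, pr_state_zero C hψ hr, hr, iff_false]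
    rcases h with ⟨rfl, hz⟩ | ⟨rfl, hz⟩
    · exact not_lt.2 unitInterval.nonneg'
    · exact not_le.2 (unitInterval.pos_iff_ne_zero.2 hz)

theorem runSat_prob_negative {c : Cmp} {z : unitInterval} {ψ : Formula AP} (hψ : ψ.IsState)
    (h : (c = .le ∧ z ≠ 1) ∨ (c = .lt ∧ z ≠ 0)) (r : ℕ → Q) :
    RunSat C (.prob c z ψ) r ↔ RunSat C (.neg ψ) r := by
  have h' := runSat_prob_pos C (c := c.compl) (z := z) hψ
    (by rcases h with ⟨rfl, hz⟩ | ⟨rfl, hz⟩ <;> simp [Cmp.compl, hz]) r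
  rw [runSat_neg_prob] at h'
  simp only [RunSat] at h' ⊢
  tauto

theorem runSat_simplifies {c : Cmp} {z : unitInterval} {ψ ψ' : Formula AP}
    (h : Simplifies c z ψ ψ') (r : ℕ → Q) : RunSat C (.prob c z ψ) r ↔ RunSat C ψ' r := by
  cases h with
  | ge_zero => simpa [RunSat, Cmp.Holds] using C.Pr_nonneg _ _
  | gt_one => simpa [RunSat, Cmp.Holds, Formula.ff] using C.Pr_le_one _ _
  | le_one => simpa [RunSat, Cmp.Holds] using C.Pr_le_one _ _
  | lt_zero => simpa [RunSat, Cmp.Holds, Formula.ff] using C.Pr_nonneg _ _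
  | ge_prob _ c z ψ hu => exact runSat_prob_pos C (ψ := .prob c z ψ) trivial (Or.inr ⟨rfl, hu⟩) r
  | gt_prob _ c z ψ hu => exact runSat_prob_pos C (ψ := .prob c z ψ) trivial (Or.inl ⟨rfl, hu⟩) r
  | le_prob _ d w χ =>
    have : {r' | RunSat C (.prob d.compl w χ) r'} = {r' | RunSat C (.neg (.prob d w χ)) r'} := by
      ext r'; exact runSat_neg_prob C d w χ r'
    have h1 := pr_neg C (r 0) (.prob d w χ)
    rw [← this] at h1
    change Cmp.Holds _ _ _ ↔ Cmp.Holds _ _ _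
    rw [h1]
    simp only [Cmp.Holds, unitInterval.coe_symm_eq]
    constructor <;> intro h <;> linarith
  | lt_prob _ d w χ =>
    have : {r' | RunSat C (.prob d.compl w χ) r'} = {r' | RunSat C (.neg (.prob d w χ)) r'} := by
      ext r'; exact runSat_neg_prob C d w χ r'
    have h1 := pr_neg C (r 0) (.prob d w χ)
    rw [← this] at h1
    change Cmp.Holds _ _ _ ↔ Cmp.Holds _ _ _
    rw [h1]
    simp only [Cmp.Holds, unitInterval.coe_symm_eq]
    constructor <;> intro h <;> linarith

end Semantics

/-! ## Expansion of a formula of a pivot that is not poised -/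

/-- `Expands L dec ψ Ls`: in a state with label `L`, where the truth of the `P`-formulas in `dec`
has been decided, a union rule replaces `ψ` by the formulas in one of the sets of `Ls`. -/
inductive Expands {AP : Type*} (L : Set AP) (dec : Cmp → unitInterval → Formula AP → Prop) :
    Formula AP → List (Set (Formula AP)) → Prop
  | top (ψ) : ψ.IsClassical → ψ.EvalClassical L → Expands L dec ψ [∅]
  | negNeg (ψ) : Expands L dec (.neg (.neg ψ)) [{ψ}]
  | negP (c z ψ) : Expands L dec (.neg (.prob c z ψ)) [{.prob c.compl z ψ}]
  | pNeg (c z ψ) : Expands L dec (.prob c z (.neg ψ)) [{.prob c.flip (unitInterval.symm z) ψ}]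
  | and (ψ₁ ψ₂) : Expands L dec (.and ψ₁ ψ₂) [{ψ₁, ψ₂}]
  | negAnd (ψ₁ ψ₂) : Expands L dec (.neg (.and ψ₁ ψ₂)) [{.neg ψ₁}, {ψ₁, .neg ψ₂}]
  | p1 (c z ψ ψ') : Simplifies c z ψ ψ' → Expands L dec (.prob c z ψ) [{ψ'}]
  | p2 (c z ψ) : ψ.IsState → (c = .gt ∧ z ≠ 1) ∨ (c = .ge ∧ z ≠ 0) → Expands L dec (.prob c z ψ) [{ψ}]
  -- That `ψ` is not a negation follows from the order of preference; without it, closures under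
  -- expansion could not be kept finite so easily.
  | p3 (c z ψ) : ψ.IsState → (c = .le ∧ z ≠ 1) ∨ (c = .lt ∧ z ≠ 0) → (∀ χ, ψ ≠ .neg χ) →
      Expands L dec (.prob c z ψ) [{.neg ψ}]
  | pTop (c z ψ) : dec c z ψ → Expands L dec (.prob c z ψ) [∅]
  | untl (ψ₁ ψ₂) : Expands L dec (.untl ψ₁ ψ₂) [{ψ₂}, {ψ₁, .neg ψ₂, .next (.untl ψ₁ ψ₂)}]
  | negUntl (ψ₁ ψ₂) : Expands L dec (.neg (.untl ψ₁ ψ₂))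
      [{.neg ψ₁, .neg ψ₂}, {ψ₁, .neg ψ₂, .next (.neg (.untl ψ₁ ψ₂))}]
  | negNext (ψ) : Expands L dec (.neg (.next ψ)) [{.next (.neg ψ)}]

namespace Expands

variable {AP : Type*} {L : Set AP} {dec : Cmp → unitInterval → Formula AP → Prop} {ψ : Formula AP}
  {Ls : List (Set (Formula AP))}

theorem not_next {χ : Formula AP} (h : Expands L dec (.next χ) Ls) : False := by
  cases h with
  | top _ h => exact h

theorem sat_iff {Q : Type*} [Fintype Q] (C : Chain Q AP) (r : ℕ → Q) (h : Expands L dec ψ Ls)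
    (hL : C.label (r 0) = L)
    (hdec : ∀ c z χ, dec c z χ → c.Holds (C.Pr (r 0) {r' | RunSat C χ r'}) z) :
    RunSat C ψ r ↔ ∃ Ψ ∈ Ls, Sat C Ψ r := by
  cases h with
  | top _ h1 h2 => simp [Sat, runSat_classical C h1, hL, h2]
  | negNeg χ => simp [Sat, RunSat]
  | negP c z χ => simp [Sat, runSat_neg_prob]
  | pNeg c z χ => simp [Sat, runSat_prob_neg]
  | and ψ₁ ψ₂ => simp [Sat, RunSat]
  | negAnd ψ₁ ψ₂ => simp [Sat, RunSat]; tauto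
  | p1 c z χ χ' h => simp [Sat, runSat_simplifies C h]
  | p2 c z χ h1 h2 => simp [Sat, runSat_prob_pos C h1 h2]
  | p3 c z χ h1 h2 _ => simp [Sat, runSat_prob_negative C h1 h2]
  | pTop c z χ h => simpa [Sat, RunSat] using hdec _ _ _ h
  | untl ψ₁ ψ₂ =>
    rw [runSat_untl]
    simp only [Sat, List.mem_cons, List.not_mem_nil, or_false, exists_eq_or_imp, exists_eq_left,
      Set.mem_singleton_iff, Set.mem_insert_iff, forall_eq_or_imp, forall_eq, runSat_next]
    simp only [RunSat]
    tauto
  | negUntl ψ₁ ψ₂ =>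
    have := runSat_untl C ψ₁ ψ₂ r
    simp only [Sat, List.mem_cons, List.not_mem_nil, or_false, exists_eq_or_imp, exists_eq_left,
      Set.mem_singleton_iff, Set.mem_insert_iff, forall_eq_or_imp, forall_eq, runSat_next]
    change ¬ RunSat C (.untl ψ₁ ψ₂) r ↔ (¬ RunSat C ψ₁ r ∧ ¬ RunSat C ψ₂ r) ∨
      (RunSat C ψ₁ r ∧ ¬ RunSat C ψ₂ r ∧ ¬ RunSat C (.untl ψ₁ ψ₂) (tail r))
    tauto
  | negNext χ => simp [Sat, RunSat]

/-- When there are two alternatives, one contains the negation of a formula of the other. This is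
what makes their probabilities add up. -/
theorem disjoint {Q : Type*} [Fintype Q] (C : Chain Q AP) (r : ℕ → Q) (h : Expands L dec ψ Ls) :
    Ls.Pairwise fun Ψ Ψ' => Sat C Ψ r → Sat C Ψ' r → False := by
  cases h with
  | negAnd ψ₁ ψ₂ =>
    simp only [Sat, List.pairwise_cons, List.not_mem_nil, List.Pairwise.nil, List.mem_singleton,
      forall_eq, Set.mem_singleton_iff, Set.mem_insert_iff, forall_eq_or_imp]
    simp only [RunSat]; tauto
  | untl ψ₁ ψ₂ =>
    simp only [Sat, List.pairwise_cons, List.not_mem_nil, List.Pairwise.nil, List.mem_singleton,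
      forall_eq, Set.mem_singleton_iff, Set.mem_insert_iff, forall_eq_or_imp]
    simp only [RunSat]; tauto
  | negUntl ψ₁ ψ₂ =>
    simp only [Sat, List.pairwise_cons, List.not_mem_nil, List.Pairwise.nil, List.mem_singleton,
      forall_eq, Set.mem_singleton_iff, Set.mem_insert_iff, forall_eq_or_imp]
    simp only [RunSat]; tauto
  | _ => simp

/-- The conclusion sets of an expansion of an until formula. -/
theorem untl_cases {ψ₁ ψ₂ : Formula AP} (h : Expands L dec (.untl ψ₁ ψ₂) Ls) :
    Ls = [{ψ₂}, {ψ₁, .neg ψ₂, .next (.untl ψ₁ ψ₂)}] := by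
  cases h with
  | top _ h => exact h.elim
  | untl => rfl

theorem negUntl_cases {ψ₁ ψ₂ : Formula AP} (h : Expands L dec (.neg (.untl ψ₁ ψ₂)) Ls) :
    Ls = [{.neg ψ₁, .neg ψ₂}, {ψ₁, .neg ψ₂, .next (.neg (.untl ψ₁ ψ₂))}] := by
  cases h with
  | top _ h => exact h.elim
  | negUntl => rfl

end Expands

/-! ## Weights of formulas -/

/-- The basic weight of a formula; `X`-formulas weigh nothing if `x = 0`. -/
def fw {AP : Type*} (x : ℕ) : Formula AP → ℕ
  | .tt => 1
  | .atom _ => 1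
  | .neg ψ => 2 * fw x ψ + 1
  | .and ψ₁ ψ₂ => fw x ψ₁ + fw x ψ₂ + 1
  -- The doubling pays for a negation of `ψ`, and 4 exceeds the weight 3 of `false`.
  | .prob _ _ ψ => 2 * fw x ψ + 4
  | .next ψ => x * (fw x ψ + 1)
  -- An unfolding yields `ψ₁`, the negation of `ψ₂` and an `X`-formula; if the latter weighs
  -- nothing, the total is smaller by one.
  | .untl ψ₁ ψ₂ => fw x ψ₁ + 2 * fw x ψ₂ + 2

/-- A correction that makes upper bounds heavier than lower bounds. -/
def pw {AP : Type*} : Formula AP → ℕ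
  | .prob .lt _ _ => 1
  | .prob .le _ _ => 1
  | _ => 0

/-- The weight of a formula. -/
def wt {AP : Type*} (x : ℕ) (ψ : Formula AP) : ℕ := 4 * fw x ψ + pw ψ

/-- The factor 4 in `wt` outweighs the corrections of the at most three formulas produced by an
expansion. -/
theorem pw_le {AP : Type*} (ψ : Formula AP) : pw ψ ≤ 1 := by
  unfold pw; split <;> simp

theorem pw_neg {AP : Type*} (ψ : Formula AP) : pw (.neg ψ) = 0 := rfl

theorem pw_next {AP : Type*} (ψ : Formula AP) : pw (.next ψ) = 0 := rfl

theorem pw_untl {AP : Type*} (ψ₁ ψ₂ : Formula AP) : pw (.untl ψ₁ ψ₂) = 0 := rfl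

namespace Expands

variable {AP : Type*} {L : Set AP} {dec : Cmp → unitInterval → Formula AP → Prop} {ψ : Formula AP}
  {Ls : List (Set (Formula AP))}

/-- The simplifications of `P_{≤ u}` and `P_{< u}` before another `P` keep the basic weight; there
the decrease comes from `pw` alone. -/
theorem wt_simplifies {x : ℕ} {c : Cmp} {z : unitInterval} {ψ ψ' : Formula AP}
    (h : Simplifies c z ψ ψ') : wt x ψ' < wt x (.prob c z ψ) := by
  cases h with
  | ge_prob u d w χ => have := pw_le (.prob d w χ); simp only [wt, fw, pw] at *; omega
  | gt_prob u d w χ => have := pw_le (.prob d w χ); simp only [wt, fw, pw] at *; omega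
  | _ => simp only [wt, fw, pw, Formula.ff]; omega

/-- Expansions decrease the total weight if `X`-formulas weigh nothing. -/
theorem exists_finset (h : Expands L dec ψ Ls) {Ψ : Set (Formula AP)} (hΨ : Ψ ∈ Ls) :
    ∃ s : Finset (Formula AP), (s : Set (Formula AP)) = Ψ ∧ ∑ χ ∈ s, wt 0 χ < wt 0 ψ := by
  classical
  have one : ∀ χ : Formula AP, wt 0 χ < wt 0 ψ →
      ∃ s : Finset (Formula AP), (s : Set (Formula AP)) = ({χ} : Set _) ∧ ∑ χ ∈ s, wt 0 χ < wt 0 ψ :=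
    fun χ h => ⟨{χ}, by simp, by simpa using h⟩
  have ins : ∀ (χ : Formula AP) (s : Finset (Formula AP)),
      ∑ χ ∈ insert χ s, wt 0 χ ≤ wt 0 χ + ∑ χ ∈ s, wt 0 χ := fun χ s => by
    by_cases hχ : χ ∈ s
    · rw [Finset.insert_eq_of_mem hχ]; omega
    · rw [Finset.sum_insert hχ]
  have two : ∀ χ₁ χ₂ : Formula AP, wt 0 χ₁ + wt 0 χ₂ < wt 0 ψ →
      ∃ s : Finset (Formula AP), (s : Set (Formula AP)) = ({χ₁, χ₂} : Set _) ∧ ∑ χ ∈ s, wt 0 χ < wt 0 ψ :=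
    fun χ₁ χ₂ h => ⟨{χ₁, χ₂}, by simp, (ins _ _).trans_lt (by simpa using h)⟩
  have three : ∀ χ₁ χ₂ χ₃ : Formula AP, wt 0 χ₁ + wt 0 χ₂ + wt 0 χ₃ < wt 0 ψ →
      ∃ s : Finset (Formula AP), (s : Set (Formula AP)) = ({χ₁, χ₂, χ₃} : Set _) ∧ ∑ χ ∈ s, wt 0 χ < wt 0 ψ :=
    fun χ₁ χ₂ χ₃ h => ⟨{χ₁, χ₂, χ₃}, by simp, (ins _ _).trans_lt (by
      have := ins χ₂ {χ₃}
      simp only [Finset.sum_singleton] at this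
      omega)⟩
  have emp : 0 < wt 0 ψ → ∃ s : Finset (Formula AP), (s : Set (Formula AP)) = (∅ : Set _) ∧ ∑ χ ∈ s, wt 0 χ < wt 0 ψ :=
    fun h => ⟨∅, by simp, by simpa using h⟩
  cases h with
  | top _ h1 h2 =>
    obtain rfl := List.mem_singleton.1 hΨ
    refine emp ?_
    cases ψ <;> first | exact h1.elim | (simp only [wt, fw]; omega)
  | negNeg χ =>
    obtain rfl := List.mem_singleton.1 hΨ
    have := pw_le χ
    exact one _ (by simp only [wt, fw]; omega)
  | negP c z χ =>
    obtain rfl := List.mem_singleton.1 hΨ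
    have := pw_le (.prob c.compl z χ)
    exact one _ (by simp only [wt, fw]; omega)
  | pNeg c z χ =>
    obtain rfl := List.mem_singleton.1 hΨ
    have := pw_le (.prob c.flip (unitInterval.symm z) χ)
    exact one _ (by simp only [wt, fw]; omega)
  | and ψ₁ ψ₂ =>
    obtain rfl := List.mem_singleton.1 hΨ
    have := pw_le ψ₁
    have := pw_le ψ₂
    exact two _ _ (by simp only [wt, fw]; omega)
  | negAnd ψ₁ ψ₂ =>
    have := pw_le ψ₁
    simp only [List.mem_cons, List.not_mem_nil, or_false] at hΨ
    rcases hΨ with rfl | rfl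
    · exact one _ (by simp only [wt, fw, pw_neg, pw_next, pw_untl]; omega)
    · exact two _ _ (by simp only [wt, fw, pw_neg, pw_next, pw_untl]; omega)
  | p1 c z χ χ' h =>
    obtain rfl := List.mem_singleton.1 hΨ
    exact one _ (wt_simplifies h)
  | p2 c z χ h1 h2 =>
    obtain rfl := List.mem_singleton.1 hΨ
    have := pw_le χ
    exact one _ (by simp only [wt, fw]; omega)
  | p3 c z χ h1 h2 _ =>
    obtain rfl := List.mem_singleton.1 hΨ
    exact one _ (by simp only [wt, fw, pw_neg, pw_next, pw_untl]; omega)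
  | pTop c z χ h =>
    obtain rfl := List.mem_singleton.1 hΨ
    exact emp (by simp only [wt, fw]; omega)
  | untl ψ₁ ψ₂ =>
    have := pw_le ψ₁
    have := pw_le ψ₂
    simp only [List.mem_cons, List.not_mem_nil, or_false] at hΨ
    rcases hΨ with rfl | rfl
    · exact one _ (by simp only [wt, fw, pw_neg, pw_next, pw_untl]; omega)
    · exact three _ _ _ (by simp only [wt, fw, pw_neg, pw_next, pw_untl]; omega)
  | negUntl ψ₁ ψ₂ =>
    have := pw_le ψ₁
    simp only [List.mem_cons, List.not_mem_nil, or_false] at hΨ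
    rcases hΨ with rfl | rfl
    · exact two _ _ (by simp only [wt, fw, pw_neg, pw_next, pw_untl]; omega)
    · exact three _ _ _ (by simp only [wt, fw, pw_neg, pw_next, pw_untl]; omega)
  | negNext χ =>
    obtain rfl := List.mem_singleton.1 hΨ
    exact one _ (by simp only [wt, fw, pw_neg, pw_next, pw_untl]; omega)

/-- Expansions produce smaller formulas, up to the unfolding of until formulas. -/
theorem wt_lt (h : Expands L dec ψ Ls) {Ψ : Set (Formula AP)} (hΨ : Ψ ∈ Ls) {χ : Formula AP}
    (hχ : χ ∈ Ψ) (h1 : ∀ ψ₁ ψ₂, ψ ≠ .untl ψ₁ ψ₂) (h2 : ∀ ψ₁ ψ₂, ψ ≠ .neg (.untl ψ₁ ψ₂)) :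
    wt 1 χ < wt 1 ψ := by
  have hb := pw_le χ
  cases h with
  | untl ψ₁ ψ₂ => exact absurd rfl (h1 _ _)
  | negUntl ψ₁ ψ₂ => exact absurd rfl (h2 _ _)
  | p1 c z χ χ' h =>
    obtain rfl := List.mem_singleton.1 hΨ
    rw [Set.mem_singleton_iff.1 hχ]
    exact wt_simplifies h
  | _ =>
    simp only [List.mem_cons, List.not_mem_nil, or_false] at hΨ
    rcases hΨ with rfl | rfl <;>
    simp only [Set.mem_insert_iff, Set.mem_singleton_iff, Set.mem_empty_iff_false] at hχ <;>
    (try rcases hχ with rfl | rfl) <;> (try subst hχ) <;> simp only [wt, fw, pw] at * <;> omega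

end Expands

/-! ## A finite closure of a formula under the rules -/

/-- `Req ψ χ`: closures that contain `ψ` have to contain `χ`. -/
inductive Req {AP : Type*} : Formula AP → Formula AP → Prop
  | neg (ψ) : Req (.neg ψ) ψ
  | andLeft (ψ₁ ψ₂) : Req (.and ψ₁ ψ₂) ψ₁
  | andRight (ψ₁ ψ₂) : Req (.and ψ₁ ψ₂) ψ₂
  | andNegLeft (ψ₁ ψ₂) : Req (.and ψ₁ ψ₂) (.neg ψ₁)
  | andNegRight (ψ₁ ψ₂) : Req (.and ψ₁ ψ₂) (.neg ψ₂)
  | next (ψ) : Req (.next ψ) ψ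
  | negNext (ψ) : Req (.neg (.next ψ)) (.next (.neg ψ))
  | untlLeft (ψ₁ ψ₂) : Req (.untl ψ₁ ψ₂) ψ₁
  | untlRight (ψ₁ ψ₂) : Req (.untl ψ₁ ψ₂) ψ₂
  | untlNegLeft (ψ₁ ψ₂) : Req (.untl ψ₁ ψ₂) (.neg ψ₁)
  | untlNegRight (ψ₁ ψ₂) : Req (.untl ψ₁ ψ₂) (.neg ψ₂)
  | untlNext (ψ₁ ψ₂) : Req (.untl ψ₁ ψ₂) (.next (.untl ψ₁ ψ₂))
  | untlNextNeg (ψ₁ ψ₂) : Req (.untl ψ₁ ψ₂) (.next (.neg (.untl ψ₁ ψ₂)))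
  | probTop (c z ψ) : Req (.prob c z ψ) .tt
  | probBot (c z ψ) : Req (.prob c z ψ) .ff
  | probArg (c z ψ) : Req (.prob c z ψ) ψ
  | prob (c z ψ d) : Req (.prob c z ψ) (.prob d z ψ)
  | probNeg (c z ψ d) : Req (.prob c z (.neg ψ)) (.prob d (unitInterval.symm z) ψ)
  | probProb (c z c' z' ψ d d') :
      Req (.prob c z (.prob c' z' ψ)) (.prob d (unitInterval.symm z) (.prob d' z' ψ))
  -- Negating negations as well would force arbitrarily long towers of negations into every closure.
  | stateNeg (ψ) : ψ.IsState → (∀ χ, ψ ≠ .neg χ) → Req ψ (.neg ψ)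

/-- Sets of formulas that are closed under the rules. -/
def Closed {AP : Type*} (K : Set (Formula AP)) : Prop := ∀ ψ ∈ K, ∀ χ, Req ψ χ → χ ∈ K

theorem Closed.union {AP : Type*} {K K' : Set (Formula AP)} (h : Closed K) (h' : Closed K') :
    Closed (K ∪ K') := by
  rintro ψ (hψ | hψ) χ hχ
  exacts [Or.inl (h ψ hψ χ hχ), Or.inr (h' ψ hψ χ hχ)]

theorem Closed.extend {AP : Type*} {K B : Set (Formula AP)} (h : Closed K)
    (h' : ∀ ψ ∈ B, ∀ χ, Req ψ χ → χ ∈ K ∪ B) : Closed (K ∪ B) := by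
  rintro ψ (hψ | hψ) χ hχ
  exacts [Or.inl (h ψ hψ χ hχ), h' ψ hψ χ hχ]

theorem Closed.expands {AP : Type*} {K : Set (Formula AP)} (hK : Closed K) {L : Set AP}
    {dec : Cmp → unitInterval → Formula AP → Prop} {ψ : Formula AP} {Ls : List (Set (Formula AP))}
    (h : Expands L dec ψ Ls) (hψ : ψ ∈ K) {Ψ : Set (Formula AP)} (hΨ : Ψ ∈ Ls) : Ψ ⊆ K := by
  have one : ∀ {χ : Formula AP}, χ ∈ K → ({χ} : Set (Formula AP)) ⊆ K :=
    fun h => Set.singleton_subset_iff.2 h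
  have two : ∀ {χ₁ χ₂ : Formula AP}, χ₁ ∈ K → χ₂ ∈ K → ({χ₁, χ₂} : Set (Formula AP)) ⊆ K :=
    fun h1 h2 => Set.insert_subset h1 (Set.singleton_subset_iff.2 h2)
  have three : ∀ {χ₁ χ₂ χ₃ : Formula AP}, χ₁ ∈ K → χ₂ ∈ K → χ₃ ∈ K →
      ({χ₁, χ₂, χ₃} : Set (Formula AP)) ⊆ K :=
    fun h1 h2 h3 => Set.insert_subset h1 (two h2 h3)
  cases h with
  | top _ h1 h2 => obtain rfl := List.mem_singleton.1 hΨ; simp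
  | negNeg χ =>
    obtain rfl := List.mem_singleton.1 hΨ
    exact one (hK _ (hK _ hψ _ (.neg _)) _ (.neg _))
  | negP c z χ =>
    obtain rfl := List.mem_singleton.1 hΨ
    exact one (hK _ (hK _ hψ _ (.neg _)) _ (.prob ..))
  | pNeg c z χ =>
    obtain rfl := List.mem_singleton.1 hΨ
    exact one (hK _ hψ _ (.probNeg ..))
  | and ψ₁ ψ₂ =>
    obtain rfl := List.mem_singleton.1 hΨ
    exact two (hK _ hψ _ (.andLeft ..)) (hK _ hψ _ (.andRight ..))
  | negAnd ψ₁ ψ₂ =>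
    have h := hK _ hψ _ (.neg _)
    simp only [List.mem_cons, List.not_mem_nil, or_false] at hΨ
    rcases hΨ with rfl | rfl
    · exact one (hK _ h _ (.andNegLeft ..))
    · exact two (hK _ h _ (.andLeft ..)) (hK _ h _ (.andNegRight ..))
  | p1 c z χ χ' h =>
    obtain rfl := List.mem_singleton.1 hΨ
    refine one ?_
    cases h with
    | ge_zero => exact hK _ hψ _ (.probTop ..)
    | gt_one => exact hK _ hψ _ (.probBot ..)
    | le_one => exact hK _ hψ _ (.probTop ..)
    | lt_zero => exact hK _ hψ _ (.probBot ..)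
    | ge_prob => exact hK _ hψ _ (.probArg ..)
    | gt_prob => exact hK _ hψ _ (.probArg ..)
    | le_prob => exact hK _ hψ _ (.probProb ..)
    | lt_prob => exact hK _ hψ _ (.probProb ..)
  | p2 c z χ h1 h2 =>
    obtain rfl := List.mem_singleton.1 hΨ
    exact one (hK _ hψ _ (.probArg ..))
  | p3 c z χ h1 h2 h3 =>
    obtain rfl := List.mem_singleton.1 hΨ
    exact one (hK _ (hK _ hψ _ (.probArg ..)) _ (.stateNeg _ h1 h3))
  | pTop c z χ h => obtain rfl := List.mem_singleton.1 hΨ; simp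
  | untl ψ₁ ψ₂ =>
    simp only [List.mem_cons, List.not_mem_nil, or_false] at hΨ
    rcases hΨ with rfl | rfl
    · exact one (hK _ hψ _ (.untlRight ..))
    · exact three (hK _ hψ _ (.untlLeft ..)) (hK _ hψ _ (.untlNegRight ..)) (hK _ hψ _ (.untlNext ..))
  | negUntl ψ₁ ψ₂ =>
    have h := hK _ hψ _ (.neg _)
    simp only [List.mem_cons, List.not_mem_nil, or_false] at hΨ
    rcases hΨ with rfl | rfl
    · exact two (hK _ h _ (.untlNegLeft ..)) (hK _ h _ (.untlNegRight ..))
    · exact three (hK _ h _ (.untlLeft ..)) (hK _ h _ (.untlNegRight ..)) (hK _ h _ (.untlNextNeg ..))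
  | negNext χ =>
    obtain rfl := List.mem_singleton.1 hΨ
    exact one (hK _ hψ _ (.negNext _))

/-- The closure of a formula under the rules. -/
def cl {AP : Type*} : Formula AP → Set (Formula AP)
  | .tt => {.tt, .neg .tt}
  | .atom a => {.atom a, .neg (.atom a)}
  | .neg ψ => cl ψ ∪ {.neg (.neg ψ)}
  | .and ψ₁ ψ₂ => cl ψ₁ ∪ cl ψ₂ ∪ {.and ψ₁ ψ₂, .neg (.and ψ₁ ψ₂)}
  | .prob _ z ψ => cl ψ ∪ {.tt, .neg .tt} ∪
      {χ | ∃ d, ∃ w ∈ ({z, unitInterval.symm z} : Set unitInterval), ∃ ξ ∈ cl ψ,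
        χ = .prob d w ξ ∨ χ = .neg (.prob d w ξ)}
  | .next ψ => cl ψ ∪ {.next ψ, .neg (.next ψ), .next (.neg ψ)}
  | .untl ψ₁ ψ₂ => cl ψ₁ ∪ cl ψ₂ ∪ {.untl ψ₁ ψ₂, .neg (.untl ψ₁ ψ₂), .next (.untl ψ₁ ψ₂),
      .next (.neg (.untl ψ₁ ψ₂))}

theorem mem_cl {AP : Type*} (ψ : Formula AP) : ψ ∈ cl ψ ∧ .neg ψ ∈ cl ψ := by
  induction ψ with
  | neg ψ ih => exact ⟨Or.inl ih.2, Or.inr rfl⟩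
  | prob c z ψ ih =>
    exact ⟨Or.inr ⟨c, z, Or.inl rfl, ψ, ih.1, Or.inl rfl⟩, Or.inr ⟨c, z, Or.inl rfl, ψ, ih.1, Or.inr rfl⟩⟩
  | _ => simp [cl]

theorem finite_cl {AP : Type*} (ψ : Formula AP) : (cl ψ).Finite := by
  induction ψ with
  | tt => simp [cl]
  | atom a => simp [cl]
  | neg ψ ih => exact ih.union (Set.toFinite _)
  | and ψ₁ ψ₂ ih₁ ih₂ => exact (ih₁.union ih₂).union (Set.toFinite _)
  | next ψ ih => exact ih.union (Set.toFinite _)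
  | untl ψ₁ ψ₂ ih₁ ih₂ => exact (ih₁.union ih₂).union (Set.toFinite _)
  | prob c z ψ ih =>
    refine (ih.union (Set.toFinite _)).union ?_
    have hc : (Set.univ : Set Cmp).Finite := by
      refine (Set.toFinite {Cmp.lt, Cmp.le, Cmp.gt, Cmp.ge}).subset fun c _ => ?_
      cases c <;> simp
    have h1 := (hc.prod ((Set.toFinite ({z, unitInterval.symm z} : Set unitInterval)).prod ih)).image
      (fun x => Formula.prob x.1 x.2.1 x.2.2)
    refine (h1.union (h1.image Formula.neg)).subset ?_
    rintro χ ⟨d, w, hw, ξ, hξ, rfl | rfl⟩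
    · exact Or.inl ⟨(d, w, ξ), ⟨trivial, hw, hξ⟩, rfl⟩
    · exact Or.inr ⟨_, ⟨(d, w, ξ), ⟨trivial, hw, hξ⟩, rfl⟩, rfl⟩

/-- Bounds only change from `z` to `1 - z` and back, comparisons range over four symbols, and the
bodies of `P`-formulas stay in the closure of the original body. -/
theorem closed_cl {AP : Type*} (ψ : Formula AP) : Closed (cl ψ) := by
  have htt : Closed ({.tt, .neg .tt} : Set (Formula AP)) := by
    rintro χ (rfl | rfl) ξ h <;> cases h <;> simp_all
  induction ψ with
  | tt => exact htt
  | atom a => rintro χ (rfl | rfl) ξ h <;> cases h <;> simp_all [cl]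
  | neg ψ ih =>
    refine ih.extend ?_
    rintro _ rfl χ h
    cases h with
    | neg => exact Or.inl (mem_cl ψ).2
    | stateNeg _ _ h => exact absurd rfl (h _)
  | and ψ₁ ψ₂ ih₁ ih₂ =>
    have h1 := mem_cl ψ₁
    have h2 := mem_cl ψ₂
    refine (ih₁.union ih₂).extend ?_
    rintro _ (rfl | rfl) χ h <;> cases h <;> simp_all
  | next ψ ih =>
    have h1 := mem_cl ψ
    refine ih.extend ?_
    rintro _ (rfl | rfl | rfl) χ h <;> cases h <;> simp_all [Formula.IsState]
  | untl ψ₁ ψ₂ ih₁ ih₂ =>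
    have h1 := mem_cl ψ₁
    have h2 := mem_cl ψ₂
    refine (ih₁.union ih₂).extend ?_
    rintro _ (rfl | rfl | rfl | rfl) χ h <;> cases h <;> simp_all [Formula.IsState]
  | prob c z ψ ih =>
    refine (ih.union htt).extend ?_
    have hsymm : ∀ w ∈ ({z, unitInterval.symm z} : Set unitInterval),
        unitInterval.symm w ∈ ({z, unitInterval.symm z} : Set unitInterval) := by
      rintro w (rfl | rfl) <;> simp
    rintro _ ⟨d, w, hw, ξ, hξ, rfl | rfl⟩ χ h
    · cases h with
      | probTop => exact Or.inl (Or.inr (Or.inl rfl))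
      | probBot => exact Or.inl (Or.inr (Or.inr rfl))
      | probArg => exact Or.inl (Or.inl hξ)
      | prob _ _ _ d' => exact Or.inr ⟨d', w, hw, ξ, hξ, Or.inl rfl⟩
      | probNeg _ _ ζ d' =>
        exact Or.inr ⟨d', _, hsymm w hw, ζ, ih _ hξ _ (.neg _), Or.inl rfl⟩
      | probProb _ _ c' z' ζ d' d'' =>
        exact Or.inr ⟨d', _, hsymm w hw, _, ih _ hξ _ (.prob _ _ _ d''), Or.inl rfl⟩
      | stateNeg => exact Or.inr ⟨d, w, hw, ξ, hξ, Or.inr rfl⟩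
    · cases h with
      | neg => exact Or.inr ⟨d, w, hw, ξ, hξ, Or.inl rfl⟩
      | stateNeg _ _ h => exact absurd rfl (h _)

/-- The nesting depth of the probability operator. -/
def pdepth {AP : Type*} : Formula AP → ℕ
  | .tt => 0
  | .atom _ => 0
  | .neg ψ => pdepth ψ
  | .and ψ₁ ψ₂ => max (pdepth ψ₁) (pdepth ψ₂)
  | .prob _ _ ψ => pdepth ψ + 1
  | .next ψ => pdepth ψ
  | .untl ψ₁ ψ₂ => max (pdepth ψ₁) (pdepth ψ₂)

/-- Bounds the depth of recursive calls: the closure of the body of a `P`-formula has smaller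
nesting depth than the formula. -/
theorem pdepth_le {AP : Type*} {ψ χ : Formula AP} (h : χ ∈ cl ψ) : pdepth χ ≤ pdepth ψ := by
  induction ψ generalizing χ with
  | tt => rcases h with rfl | rfl <;> simp [pdepth]
  | atom a => rcases h with rfl | rfl <;> simp [pdepth]
  | neg ψ ih =>
    rcases h with h | rfl
    · exact ih h
    · simp [pdepth]
  | and ψ₁ ψ₂ ih₁ ih₂ =>
    rcases h with (h | h) | (rfl | rfl)
    · exact le_max_of_le_left (ih₁ h)
    · exact le_max_of_le_right (ih₂ h)
    all_goals simp [pdepth]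
  | next ψ ih =>
    rcases h with h | (rfl | rfl | rfl)
    · exact ih h
    all_goals simp [pdepth]
  | untl ψ₁ ψ₂ ih₁ ih₂ =>
    rcases h with (h | h) | (rfl | rfl | rfl | rfl)
    · exact le_max_of_le_left (ih₁ h)
    · exact le_max_of_le_right (ih₂ h)
    all_goals simp [pdepth]
  | prob c z ψ ih =>
    rcases h with (h | (rfl | rfl)) | ⟨d, w, hw, ξ, hξ, rfl | rfl⟩
    · exact (ih h).trans (Nat.le_succ _)
    · simp [pdepth]
    · simp [pdepth]
    · exact Nat.succ_le_succ (ih hξ)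
    · exact Nat.succ_le_succ (ih hξ)

end PCTLSynth


namespace PCTLSynth

/-! ## Shapes of the selected inferences -/

section Moves

variable {S A M AP : Type*} [Fintype S] [Fintype A] {D : MDP S A AP} {ρ : PartialPolicy S M}

/-- The truth of a `P`-formula in the policy state of a leaf has been decided. -/
def Leaf.dec (l : Leaf S A M AP) (c : Cmp) (z : unitInterval) (ψ : Formula AP) : Prop :=
  HasCmp l.prog l.pivot.mode l.pivot.state ψ c z

/-- The shapes of a most preferred inference at a leaf that is not poised. -/
inductive LocalMove (D : MDP S A AP) (l : Leaf S A M AP) : Outcome S A M AP → Prop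
  | cross (ψ) : ψ ∈ l.pivot.fmls → ((ψ.IsClassical ∧ ¬ ψ.EvalClassical (D.label l.pivot.state)) ∨
      ∃ c z χ, ψ = .prob c z χ ∧ l.dec c.compl z χ) → LocalMove D l (.close (l.pivotEq 0) .cross)
  | check : l.pivot.fmls = ∅ → LocalMove D l (.close (l.pivotEq 1) .check)
  | call (c z ψ) : .prob c z ψ ∈ l.pivot.fmls → ¬ l.dec c z ψ → ¬ l.dec c.compl z ψ →
      LocalMove D l (.call c z ψ)
  | expand (ψ Ls γ) : ψ ∈ l.pivot.fmls → Expands (D.label l.pivot.state) l.dec ψ Ls →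
      -- The added equation matters only under valuations that ignore node names, such as
      -- `Policy.val`. For these it says that the pivot has the total probability of the
      -- conclusions.
      (∀ (σ : Var S A M AP → ℝ) (f : LForm S M AP → ℝ), (∀ u F, σ (.prob u F) = f F) →
        (γ.rel.Holds (γ.lhs.eval σ) (γ.rhs.eval σ) ↔ f l.pivot = ((Ls.map (l.replace ψ)).map f).sum)) →
      LocalMove D l (.union false (Ls.map (l.replace ψ)) γ)

/-- All enabled actions have been decided in the policy state of a leaf. -/
def Leaf.Decided (D : MDP S A AP) (l : Leaf S A M AP) : Prop :=
  ∀ α ∈ D.enabled l.pivot.state, actZero l.pivot.mode l.pivot.state α ∈ l.prog ∨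
    actPos l.pivot.mode l.pivot.state α ∈ l.prog

/-- The list enumerates the successor states under the prescribed actions. -/
def Leaf.Enum (D : MDP S A AP) (l : Leaf S A M AP) (ts : List S) : Prop :=
  ts.Nodup ∧ ∀ t, t ∈ ts ↔ ∃ α ∈ prescribed l.prog l.pivot.mode l.pivot.state,
    t ∈ succ D l.pivot.state α

/-- The shapes of a most preferred inference at a poised leaf. -/
inductive PoisedMove (D : MDP S A AP) (ρ : PartialPolicy S M) (l : Leaf S A M AP) :
    Outcome S A M AP → Prop
  | act (α) : α ∈ D.enabled l.pivot.state → actZero l.pivot.mode l.pivot.state α ∉ l.prog →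
      actPos l.pivot.mode l.pivot.state α ∉ l.prog → PoisedMove D ρ l
        (.dontKnow (actZero l.pivot.mode l.pivot.state α) (actPos l.pivot.mode l.pivot.state α))
  | prescribed : l.Decided D → prescribedConstr l.prog l.pivot.mode l.pivot.state ∉ l.prog →
      PoisedMove D ρ l (.extend (prescribedConstr l.prog l.pivot.mode l.pivot.state))
  | yesLoop (v) : l.Decided D → l.YesBlocked v →
      PoisedMove D ρ l (.close ⟨xF l.name l.pivot, .eq, xF v.name l.pivot⟩ (.yesLoop v.name))
  | noLoop (v) : l.Decided D → (∀ v, ¬ l.YesBlocked v) → l.NoBlocked v →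
      PoisedMove D ρ l (.close ⟨xF l.name l.pivot, .eq, xF v.name l.pivot⟩ (.noLoop v.name))
  | next (ts) : l.Decided D → (∀ v, ¬ l.YesBlocked v) → (∀ v, ¬ l.NoBlocked v) → l.Enum D ts →
      PoisedMove D ρ l (nextOutcome D ρ l ts)

theorem not_poised_of_rule {l : Leaf S A M AP} {n : ℕ} {o : Outcome S A M AP} (h : Rule D ρ l n o)
    (hn : n < 17) : ¬ l.pivot.Poised := by
  intro hp
  cases h <;> (try omega)
  case top ψ h1 h2 _ => obtain ⟨χ, rfl⟩ := hp.2 _ h1; exact h2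
  case cross ψ h1 h2 _ => obtain ⟨χ, rfl⟩ := hp.2 _ h1; exact h2
  case check h1 => exact hp.1.ne_empty h1
  all_goals
    rename_i h1
    obtain ⟨χ, hχ⟩ := hp.2 _ (by assumption)
    cases hχ

/-- The side conditions of `Expands` that are not premises of the rule come from the preference
order: had they failed, a better rule would have been applicable. -/
theorem Strategy.localMove (strat : Strategy D ρ) {l : Leaf S A M AP} (h : ¬ l.pivot.Poised) :
    LocalMove D l (strat.pick l) := by
  obtain ⟨n, hr, hmin⟩ := strat.admissible l
  generalize strat.pick l = o at *
  have one : ∀ ψ Ψ, ψ ∈ l.pivot.fmls → Expands (D.label l.pivot.state) l.dec ψ [Ψ] →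
      LocalMove D l (l.one (l.replace ψ Ψ)) := fun ψ Ψ h1 h2 => by
    refine .expand ψ [Ψ] _ h1 h2 fun σ f hf => ?_
    simp [CRel.Holds, Expr.eval, xF, hf]
  have two : ∀ ψ Ψ Ψ', ψ ∈ l.pivot.fmls → Expands (D.label l.pivot.state) l.dec ψ [Ψ, Ψ'] →
      LocalMove D l (l.two (l.replace ψ Ψ) (l.replace ψ Ψ')) := fun ψ Ψ Ψ' h1 h2 => by
    refine .expand ψ [Ψ, Ψ'] _ h1 h2 fun σ f hf => ?_
    simp [CRel.Holds, Expr.eval, xF, hf]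
  cases hr with
  | top ψ h1 h2 h3 => exact one _ _ h1 (.top _ h2 h3)
  | cross ψ h1 h2 h3 => exact .cross ψ h1 (Or.inl ⟨h2, h3⟩)
  | check h1 => exact .check h1
  | negNeg ψ h1 => exact one _ _ h1 (.negNeg _)
  | negP c z ψ h1 => exact one _ _ h1 (.negP ..)
  | pNeg c z ψ h1 => exact one _ _ h1 (.pNeg ..)
  | and ψ₁ ψ₂ h1 => exact one _ _ h1 (.and ..)
  | negAnd ψ₁ ψ₂ h1 => exact two _ _ _ h1 (.negAnd ..)
  | p1 c z ψ ψ' h1 h2 => exact one _ _ h1 (.p1 _ _ _ _ h2)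
  | p2 c z ψ h1 h2 h3 =>
    refine one _ _ h1 (.p2 _ _ _ h2 ?_)
    rcases h3 with rfl | rfl
    · refine Or.inl ⟨rfl, ?_⟩
      -- With the bound `> 1` the preferred simplification to `false` would apply.
      rintro rfl
      have := hmin _ _ (.p1 _ _ _ _ h1 (.gt_one ψ))
      omega
    · refine Or.inr ⟨rfl, ?_⟩
      rintro rfl
      have := hmin _ _ (.p1 _ _ _ _ h1 (.ge_zero ψ))
      omega
  | p3 c z ψ h1 h2 h3 =>
    refine one _ _ h1 (.p3 _ _ _ h2 ?_ ?_)
    · rcases h3 with rfl | rfl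
      · refine Or.inr ⟨rfl, ?_⟩
        rintro rfl
        have := hmin _ _ (.p1 _ _ _ _ h1 (.lt_zero ψ))
        omega
      · refine Or.inl ⟨rfl, ?_⟩
        rintro rfl
        have := hmin _ _ (.p1 _ _ _ _ h1 (.le_one ψ))
        omega
    -- Moving a negation out of `P` has preference.
    · rintro χ rfl
      have := hmin _ _ (.pNeg _ _ _ h1)
      omega
  | p c z ψ h1 h2 h3 => exact .call c z ψ h1 h2 h3
  | pTop c z ψ h1 h2 => exact one _ _ h1 (.pTop _ _ _ h2)
  | pCross c z ψ h1 h2 => exact .cross _ h1 (Or.inr ⟨c, z, ψ, rfl, h2⟩)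
  | untl ψ₁ ψ₂ h1 => exact two _ _ _ h1 (.untl ..)
  | negUntl ψ₁ ψ₂ h1 => exact two _ _ _ h1 (.negUntl ..)
  | negNext ψ h1 => exact one _ _ h1 (.negNext _)
  | a _ h1 => exact absurd h1 h
  | prescribed h1 => exact absurd h1 h
  | yesLoop _ h1 => exact absurd h1 h
  | noLoop _ h1 => exact absurd h1 h
  | next _ h1 => exact absurd h1 h

/-- Preference again supplies the extra information: all actions are decided before loops and
transitions are considered, and transitions only happen at nodes that are not blocked. -/
theorem Strategy.poisedMove (strat : Strategy D ρ) {l : Leaf S A M AP} (h : l.pivot.Poised) :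
    PoisedMove D ρ l (strat.pick l) := by
  obtain ⟨n, hr, hmin⟩ := strat.admissible l
  generalize strat.pick l = o at *
  have hge : 17 ≤ n := not_lt.1 fun hn => not_poised_of_rule hr hn h
  have decided : 18 ≤ n → l.Decided D := fun hn α hα => by
    by_contra hc
    push Not at hc
    have := hmin _ _ (.a α h hα hc.1 hc.2)
    omega
  have notYes : 20 ≤ n → ∀ v, ¬ l.YesBlocked v := fun hn v hv => by
    have := hmin _ _ (.yesLoop v h hv)
    omega
  have notNo : 21 ≤ n → ∀ v, ¬ l.NoBlocked v := fun hn v hv => by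
    have := hmin _ _ (.noLoop v h hv)
    omega
  cases hr <;> (try omega)
  case a α h1 h2 h3 h4 => exact .act α h2 h3 h4
  case prescribed h1 h2 => exact .prescribed (decided (by omega)) h2
  case yesLoop v h1 h2 => exact .yesLoop v (decided (by omega)) h2
  case noLoop v h1 h2 => exact .noLoop v (decided (by omega)) (notYes (by omega)) h2
  case next ts h1 h2 h3 =>
    exact .next ts (decided (by omega)) (notYes (by omega)) (notNo (by omega)) ⟨h2, h3⟩

end Moves

/-! ## Guided derivations -/

section Guided

variable {S A M AP : Type*} [Fintype S] [Fintype A] {D : MDP S A AP} {ρ : PartialPolicy S M}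

/-- The constraint holds under the valuation. -/
def Constr.Sat {V : Type*} (γ : Constr V) (σ : V → ℝ) : Prop :=
  γ.rel.Holds (γ.lhs.eval σ) (γ.rhs.eval σ)

/-- The selected inference is the one for transitions into successor states. -/
def Strategy.byX (strat : Strategy D ρ) (l : Leaf S A M AP) : Bool :=
  match strat.pick l with
  | .union b _ _ => b
  | _ => false

/-- The tableau given by its leaves in the moment of their closing or branching. -/
def tab (strat : Strategy D ρ) (P : Set (Leaf S A M AP)) : Tab S A M AP :=
  {n | ∃ l ∈ P, n = l.toNode (strat.byX l)} ∪
    {n | ∃ l ∈ P, ∃ γ k, strat.pick l = .close γ k ∧ n = l.closed γ k}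

/-- Derivations whose don't-know choices are true under a valuation; `P` collects the leaves in the
moment of their closing or branching. -/
inductive Guided (strat : Strategy D ρ) (σ : Var S A M AP → ℝ) :
    Leaf S A M AP → Set (Leaf S A M AP) → Prop
  | close (l γ k) : strat.pick l = .close γ k → Guided strat σ l {l}
  | union (l byX concl γ) (Ps : Fin (List.length concl) → Set (Leaf S A M AP)) :
      strat.pick l = .union byX concl γ → (∀ i, Guided strat σ (l.child concl γ i) (Ps i)) →
      Guided strat σ l ({l} ∪ ⋃ i, Ps i)
  | choose (l γl γr γ P) : strat.pick l = .dontKnow γl γr → γ = γl ∨ γ = γr → γ.Sat σ →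
      Guided strat σ (l.addConstrs {γ}) P → Guided strat σ l P
  | extend (l γ P) : strat.pick l = .extend γ →
      Guided strat σ (l.addConstrs {γ}) P → Guided strat σ l P
  | call (l c z ψ d P' P) : strat.pick l = .call c z ψ → d = c ∨ d = c.compl →
      Constr.Sat (cmpConstr (l.callName c z ψ) l.pivot.mode l.pivot.state ψ d z) σ →
      Guided strat σ (l.callLeaf c z ψ) P' →
      Guided strat σ (l.addConstrs (Tab.gamma (tab strat P') ∪
        {cmpConstr (l.callName c z ψ) l.pivot.mode l.pivot.state ψ d z})) P →
      Guided strat σ l P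

theorem Guided.derives {strat : Strategy D ρ} {σ : Var S A M AP → ℝ} {l : Leaf S A M AP}
    {P : Set (Leaf S A M AP)} (h : Guided strat σ l P) : Derives strat l (tab strat P) := by
  induction h with
  | close l γ k hp =>
    have : tab strat {l} = {l.toNode false, l.closed γ k} := by
      ext n
      simp only [tab, hp, Strategy.byX, Set.mem_union, Set.mem_ofPred_eq, Set.mem_singleton_iff,
        exists_eq_left, Outcome.close.injEq, Set.mem_insert_iff]
      simp
    rw [this]
    exact .close l γ k hp
  | union l byX concl γ Ps hp _ ih =>
    have : tab strat ({l} ∪ ⋃ i, Ps i) = {l.toNode byX} ∪ ⋃ i, tab strat (Ps i) := by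
      ext n
      simp only [tab, Set.mem_union, Set.mem_iUnion, Set.mem_singleton_iff, Set.mem_ofPred_eq]
      constructor
      · rintro (⟨x, rfl | ⟨i, hx⟩, rfl⟩ | ⟨x, rfl | ⟨i, hx⟩, γ', k, hk, rfl⟩)
        · exact Or.inl (by simp [Strategy.byX, hp])
        · exact Or.inr ⟨i, Or.inl ⟨x, hx, rfl⟩⟩
        · rw [hp] at hk; cases hk
        · exact Or.inr ⟨i, Or.inr ⟨x, hx, γ', k, hk, rfl⟩⟩
      · rintro (rfl | ⟨i, ⟨x, hx, rfl⟩ | ⟨x, hx, γ', k, hk, rfl⟩⟩)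
        · exact Or.inl ⟨l, Or.inl rfl, by simp [Strategy.byX, hp]⟩
        · exact Or.inl ⟨x, Or.inr ⟨i, hx⟩, rfl⟩
        · exact Or.inr ⟨x, Or.inr ⟨i, hx⟩, γ', k, hk, rfl⟩
    rw [this]
    exact .union l byX concl γ _ hp ih
  | choose l γl γr γ P hp hγ _ _ ih =>
    rcases hγ with rfl | rfl
    · exact .left _ _ _ _ hp ih
    · exact .right _ _ _ _ hp ih
  | extend l γ P hp _ ih => exact .extend _ _ _ hp ih
  | call l c z ψ d P' P hp hd _ _ _ ih' ih =>
    rcases hd with rfl | rfl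
    · exact .callLeft _ _ _ _ _ _ hp ih' ih
    · exact .callRight _ _ _ _ _ _ hp ih' ih

/-- `x` is the leaf `l` with a possibly larger program. -/
def Leaf.Extends (l x : Leaf S A M AP) : Prop :=
  x.name = l.name ∧ x.pivot = l.pivot ∧ x.anc = l.anc ∧ l.prog ⊆ x.prog

/-- `y` extends the `i`-th conclusion of the union rule selected at `x`. -/
def IsKid (strat : Strategy D ρ) (x y : Leaf S A M AP) (i : ℕ) : Prop :=
  ∃ b concl γ, strat.pick x = .union b concl γ ∧ ∃ h : i < concl.length,
    y.name = childName x.name i ∧ y.pivot = concl[i] ∧ y.anc = x.toAnc :: x.anc ∧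
    x.prog ⊆ y.prog

/-- The tree structure of the set of closed or branching leaves developed from `l₀`. -/
structure IsTree (strat : Strategy D ρ) (l₀ : Leaf S A M AP) (P : Set (Leaf S A M AP)) : Prop where
  fin : P.Finite
  root : ∃ x ∈ P, l₀.Extends x
  le : ∀ x ∈ P, l₀.name <+: x.name
  inj : ∀ x ∈ P, ∀ y ∈ P, x.name = y.name → x = y
  kids : ∀ x ∈ P, ∀ b concl γ, strat.pick x = .union b concl γ → ∀ i < concl.length,
    ∃ y ∈ P, IsKid strat x y i
  parent : ∀ y ∈ P, l₀.Extends y ∨ ∃ x ∈ P, ∃ i, IsKid strat x y i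
  done : ∀ x ∈ P, (∃ γ k, strat.pick x = .close γ k) ∨ ∃ b concl γ, strat.pick x = .union b concl γ

theorem IsTree.of_addConstrs {strat : Strategy D ρ} {l : Leaf S A M AP} {Γ : Program S A M AP}
    {P : Set (Leaf S A M AP)} (h : IsTree strat (l.addConstrs Γ) P) : IsTree strat l P where
  fin := h.fin
  root := by
    obtain ⟨x, hx, h1, h2, h3, h4⟩ := h.root
    exact ⟨x, hx, h1, h2, h3, fun γ hγ => h4 (Or.inl hγ)⟩
  le := h.le
  inj := h.inj
  kids := h.kids
  parent y hy := by
    rcases h.parent y hy with ⟨h1, h2, h3, h4⟩ | h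
    · exact Or.inl ⟨h1, h2, h3, fun γ hγ => h4 (Or.inl hγ)⟩
    · exact Or.inr h
  done := h.done

theorem childName_inj {u v : Name AP} {i j : ℕ} (h : childName u i = childName v j) :
    u = v ∧ i = j := by
  have := List.append_inj' h rfl
  refine ⟨this.1, ?_⟩
  simpa using this.2

theorem prefix_childName (u : Name AP) (i : ℕ) : u <+: childName u i := List.prefix_append _ _

/-- Inferences that only enlarge the program keep the node, so all structure comes from union rules.
The subtrees of different children are disjoint since a name has only one prefix of each length. -/
theorem Guided.isTree {strat : Strategy D ρ} {σ : Var S A M AP → ℝ} {l : Leaf S A M AP}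
    {P : Set (Leaf S A M AP)} (h : Guided strat σ l P) : IsTree strat l P := by
  induction h with
  | close l γ k hp =>
    refine ⟨Set.finite_singleton _, ⟨l, rfl, rfl, rfl, rfl, subset_rfl⟩, ?_, ?_, ?_, ?_, ?_⟩
    · rintro x rfl; exact List.prefix_rfl
    · rintro x rfl y rfl _; rfl
    · rintro x rfl b concl γ' h'; rw [hp] at h'; cases h'
    · rintro x rfl; exact Or.inl ⟨rfl, rfl, rfl, subset_rfl⟩
    · rintro x rfl; exact Or.inl ⟨γ, k, hp⟩
  | union l byX concl γ Ps hp _ ih =>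
    have hlt : ∀ i, ∀ x ∈ Ps i, l.name.length < x.name.length := fun i x hx => by
      have := ((ih i).le x hx).length_le
      simp only [Leaf.child, childName, List.length_append, List.length_cons] at this
      omega
    have hkid : ∀ i x, (l.child concl γ i).Extends x → IsKid strat l x i := by
      rintro i x ⟨h1, h2, h3, h4⟩
      exact ⟨byX, concl, γ, hp, i.2, h1, h2, h3, fun γ' hγ' => h4 (Or.inl hγ')⟩
    refine ⟨(Set.finite_singleton _).union (Set.finite_iUnion fun i => (ih i).fin),
      ⟨l, Or.inl rfl, rfl, rfl, rfl, subset_rfl⟩, ?_, ?_, ?_, ?_, ?_⟩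
    · rintro x (rfl | hx)
      · exact List.prefix_rfl
      · obtain ⟨i, hx⟩ := Set.mem_iUnion.1 hx
        exact (prefix_childName _ _).trans ((ih i).le x hx)
    · rintro x (rfl | hx) y (rfl | hy) hxy
      · rfl
      · obtain ⟨j, hy⟩ := Set.mem_iUnion.1 hy
        have := hlt j y hy
        rw [hxy] at this; omega
      · obtain ⟨i, hx⟩ := Set.mem_iUnion.1 hx
        have := hlt i x hx
        rw [hxy] at this; omega
      · obtain ⟨i, hx⟩ := Set.mem_iUnion.1 hx
        obtain ⟨j, hy⟩ := Set.mem_iUnion.1 hy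
        have h1 := (ih i).le x hx
        have h2 := (ih j).le y hy
        rw [← hxy] at h2
        have h3 : childName l.name i = childName l.name j :=
          (List.prefix_of_prefix_length_le h1 h2 (by simp [Leaf.child, childName])).eq_of_length
            (by simp [Leaf.child, childName])
        have := Fin.ext (childName_inj h3).2
        subst this
        exact (ih i).inj x hx y hy hxy
    · rintro x (rfl | hx) b concl' γ' h' i hi
      · rw [hp] at h'
        cases h'
        obtain ⟨y, hy, hy'⟩ := (ih ⟨i, hi⟩).root
        exact ⟨y, Or.inr (Set.mem_iUnion.2 ⟨_, hy⟩), hkid _ _ hy'⟩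
      · obtain ⟨j, hx⟩ := Set.mem_iUnion.1 hx
        obtain ⟨y, hy, hy'⟩ := (ih j).kids x hx b concl' γ' h' i hi
        exact ⟨y, Or.inr (Set.mem_iUnion.2 ⟨_, hy⟩), hy'⟩
    · rintro y (rfl | hy)
      · exact Or.inl ⟨rfl, rfl, rfl, subset_rfl⟩
      · obtain ⟨j, hy⟩ := Set.mem_iUnion.1 hy
        right
        rcases (ih j).parent y hy with h | ⟨x, hx, i, hi⟩
        · exact ⟨l, Or.inl rfl, _, hkid _ _ h⟩
        · exact ⟨x, Or.inr (Set.mem_iUnion.2 ⟨_, hx⟩), i, hi⟩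
    · rintro x (rfl | hx)
      · exact Or.inr ⟨byX, concl, γ, hp⟩
      · obtain ⟨j, hx⟩ := Set.mem_iUnion.1 hx
        exact (ih j).done x hx
  | choose l γl γr γ P hp hγ _ _ ih => exact ih.of_addConstrs
  | extend l γ P hp _ ih => exact ih.of_addConstrs
  | call l c z ψ d P' P hp hd _ _ _ ih' ih => exact ih.of_addConstrs

end Guided

/-! ## Trees of leaves -/

section Trees

variable {S A M AP : Type*} [Fintype S] [Fintype A] {D : MDP S A AP} {ρ : PartialPolicy S M}
  {strat : Strategy D ρ}

theorem IsKid.prefix_or_eq {x y z : Leaf S A M AP} {i : ℕ} (h : IsKid strat x y i)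
    (hz : z.name <+: y.name) : z.name <+: x.name ∨ z.name = y.name := by
  obtain ⟨b, concl, γ, hp, hi, hn, _⟩ := h
  rw [hn] at hz ⊢
  rcases List.prefix_concat_iff.1 hz with h | h
  · exact Or.inr h
  · exact Or.inl h

theorem IsKid.prefix {x y : Leaf S A M AP} {i : ℕ} (h : IsKid strat x y i) : x.name <+: y.name := by
  obtain ⟨b, concl, γ, hp, hi, hn, _⟩ := h
  rw [hn]
  exact prefix_childName _ _

theorem IsKid.length {x y : Leaf S A M AP} {i : ℕ} (h : IsKid strat x y i) :
    y.name.length = x.name.length + 1 := by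
  obtain ⟨b, concl, γ, hp, hi, hn, _⟩ := h
  rw [hn]
  simp [childName]

end Trees

namespace IsTree

variable {S A M AP : Type*} [Fintype S] [Fintype A] {D : MDP S A AP} {ρ : PartialPolicy S M}
  {strat : Strategy D ρ} {l₀ : Leaf S A M AP} {P : Set (Leaf S A M AP)} (hT : IsTree strat l₀ P)

include hT

theorem isKid_of_name {x y : Leaf S A M AP} (hx : x ∈ P) (hy : y ∈ P) {i : ℕ}
    (h : y.name = childName x.name i) : IsKid strat x y i := by
  rcases hT.parent y hy with h' | ⟨z, hz, j, hj⟩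
  · have h1 := (hT.le x hx).length_le
    rw [← h'.1, h] at h1
    simp only [childName, List.length_append, List.length_cons] at h1
    omega
  · have hj' := hj
    obtain ⟨b, concl, γ, hp, hi, hn, _⟩ := hj
    rw [h] at hn
    obtain ⟨h1, rfl⟩ := childName_inj hn
    rwa [hT.inj x hx z hz h1]

/-- Induction from a node downwards. -/
theorem induct {z : Leaf S A M AP} (hz : z ∈ P) {motive : Leaf S A M AP → Prop} (base : motive z)
    (step : ∀ x ∈ P, ∀ y ∈ P, ∀ i, z.name <+: x.name → IsKid strat x y i → motive x → motive y)
    {y : Leaf S A M AP} (hy : y ∈ P) (hzy : z.name <+: y.name) : motive y := by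
  induction hn : y.name.length using Nat.strong_induction_on generalizing y with
  | _ n ih =>
    by_cases he : z.name = y.name
    · rwa [← hT.inj z hz y hy he]
    rcases hT.parent y hy with h' | ⟨x, hx, i, hk⟩
    · refine absurd ?_ he
      have h1 := hT.le z hz
      rw [← h'.1] at h1
      exact hzy.eq_of_length (le_antisymm hzy.length_le h1.length_le)
    · have hzx := (hk.prefix_or_eq hzy).resolve_right he
      refine step x hx y hy i hzx hk (ih x.name.length ?_ hx hzx rfl)
      obtain ⟨b, concl, γ, hp, hi, hn', _⟩ := hk
      rw [← hn, hn']
      simp [childName]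

/-- Translates blocking, which speaks of the recorded ancestors, into the prefix order of names.
Initial leaves and leaves of recursive calls have no recorded ancestors, so loops stay within one
tableau. -/
theorem mem_anc (h0 : l₀.anc = []) {x : Leaf S A M AP} (hx : x ∈ P) {a : Anc S M AP} :
    a ∈ x.anc ↔ ∃ y ∈ P, y.toAnc = a ∧ y.name.Above x.name := by
  obtain ⟨r, hr, hr'⟩ := hT.root
  have hrx : r.name <+: x.name := by rw [hr'.1]; exact hT.le x hx
  refine hT.induct hr (motive := fun x => a ∈ x.anc ↔ ∃ y ∈ P, y.toAnc = a ∧ y.name.Above x.name)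
    ?_ ?_ hx hrx
  · rw [hr'.2.2.1, h0]
    refine ⟨fun h => by simp at h, ?_⟩
    rintro ⟨y, hy, _, h1, h2⟩
    have h3 := hT.le y hy
    rw [← hr'.1] at h3
    exact absurd (h1.eq_of_length (le_antisymm h1.length_le h3.length_le)) h2
  · intro x hx y hy i _ hk ih
    have hk' := hk
    obtain ⟨b, concl, γ, hp, hi, hn, _, ha, _⟩ := hk
    rw [ha, List.mem_cons, ih]
    constructor
    · rintro (rfl | ⟨z, hz, rfl, h1, h2⟩)
      · refine ⟨x, hx, rfl, ?_, ?_⟩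
        · rw [hn]; exact prefix_childName _ _
        · rw [hn]; intro h
          have := congrArg List.length h
          simp [childName] at this
      · refine ⟨z, hz, rfl, ?_, ?_⟩
        · rw [hn]; exact h1.trans (prefix_childName _ _)
        · rw [hn]; intro h
          have := h1.length_le
          rw [h] at this
          simp [childName] at this
    · rintro ⟨z, hz, rfl, h1, h2⟩
      have h3 := (hk'.prefix_or_eq h1).resolve_right h2
      by_cases h4 : z.name = x.name
      · exact Or.inl (by rw [hT.inj z hz x hx h4])
      · exact Or.inr ⟨z, hz, rfl, h3, h4⟩

/-- An infinite sequence of children does not exist. -/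
theorem not_forall_kid (x : ℕ → Leaf S A M AP) (hx : ∀ n, x n ∈ P) (N : ℕ)
    (h : ∀ n ≥ N, ∃ i, IsKid strat (x n) (x (n + 1)) i) : False := by
  -- Names grow with every child, but their lengths are bounded in a finite tree.
  obtain ⟨B, hB⟩ := (hT.fin.image fun x => x.name.length).bddAbove
  have hlen : ∀ k, k ≤ (x (N + k)).name.length := by
    intro k
    induction k with
    | zero => exact Nat.zero_le _
    | succ k ih =>
      obtain ⟨i, b, concl, γ, hp, hi, hn, _⟩ := h (N + k) (Nat.le_add_right _ _)
      rw [← Nat.add_assoc, hn]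
      simp only [childName, List.length_append, List.length_cons, List.length_nil]
      omega
  have h1 := hlen (B + 1)
  have h2 : (x (N + (B + 1))).name.length ≤ B := hB ⟨_, hx _, rfl⟩
  omega

end IsTree

end PCTLSynth


namespace PCTLSynth

/-! ## Existence of guided derivations -/

section Existence

variable {S A M AP : Type*}

/-- What the ancestors of a leaf record about a pivot: that it occurs, that it occurs twice, and
that an until formula is fulfilled between two of its occurrences. -/
def record (anc : List (Anc S M AP)) :
    Set (LForm S M AP × Option (Option (Formula AP × Formula AP))) :=
  {k | match k.2 with
    | none => ∃ a ∈ anc, a.pivot = k.1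
    | some none => ∃ a ∈ anc, ∃ b ∈ anc, a.pivot = k.1 ∧ b.pivot = k.1 ∧ a.name.Above b.name
    | some (some e) => ∃ a ∈ anc, ∃ b ∈ anc, ∃ x ∈ anc, a.pivot = k.1 ∧ b.pivot = k.1 ∧
        a.name.Above x.name ∧ (x.name = b.name ∨ x.name.Above b.name) ∧
        .next (.untl e.1 e.2) ∈ k.1.fmls ∧ e.2 ∈ x.pivot.fmls}

theorem record_mono {anc anc' : List (Anc S M AP)} (h : anc ⊆ anc') : record anc ⊆ record anc' := by
  rintro ⟨F, _ | _ | e⟩ hk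
  · obtain ⟨a, ha, h1⟩ := hk
    exact ⟨a, h ha, h1⟩
  · obtain ⟨a, ha, b, hb, h1⟩ := hk
    exact ⟨a, h ha, b, h hb, h1⟩
  · obtain ⟨a, ha, b, hb, x, hx, h1⟩ := hk
    exact ⟨a, h ha, b, h hb, x, h hx, h1⟩

/-- The records over a set of formulas. -/
def records (S M : Type*) (K : Set (Formula AP)) :
    Set (LForm S M AP × Option (Option (Formula AP × Formula AP))) :=
  {k | k.1.fmls ⊆ K ∧ ∀ e, k.2 = some (some e) → e.1 ∈ K ∧ e.2 ∈ K}

theorem finite_records [Finite S] [Finite M] {K : Set (Formula AP)} (hK : K.Finite) :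
    (records S M K).Finite := by
  have h1 : {F : LForm S M AP | F.fmls ⊆ K}.Finite := by
    refine (((Set.finite_univ (α := M)).prod ((Set.finite_univ (α := S)).prod hK.finite_subsets)).image
      (fun x => (⟨x.1, x.2.1, x.2.2⟩ : LForm S M AP))).subset ?_
    rintro ⟨m, s, Ψ⟩ h
    exact ⟨(m, s, Ψ), ⟨trivial, trivial, h⟩, rfl⟩
  have h2 : ({none, some none} ∪ (fun e => some (some e)) '' (K ×ˢ K) :
      Set (Option (Option (Formula AP × Formula AP)))).Finite :=
    (Set.toFinite _).union ((hK.prod hK).image _)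
  refine (h1.prod h2).subset ?_
  rintro ⟨F, _ | _ | e⟩ ⟨hF, he⟩
  · exact ⟨hF, Or.inl (by simp)⟩
  · exact ⟨hF, Or.inl (by simp)⟩
  · exact ⟨hF, Or.inr ⟨e, he e rfl, rfl⟩⟩

/-- The names of the listed ancestors of a leaf are above it. -/
def Leaf.Wf (l : Leaf S A M AP) : Prop := ∀ a ∈ l.anc, a.name.Above l.name

theorem Name.above_of_length {u v w : Name AP} (hu : u <+: w) (hv : v <+: w)
    (h : u.length < v.length) : u.Above v :=
  ⟨List.prefix_of_prefix_length_le hu hv h.le, fun he => by rw [he] at h; omega⟩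

theorem Name.Above.trans_le {u v w : Name AP} (h : u.Above v) (h' : v <+: w) : u.Above w :=
  ⟨h.1.trans h', fun he => h.2 (h.1.eq_of_length (le_antisymm h.1.length_le (by
    rw [he]; exact h'.length_le)))⟩

theorem Name.Above.length {u v : Name AP} (h : u.Above v) : u.length < v.length :=
  lt_of_le_of_ne h.1.length_le fun he => h.2 (h.1.eq_of_length he)

/-- The occurrence of a pivot that is not blocked adds to the record. -/
theorem exists_new_record {l : Leaf S A M AP} (hl : l.Wf) {K : Set (Formula AP)} (hK : Closed K)
    (hF : l.pivot.fmls ⊆ K) (hno : ∀ v, ¬ l.NoBlocked v) :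
    ∃ k ∈ records S M K, k ∈ record (l.toAnc :: l.anc) ∧ k ∉ record l.anc := by
  -- The first and the second occurrence of a pivot on a branch are new records by themselves; from
  -- the third one on, the failure of no-blocking provides a newly fulfilled until formula.
  by_cases h1 : ∃ a ∈ l.anc, a.pivot = l.pivot
  swap
  · exact ⟨(l.pivot, none), ⟨hF, fun e he => by cases he⟩, ⟨l.toAnc, List.mem_cons_self, rfl⟩, h1⟩
  by_cases h2 : ∃ a ∈ l.anc, ∃ b ∈ l.anc, a.pivot = l.pivot ∧ b.pivot = l.pivot ∧ a.name.Above b.name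
  swap
  · obtain ⟨a, ha, ha'⟩ := h1
    exact ⟨(l.pivot, some none), ⟨hF, fun e he => by cases he⟩,
      ⟨a, List.mem_cons_of_mem _ ha, l.toAnc, List.mem_cons_self, ha', rfl, hl a ha⟩, h2⟩
  have hfin : {a | a ∈ l.anc ∧ a.pivot = l.pivot}.Finite :=
    (List.finite_toSet l.anc).subset fun a h => h.1
  have hne : {a | a ∈ l.anc ∧ a.pivot = l.pivot}.Nonempty := by
    obtain ⟨a, ha, ha'⟩ := h1
    exact ⟨a, ha, ha'⟩
  -- `a` and `b` are the topmost and the lowest earlier occurrence. As `a` does not no-block the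
  -- leaf via `b`, some until formula is fulfilled below `b` but not between `a` and `b`.
  obtain ⟨a, ⟨ha, ha'⟩, hmin⟩ := hfin.exists_minimalFor (fun a => a.name.length) _ hne
  obtain ⟨b, ⟨hb, hb'⟩, hmax⟩ := hfin.exists_maximalFor (fun a => a.name.length) _ hne
  have hmin' : ∀ c ∈ l.anc, c.pivot = l.pivot → a.name.length ≤ c.name.length := fun c hc hc' => by
    by_contra h
    exact h (hmin ⟨hc, hc'⟩ (not_le.1 h).le)
  have hmax' : ∀ c ∈ l.anc, c.pivot = l.pivot → c.name.length ≤ b.name.length := fun c hc hc' => by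
    by_contra h
    exact h (hmax ⟨hc, hc'⟩ (not_le.1 h).le)
  have hab : a.name.Above b.name := by
    obtain ⟨c, hc, d, hd, hc', hd', hcd⟩ := h2
    refine Name.above_of_length (hl a ha).1 (hl b hb).1 ?_
    exact (hmin' c hc hc').trans_lt (hcd.length.trans_le (hmax' d hd hd'))
  have hbl := hno a
  unfold Leaf.NoBlocked at hbl
  push Not at hbl
  obtain ⟨ψ₁, ψ₂, hu, ⟨x, hx, hbx, hψx⟩, hy⟩ := hbl ha b hb hab (ha'.trans hb'.symm) hb'
  rw [ha'] at hu
  have hxl : x.name = l.name ∨ x.name.Above l.name := by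
    rcases List.mem_cons.1 hx with rfl | hx
    · exact Or.inl rfl
    · exact Or.inr (hl x hx)
  refine ⟨(l.pivot, some (some (ψ₁, ψ₂))), ⟨hF, ?_⟩, ?_, ?_⟩
  · rintro e he
    cases he
    have h3 := hK _ (hF hu) _ (.next _)
    exact ⟨hK _ h3 _ (.untlLeft ..), hK _ h3 _ (.untlRight ..)⟩
  · refine ⟨a, List.mem_cons_of_mem _ ha, l.toAnc, List.mem_cons_self, x, hx, ha', rfl, ?_, hxl, hu, hψx⟩
    exact hab.trans_le hbx.1
  -- Any earlier fulfilment between two occurrences lies between `a` and `b`, by their extremality.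
  · rintro ⟨a', ha1, b', hb1, y, hy1, ha2, hb2, hay, hyb, -, hψy⟩
    refine hy y (List.mem_cons_of_mem _ hy1) ?_ ?_ hψy
    · exact Name.above_of_length (hl a ha).1 (hl y hy1).1 ((hmin' a' ha1 ha2).trans_lt hay.length)
    · have hyb' : y.name.length ≤ b.name.length := by
        refine le_trans ?_ (hmax' b' hb1 hb2)
        rcases hyb with h | h
        · rw [h]
        · exact h.length.le
      rcases hyb'.lt_or_eq with h | h
      · exact Or.inr (Name.above_of_length (hl y hy1).1 (hl b hb).1 h)
      · exact Or.inl ((List.prefix_of_prefix_length_le (hl y hy1).1 (hl b hb).1 h.le).eq_of_length h)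

/-- Lexicographic induction on three natural numbers. -/
theorem lex_induction {α : Type*} (f g h : α → ℕ) {p : α → Prop}
    (H : ∀ a, (∀ b, (f b < f a ∨ (f b ≤ f a ∧ g b < g a) ∨ (f b ≤ f a ∧ g b ≤ g a ∧ h b < h a)) → p b) →
      p a) (a : α) : p a := by
  induction h1 : f a using Nat.strong_induction_on generalizing a with
  | _ n ih1 =>
    induction h2 : g a using Nat.strong_induction_on generalizing a with
    | _ m ih2 =>
      induction h3 : h a using Nat.strong_induction_on generalizing a with
      | _ k ih3 =>
        subst h1 h2 h3
        refine H a fun b hb => ?_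
        by_cases hf : f b < f a
        · exact ih1 _ hf b rfl
        by_cases hg : g b < g a
        · have : f b = f a := by omega
          exact ih2 _ hg b this rfl
        · have h4 : f b = f a := by omega
          have h5 : g b = g a := by omega
          have h6 : h b < h a := by omega
          exact ih3 _ h6 b h4 h5 rfl

variable [Fintype S] [Fintype A]

open Classical in
/-- The number of undecided actions and constraints of a poised leaf, or of undecided `P`-formulas
of another leaf. -/
noncomputable def undecided (D : MDP S A AP) (K : Set (Formula AP)) (l : Leaf S A M AP) : ℕ :=
  if l.pivot.Poised then
    -- Actions count twice because deciding one may change the prescribed set, so that the sum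
    -- constraint has to be added anew.
    2 * {α | actZero l.pivot.mode l.pivot.state α ∉ l.prog ∧
      actPos l.pivot.mode l.pivot.state α ∉ l.prog ∧ α ∈ D.enabled l.pivot.state}.ncard +
    if prescribedConstr l.prog l.pivot.mode l.pivot.state ∈ l.prog then 0 else 1
  else {χ | χ ∈ K ∧ ∃ c z ψ, χ = .prob c z ψ ∧ ¬ l.dec c z ψ ∧ ¬ l.dec c.compl z ψ}.ncard

/-- Adding the sum constraint leaves the prescribed set alone, so the constraint just added is the
one required afterwards. -/
theorem prescribed_insert (Γ : Program S A M AP) (m : M) (s : S) (m' : M) (s' : S)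
    (Γ' : Program S A M AP) :
    prescribed (Γ ∪ {prescribedConstr Γ' m' s'}) m s = prescribed Γ m s := by
  ext α
  simp only [prescribed, Finset.mem_filter, Finset.mem_univ, true_and]
  constructor
  · rintro (h | h)
    · exact h
    · simp only [Set.mem_singleton_iff, actPos, prescribedConstr, Constr.mk.injEq] at h
      exact absurd h.2.1 (by simp)
  · exact Or.inl

theorem undecided_choose {D : MDP S A AP} {K : Set (Formula AP)} {l : Leaf S A M AP}
    (hl : l.pivot.Poised) {α : A} (hα : α ∈ D.enabled l.pivot.state)
    (h1 : actZero l.pivot.mode l.pivot.state α ∉ l.prog)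
    (h2 : actPos l.pivot.mode l.pivot.state α ∉ l.prog) {γ : Constr (Var S A M AP)}
    (hγ : γ = actZero l.pivot.mode l.pivot.state α ∨ γ = actPos l.pivot.mode l.pivot.state α) :
    undecided D K (l.addConstrs {γ}) < undecided D K l := by
  unfold undecided
  rw [if_pos hl, if_pos (show (l.addConstrs {γ}).pivot.Poised from hl)]
  have : {β | actZero l.pivot.mode l.pivot.state β ∉ (l.addConstrs {γ}).prog ∧
      actPos l.pivot.mode l.pivot.state β ∉ (l.addConstrs {γ}).prog ∧
      β ∈ D.enabled l.pivot.state}.ncard <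
      {β | actZero l.pivot.mode l.pivot.state β ∉ l.prog ∧
      actPos l.pivot.mode l.pivot.state β ∉ l.prog ∧ β ∈ D.enabled l.pivot.state}.ncard := by
    refine Set.ncard_lt_ncard ((Set.ssubset_iff_of_subset ?_).2 ⟨α, ⟨h1, h2, hα⟩, ?_⟩) (Set.toFinite _)
    · exact fun β h => ⟨fun hc => h.1 (Or.inl hc), fun hc => h.2.1 (Or.inl hc), h.2.2⟩
    · rcases hγ with rfl | rfl
      · exact fun h => h.1 (Or.inr rfl)
      · exact fun h => h.2.1 (Or.inr rfl)
  change 2 * {β | actZero l.pivot.mode l.pivot.state β ∉ (l.addConstrs {γ}).prog ∧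
      actPos l.pivot.mode l.pivot.state β ∉ (l.addConstrs {γ}).prog ∧
      β ∈ D.enabled l.pivot.state}.ncard + _ < _
  split_ifs <;> omega

theorem undecided_extend {D : MDP S A AP} {K : Set (Formula AP)} {l : Leaf S A M AP}
    (hl : l.pivot.Poised) (h : prescribedConstr l.prog l.pivot.mode l.pivot.state ∉ l.prog) :
    undecided D K (l.addConstrs {prescribedConstr l.prog l.pivot.mode l.pivot.state}) <
      undecided D K l := by
  unfold undecided
  rw [if_pos hl, if_pos (show (l.addConstrs {_}).pivot.Poised from hl), if_neg h]
  generalize hΓ : l.addConstrs {prescribedConstr l.prog l.pivot.mode l.pivot.state} = l'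
  have hpr : l'.prog = l.prog ∪ {prescribedConstr l.prog l.pivot.mode l.pivot.state} := by
    rw [← hΓ]; rfl
  have hpi : l'.pivot = l.pivot := by rw [← hΓ]; rfl
  rw [hpi]
  have : {β | actZero l.pivot.mode l.pivot.state β ∉ l'.prog ∧
      actPos l.pivot.mode l.pivot.state β ∉ l'.prog ∧ β ∈ D.enabled l.pivot.state}.ncard ≤
      {β | actZero l.pivot.mode l.pivot.state β ∉ l.prog ∧
      actPos l.pivot.mode l.pivot.state β ∉ l.prog ∧ β ∈ D.enabled l.pivot.state}.ncard := by
    rw [hpr]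
    exact Set.ncard_le_ncard (fun β h => ⟨fun hc => h.1 (Or.inl hc), fun hc => h.2.1 (Or.inl hc), h.2.2⟩)
      (Set.toFinite _)
  have hin : prescribedConstr l'.prog l.pivot.mode l.pivot.state ∈ l'.prog := by
    have : prescribedConstr l'.prog l.pivot.mode l.pivot.state =
        prescribedConstr l.prog l.pivot.mode l.pivot.state := by
      have h1 := prescribed_insert l.prog l.pivot.mode l.pivot.state l.pivot.mode l.pivot.state l.prog
      rw [← hpr] at h1
      simp only [prescribedConstr, h1]
    rw [this, hpr]
    exact Or.inr rfl
  rw [if_pos hin]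
  omega

theorem undecided_call {D : MDP S A AP} {K : Set (Formula AP)} (hfin : K.Finite)
    {l : Leaf S A M AP}
    (hl : ¬ l.pivot.Poised) {c d : Cmp} {z : unitInterval} {ψ : Formula AP} (hK : .prob c z ψ ∈ K)
    (h1 : ¬ l.dec c z ψ) (h2 : ¬ l.dec c.compl z ψ) (hd : d = c ∨ d = c.compl)
    (Γ : Program S A M AP) (u : Name AP) :
    undecided D K (l.addConstrs (Γ ∪ {cmpConstr u l.pivot.mode l.pivot.state ψ d z})) <
      undecided D K l := by
  unfold undecided
  rw [if_neg hl, if_neg (show ¬ (l.addConstrs _).pivot.Poised from hl)]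
  generalize hΓ : l.addConstrs (Γ ∪ {cmpConstr u l.pivot.mode l.pivot.state ψ d z}) = l'
  have hmono : ∀ c z χ, l.dec c z χ → l'.dec c z χ := by
    rintro c z χ ⟨v, hv⟩
    rw [← hΓ]
    exact ⟨v, Or.inl hv⟩
  have hnew : l'.dec d z ψ := by
    rw [← hΓ]
    exact ⟨u, Or.inr (Or.inr rfl)⟩
  refine Set.ncard_lt_ncard ((Set.ssubset_iff_of_subset ?_).2
    ⟨.prob c z ψ, ⟨hK, c, z, ψ, rfl, h1, h2⟩, ?_⟩) (hfin.subset fun χ h => h.1)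
  · rintro χ ⟨hχ, c', z', ψ', rfl, h3, h4⟩
    exact ⟨hχ, c', z', ψ', rfl, fun h => h3 (hmono _ _ _ h), fun h => h4 (hmono _ _ _ h)⟩
  · rintro ⟨_, c', z', ψ', he, h3, h4⟩
    cases he
    rcases hd with rfl | rfl
    · exact h3 hnew
    · exact h4 hnew

variable {D : MDP S A AP} {ρ : PartialPolicy S M}

/-- Hides the equation of the transition rule where only its conclusions matter. -/
theorem exists_nextOutcome (D : MDP S A AP) (ρ : PartialPolicy S M) (l : Leaf S A M AP)
    (ts : List S) : ∃ γ, nextOutcome D ρ l ts = .union true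
      (ts.map fun t => ⟨ρ.delta l.pivot.mode l.pivot.state, t, l.pivot.unnext⟩) γ := ⟨_, rfl⟩

/-- Guided derivations exist. -/
theorem exists_guided [Finite M] (strat : Strategy D ρ) {σ : Var S A M AP → ℝ}
    (hσ : ∀ m s α, 0 ≤ σ (.act m s α)) (N : ℕ) (K : Set (Formula AP)) (hfin : K.Finite)
    (hK : Closed K) (hN : ∀ χ ∈ K, pdepth χ < N) (l : Leaf S A M AP) (hl : l.Wf)
    (hF : l.pivot.fmls ⊆ K) : ∃ P, Guided strat σ l P := by
  classical
  induction N generalizing K l with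
  | zero =>
    have hK0 : l.pivot.fmls = ∅ := Set.eq_empty_of_forall_notMem fun χ hχ =>
      absurd (hN χ (hF hχ)) (Nat.not_lt_zero _)
    have hnp : ¬ l.pivot.Poised := fun h => h.1.ne_empty hK0
    have hm := strat.localMove hnp
    generalize hp : strat.pick l = o at hm
    cases hm with
    | cross => exact ⟨_, .close _ _ _ hp⟩
    | check => exact ⟨_, .close _ _ _ hp⟩
    | call c z ψ h => rw [hK0] at h; exact h.elim
    | expand ψ Ls γ h => rw [hK0] at h; exact h.elim
  | succ N ihN =>
    have hbase : (records S M K).Finite := finite_records hfin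
    have hcoe : ∀ χ, χ ∈ hfin.toFinset ↔ χ ∈ K := fun χ => hfin.mem_toFinset
    -- Lexicographic measure: a transition lowers the number of missing records `f3`, an expansion
    -- lowers the weight `f2` of the pivot without raising `f3`, and enlarging the program at a node
    -- lowers `f1` and keeps the others. Recursive calls are left to the outer induction on `N`.
    let f3 : Leaf S A M AP → ℕ := fun l => (records S M K \ record l.anc).ncard
    let f2 : Leaf S A M AP → ℕ := fun l => ∑ χ ∈ hfin.toFinset.filter (· ∈ l.pivot.fmls), wt 0 χ
    let f1 : Leaf S A M AP → ℕ := undecided D K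
    have hf3 : ∀ l l' : Leaf S A M AP, l.anc ⊆ l'.anc → f3 l' ≤ f3 l := fun l l' h =>
      Set.ncard_le_ncard (Set.sdiff_subset_sdiff_right (record_mono h)) hbase.sdiff
    revert hl hF
    refine lex_induction f3 f2 f1 (p := fun l => l.Wf → l.pivot.fmls ⊆ K → ∃ P, Guided strat σ l P)
      (fun l ih hl hF => ?_) l
    have hsame : ∀ Γ, f1 (l.addConstrs Γ) < f1 l → ∃ P, Guided strat σ (l.addConstrs Γ) P :=
      fun Γ h => ih _ (Or.inr (Or.inr ⟨le_rfl, le_rfl, h⟩)) hl hF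
    have hwf : ∀ concl γ i, (l.child concl γ i).Wf := by
      intro concl γ i a ha
      rcases List.mem_cons.1 ha with rfl | ha
      · exact ⟨prefix_childName _ _, fun h => by
          have := congrArg List.length h
          simp [Leaf.child, childName] at this⟩
      · exact (hl a ha).trans_le (prefix_childName _ _)
    by_cases hpo : l.pivot.Poised
    · have hm := strat.poisedMove hpo
      generalize hp : strat.pick l = o at hm
      cases hm with
      | act α h1 h2 h3 =>
        by_cases hα : σ (.act l.pivot.mode l.pivot.state α) = 0
        · obtain ⟨P, hP⟩ := hsame {actZero l.pivot.mode l.pivot.state α}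
            (undecided_choose hpo h1 h2 h3 (Or.inl rfl))
          exact ⟨P, .choose _ _ _ _ _ hp (Or.inl rfl) hα hP⟩
        · obtain ⟨P, hP⟩ := hsame {actPos l.pivot.mode l.pivot.state α}
            (undecided_choose hpo h1 h2 h3 (Or.inr rfl))
          exact ⟨P, .choose _ _ _ _ _ hp (Or.inr rfl) (lt_of_le_of_ne (hσ _ _ _) (Ne.symm hα)) hP⟩
      | prescribed h1 h2 =>
        obtain ⟨P, hP⟩ := hsame _ (undecided_extend hpo h2)
        exact ⟨P, .extend _ _ _ hp hP⟩
      | yesLoop v => exact ⟨_, .close _ _ _ hp⟩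
      | noLoop v => exact ⟨_, .close _ _ _ hp⟩
      | next ts h1 h2 h3 h4 =>
        have hch : ∀ concl γ i, (∀ F ∈ concl, F.fmls ⊆ K) →
            ∃ P, Guided strat σ (l.child concl γ i) P := by
          intro concl γ i hc
          refine ih _ (Or.inl ?_) (hwf _ _ _) (hc _ (List.get_mem _ _))
          obtain ⟨k, hk1, hk2, hk3⟩ := exists_new_record hl hK hF h3
          refine Set.ncard_lt_ncard ?_ hbase.sdiff
          refine (Set.ssubset_iff_of_subset ?_).2 ⟨k, ⟨hk1, hk3⟩, fun h => h.2 hk2⟩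
          exact Set.sdiff_subset_sdiff_right (record_mono (List.subset_cons_self _ _))
        obtain ⟨γ, hγ⟩ := exists_nextOutcome D ρ l ts
        rw [hγ] at hp
        have : ∀ i, ∃ P, Guided strat σ (l.child _ γ i) P := fun i => hch
          (ts.map fun t => ⟨ρ.delta l.pivot.mode l.pivot.state, t, l.pivot.unnext⟩) γ i (by
          intro F hF'
          obtain ⟨t, _, rfl⟩ := List.mem_map.1 hF'
          exact fun χ hχ => hK (.next χ) (hF hχ) _ (.next χ))
        choose Ps hPs using this
        exact ⟨_, .union _ _ _ _ Ps hp hPs⟩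
    · have hm := strat.localMove hpo
      generalize hp : strat.pick l = o at hm
      cases hm with
      | cross => exact ⟨_, .close _ _ _ hp⟩
      | check => exact ⟨_, .close _ _ _ hp⟩
      | call c z ψ h1 h2 h3 =>
        obtain ⟨P', hP'⟩ : ∃ P, Guided strat σ (l.callLeaf c z ψ) P := by
          -- The call works in its own closure `cl ψ`, where the nesting depth is smaller.
          refine ihN (cl ψ) (finite_cl ψ) (closed_cl ψ) (fun χ hχ => ?_) _ ?_ ?_
          · have := hN _ (hF h1)
            simp only [pdepth] at this
            exact (pdepth_le hχ).trans_lt (Nat.lt_of_succ_lt_succ this)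
          · rintro a ha; simp [Leaf.callLeaf] at ha
          · exact Set.singleton_subset_iff.2 (mem_cl ψ).1
        have hd : ∃ d, (d = c ∨ d = c.compl) ∧
            Constr.Sat (cmpConstr (l.callName c z ψ) l.pivot.mode l.pivot.state ψ d z) σ := by
          by_cases h : c.Holds (σ (.prob (l.callName c z ψ) ⟨l.pivot.mode, l.pivot.state, {ψ}⟩)) z
          · exact ⟨c, Or.inl rfl, h⟩
          · exact ⟨c.compl, Or.inr rfl, (Cmp.holds_compl _ _ _).2 h⟩
        obtain ⟨d, hd, hd'⟩ := hd
        obtain ⟨P, hP⟩ := hsame _ (undecided_call (D := D) hfin hpo (hF h1) h2 h3 hd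
          (Tab.gamma (tab strat P')) (l.callName c z ψ))
        exact ⟨P, .call _ _ _ _ _ _ _ hp hd hd' hP' hP⟩
      | expand ψ Ls γ h1 h2 h3 =>
        have : ∀ i, ∃ P, Guided strat σ (l.child (Ls.map (l.replace ψ)) γ i) P := by
          intro i
          obtain ⟨Ψ, hΨ, hi⟩ := List.mem_map.1 (List.get_mem _ i)
          have hpiv : (l.child (Ls.map (l.replace ψ)) γ i).pivot = l.replace ψ Ψ := hi.symm
          refine ih _ (Or.inr (Or.inl ⟨hf3 _ _ (List.subset_cons_self _ _), ?_⟩))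
            (hwf _ _ _) ?_
          · obtain ⟨s, hs, hsum⟩ := h2.exists_finset hΨ
            simp only [f2, hpiv]
            have hmem : ψ ∈ hfin.toFinset.filter (· ∈ l.pivot.fmls) :=
              Finset.mem_filter.2 ⟨(hcoe _).2 (hF h1), h1⟩
            rw [← Finset.add_sum_erase _ _ hmem]
            -- New formulas may already belong to the pivot; this only makes the sum smaller, so an
            -- inclusion suffices.
            have hsub : hfin.toFinset.filter (· ∈ (l.replace ψ Ψ).fmls) ⊆
                s ∪ (hfin.toFinset.filter (· ∈ l.pivot.fmls)).erase ψ := by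
              intro χ hχ
              obtain ⟨hχ1, hχ2 | hχ2⟩ := Finset.mem_filter.1 hχ
              · rw [← hs] at hχ2
                exact Finset.mem_union_left _ hχ2
              · exact Finset.mem_union_right _ (Finset.mem_erase.2
                  ⟨hχ2.2, Finset.mem_filter.2 ⟨hχ1, hχ2.1⟩⟩)
            have h4 := Finset.sum_le_sum_of_subset (f := wt 0) hsub
            have h5 := Finset.sum_union_inter (s₁ := s)
              (s₂ := (hfin.toFinset.filter (· ∈ l.pivot.fmls)).erase ψ) (f := wt 0)
            omega
          · rw [hpiv]
            exact Set.union_subset (hK.expands h2 (hF h1) hΨ) (Set.sdiff_subset.trans hF)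
        choose Ps hPs using this
        exact ⟨_, .union _ _ _ _ Ps hp hPs⟩

end Existence

end PCTLSynth


namespace PCTLSynth

/-! ## Steps of a run through a tree -/

section Steps

variable {S A M AP : Type*} [Fintype S] [Fintype A] [Fintype M] {D : MDP S A AP}
  {ρ : PartialPolicy S M} {strat : Strategy D ρ}

/-- The policy state of a leaf. -/
def Leaf.st (x : Leaf S A M AP) : M × S := (x.pivot.mode, x.pivot.state)

/-- The program of a leaf is right about the policy state of the leaf. -/
structure Sound (π : Policy D M) (x : Leaf S A M AP) : Prop where
  dec : ∀ c z ψ, x.dec c z ψ →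
    c.Holds ((inducedChain D π).Pr x.st {r | RunSat (inducedChain D π) ψ r}) z
  zero : ∀ α, actZero x.pivot.mode x.pivot.state α ∈ x.prog →
    π.act x.pivot.mode x.pivot.state α = 0
  pos : ∀ α, actPos x.pivot.mode x.pivot.state α ∈ x.prog →
    0 < π.act x.pivot.mode x.pivot.state α

/-- Once all enabled actions are decided in accordance with the policy, the prescribed actions are
exactly those it uses, and the `X`-successors are exactly the possible next states. -/
theorem trans_pos_iff {π : Policy D M} {x : Leaf S A M AP} (hx : Sound π x) (hd : x.Decided D)
    {ts : List S} (hts : x.Enum D ts) (q : M × S) : 0 < (inducedChain D π).trans x.st q ↔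
      q.1 = π.delta x.pivot.mode x.pivot.state ∧ q.2 ∈ ts := by
  classical
  simp only [inducedChain, Leaf.st]
  have hnn : ∀ α ∈ Finset.univ.filter (fun α => α ∈ D.enabled x.pivot.state),
      0 ≤ π.act x.pivot.mode x.pivot.state α * D.P x.pivot.state α q.2 := fun α _ =>
    mul_nonneg (π.act_nonneg _ _ _) (D.P_nonneg _ _ _)
  split_ifs with h
  · rw [hts.2]
    simp only [h, true_and, prescribed, succ, Finset.mem_filter, Finset.mem_univ]
    constructor
    · intro hs
      obtain ⟨α, hα, hne⟩ := Finset.exists_ne_zero_of_sum_ne_zero hs.ne'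
      have hp := lt_of_le_of_ne (hnn α hα) hne.symm
      have hact : 0 < π.act x.pivot.mode x.pivot.state α :=
        pos_of_mul_pos_left hp (D.P_nonneg _ _ _)
      refine ⟨α, ?_, pos_of_mul_pos_right hp (π.act_nonneg _ _ _)⟩
      rcases hd α (Finset.mem_filter.1 hα).2 with h0 | h0
      · rw [hx.zero α h0] at hact
        exact absurd hact (lt_irrefl _)
      · exact h0
    · rintro ⟨α, hα, hP⟩
      have hact := hx.pos α hα
      exact Finset.sum_pos' hnn ⟨α, Finset.mem_filter.2 ⟨Finset.mem_univ _, π.act_enabled _ _ _ hact⟩,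
        mul_pos hact hP⟩
  · simp [h]

theorem kid_local {x y : Leaf S A M AP} {i : ℕ} (hk : IsKid strat x y i) (hx : ¬ x.pivot.Poised) :
    ∃ ψ ∈ x.pivot.fmls, ∃ Ls, Expands (D.label x.pivot.state) x.dec ψ Ls ∧
      ∃ Ψ ∈ Ls, y.pivot = x.replace ψ Ψ := by
  obtain ⟨b, concl, γ, hp, hi, -, hy, -⟩ := hk
  have hm := strat.localMove hx
  rw [hp] at hm
  cases hm with
  | expand ψ Ls γ h1 h2 h3 =>
    refine ⟨ψ, h1, Ls, h2, ?_⟩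
    rw [hy]
    obtain ⟨Ψ, hΨ, he⟩ := List.mem_map.1 (List.getElem_mem hi)
    exact ⟨Ψ, hΨ, he.symm⟩

theorem kid_next {x y : Leaf S A M AP} {i : ℕ} (hk : IsKid strat x y i) (hx : x.pivot.Poised) :
    x.Decided D ∧ (∀ v, ¬ x.YesBlocked v) ∧ (∀ v, ¬ x.NoBlocked v) ∧ ∃ ts, x.Enum D ts ∧
      y.pivot.mode = ρ.delta x.pivot.mode x.pivot.state ∧ y.pivot.state ∈ ts ∧
      y.pivot.fmls = x.pivot.unnext := by
  obtain ⟨b, concl, γ, hp, hi, -, hy, -⟩ := hk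
  have hm := strat.poisedMove hx
  generalize ho : strat.pick x = o at hm
  cases hm with
  | next ts h1 h2 h3 h4 =>
    obtain ⟨γ', hγ'⟩ := exists_nextOutcome D ρ x ts
    rw [hp, hγ'] at ho
    cases ho
    refine ⟨h1, h2, h3, ts, h4, ?_⟩
    obtain ⟨t, ht, he⟩ := List.mem_map.1 (List.getElem_mem hi)
    rw [hy, ← he]
    exact ⟨rfl, ht, rfl⟩
  | _ => rw [hp] at ho; cases ho

theorem st_local {x y : Leaf S A M AP} {i : ℕ} (hk : IsKid strat x y i) (hx : ¬ x.pivot.Poised) :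
    y.st = x.st := by
  obtain ⟨ψ, -, Ls, -, Ψ, -, h⟩ := kid_local hk hx
  simp [Leaf.st, h, Leaf.replace]

/-- One step of a path through the tree: to a child for the same path, to an `X`-successor for the
tail of the path, or from a leaf to an ancestor with the same poised pivot. -/
inductive Move (strat : Strategy D ρ) : Leaf S A M AP → (ℕ → M × S) → Leaf S A M AP →
    (ℕ → M × S) → Prop
  | same (x y i r) : ¬ x.pivot.Poised → IsKid strat x y i → Move strat x r y r
  | next (x y i r) : x.pivot.Poised → IsKid strat x y i → r 1 = y.st → Move strat x r y (tail r)
  -- The target need not be that of the backlink: for no-loops, walks will jump to the middle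
  -- occurrence of the pivot instead of the topmost one.
  | jump (x y r) : x.pivot.Poised → y.name.Above x.name → y.pivot = x.pivot →
      (∃ γ k, strat.pick x = .close γ k) → Move strat x r y r

theorem Move.st {x y : Leaf S A M AP} {r r' : ℕ → M × S} (h : Move strat x r y r')
    (hr : r 0 = x.st) : r' 0 = y.st := by
  cases h with
  | same _ i _ h1 h2 => rw [hr, st_local h2 h1]
  | next _ i _ h1 h2 h3 => rw [tail_apply, h3]
  | jump _ _ h1 h2 h3 => rw [hr]; simp [Leaf.st, h3]

variable {π : Policy D M}

theorem sat_replace (C : Chain (M × S) AP) {x : Leaf S A M AP} {ψ : Formula AP}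
    {Ψ : Set (Formula AP)} {r : ℕ → M × S} :
    Sat C (x.replace ψ Ψ).fmls r ↔ Sat C Ψ r ∧ Sat C (x.pivot.fmls \ {ψ}) r := by
  constructor
  · exact fun h => ⟨fun χ hχ => h χ (Or.inl hχ), fun χ hχ => h χ (Or.inr hχ)⟩
  · rintro ⟨h1, h2⟩ χ (hχ | hχ)
    exacts [h1 χ hχ, h2 χ hχ]

theorem sat_expand_iff {x : Leaf S A M AP} (hx : Sound π x) {ψ : Formula AP}
    {Ls : List (Set (Formula AP))} (hψ : ψ ∈ x.pivot.fmls)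
    (h : Expands (D.label x.pivot.state) x.dec ψ Ls) {r : ℕ → M × S} (hr : r 0 = x.st) :
    Sat (inducedChain D π) x.pivot.fmls r ↔
      ∃ Ψ ∈ Ls, Sat (inducedChain D π) (x.replace ψ Ψ).fmls r := by
  have hs := h.sat_iff (inducedChain D π) r (by rw [hr]; rfl)
    (fun c z χ hd => by rw [hr]; exact hx.dec c z χ hd)
  simp only [sat_replace]
  constructor
  · intro h1
    obtain ⟨Ψ, hΨ, h2⟩ := hs.1 (h1 ψ hψ)
    exact ⟨Ψ, hΨ, h2, fun χ hχ => h1 χ hχ.1⟩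
  · rintro ⟨Ψ, hΨ, h1, h2⟩ χ hχ
    by_cases he : χ = ψ
    · rw [he]
      exact hs.2 ⟨Ψ, hΨ, h1⟩
    · exact h2 χ ⟨hχ, he⟩

theorem sat_poised_iff (C : Chain (M × S) AP) {F : LForm S M AP} (hF : F.Poised)
    {r : ℕ → M × S} : Sat C F.fmls r ↔ Sat C F.unnext (tail r) := by
  constructor
  · exact fun h χ hχ => h _ hχ
  · intro h χ hχ
    obtain ⟨ξ, rfl⟩ := hF.2 χ hχ
    exact h ξ hχ

/-- Every alternative implies the premise, so truth can be carried back from a check leaf to the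
start. -/
theorem Move.sat_back {x y : Leaf S A M AP} {r r' : ℕ → M × S} (h : Move strat x r y r')
    (hx : Sound π x) (hr : r 0 = x.st) (hy : Sat (inducedChain D π) y.pivot.fmls r') :
    Sat (inducedChain D π) x.pivot.fmls r := by
  cases h with
  | same _ i _ h1 h2 =>
    obtain ⟨ψ, hψ, Ls, hE, Ψ, hΨ, h⟩ := kid_local h2 h1
    rw [h] at hy
    exact (sat_expand_iff hx hψ hE hr).2 ⟨Ψ, hΨ, hy⟩
  | next _ i _ h1 h2 h3 =>
    obtain ⟨-, -, -, ts, -, -, -, h⟩ := kid_next h2 h1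
    rw [h] at hy
    exact (sat_poised_iff _ h1).2 hy
  | jump _ _ h1 h2 h3 => rwa [h3] at hy

theorem not_sat_cross {x : Leaf S A M AP} (hx : Sound π x) {γ : Constr (Var S A M AP)}
    (hp : strat.pick x = .close γ .cross) {r : ℕ → M × S} (hr : r 0 = x.st) :
    ¬ Sat (inducedChain D π) x.pivot.fmls r := by
  intro hs
  by_cases hpo : x.pivot.Poised
  · have hm := strat.poisedMove hpo
    generalize ho : strat.pick x = o at hm
    rw [hp] at ho
    cases hm with
    | next ts => obtain ⟨γ', hγ'⟩ := exists_nextOutcome D ρ x ts; rw [hγ'] at ho; cases ho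
    | _ => cases ho
  · have hm := strat.localMove hpo
    rw [hp] at hm
    cases hm with
    | cross ψ h1 h2 =>
      rcases h2 with ⟨h2, h3⟩ | ⟨c, z, χ, rfl, h2⟩
      · refine h3 ?_
        have := (runSat_classical (inducedChain D π) h2 r).1 (hs ψ h1)
        rwa [hr] at this
      · have h3 := hs _ h1
        have h4 := hx.dec _ _ _ h2
        rw [Cmp.holds_compl, ← hr] at h4
        exact h4 h3

theorem check_empty {x : Leaf S A M AP} {γ : Constr (Var S A M AP)}
    (hp : strat.pick x = .close γ .check) : x.pivot.fmls = ∅ := by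
  by_cases hpo : x.pivot.Poised
  · have hm := strat.poisedMove hpo
    generalize ho : strat.pick x = o at hm
    rw [hp] at ho
    cases hm with
    | next ts => obtain ⟨γ', hγ'⟩ := exists_nextOutcome D ρ x ts; rw [hγ'] at ho; cases ho
    | _ => cases ho
  · have hm := strat.localMove hpo
    rw [hp] at hm
    cases hm with
    | check h => exact h

/-- The inference selected at a leaf `x` is a loop with target `v`. -/
def IsLoop (strat : Strategy D ρ) (x : Leaf S A M AP) (v : Anc S M AP) : Prop :=
  x.pivot.Poised ∧ x.Decided D ∧ ((∃ γ, strat.pick x = .close γ (.yesLoop v.name) ∧ x.YesBlocked v) ∨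
    (∃ γ, strat.pick x = .close γ (.noLoop v.name) ∧ (∀ v, ¬ x.YesBlocked v) ∧ x.NoBlocked v))

theorem IsLoop.close {x : Leaf S A M AP} {v : Anc S M AP} (h : IsLoop strat x v) :
    ∃ γ k, strat.pick x = .close γ k := by
  rcases h.2.2 with ⟨γ, h, -⟩ | ⟨γ, h, -⟩
  exacts [⟨_, _, h⟩, ⟨_, _, h⟩]

/-- Loops lead to an ancestor with the same pivot. -/
theorem IsLoop.target {x : Leaf S A M AP} {v : Anc S M AP} (h : IsLoop strat x v) :
    v ∈ x.anc ∧ v.pivot = x.pivot := by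
  rcases h.2.2 with ⟨γ, -, h⟩ | ⟨γ, -, -, h⟩
  · exact ⟨h.1, h.2.1⟩
  · obtain ⟨h1, w, hw, h2, h3, h4, -⟩ := h
    exact ⟨h1, h3.trans h4⟩

variable {l₀ : Leaf S A M AP} {P : Set (Leaf S A M AP)}

/-- A run that satisfies the pivot of a node can be continued in the tree. -/
theorem exists_step (hT : IsTree strat l₀ P) (hπ : π.toPartialPolicy = ρ) {x : Leaf S A M AP}
    (hx : x ∈ P) (hs : Sound π x) {r : ℕ → M × S} (hrun : (inducedChain D π).IsRun r)
    (hr : r 0 = x.st) (hsat : Sat (inducedChain D π) x.pivot.fmls r) :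
    (∃ γ, strat.pick x = .close γ .check) ∨
    (∃ y ∈ P, ∃ r', Move strat x r y r' ∧ (∃ i, IsKid strat x y i) ∧ (r' = r ∨ r' = tail r) ∧
      Sat (inducedChain D π) y.pivot.fmls r') ∨ (∃ v, IsLoop strat x v) := by
  by_cases hpo : x.pivot.Poised
  · have hm := strat.poisedMove hpo
    generalize ho : strat.pick x = o at hm
    have hdone := hT.done x hx
    rw [ho] at hdone
    cases hm with
    | act => simp at hdone
    | prescribed => simp at hdone
    | yesLoop v h1 h2 => exact Or.inr (Or.inr ⟨v, hpo, h1, Or.inl ⟨_, ho, h2⟩⟩)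
    | noLoop v h1 h2 h3 => exact Or.inr (Or.inr ⟨v, hpo, h1, Or.inr ⟨_, ho, h2, h3⟩⟩)
    | next ts h1 h2 h3 h4 =>
      obtain ⟨γ, hγ⟩ := exists_nextOutcome D ρ x ts
      rw [hγ] at ho
      -- The first transition of a run has positive probability, so its target is one of the
      -- enumerated successors.
      have h01 := hrun 0
      rw [hr, trans_pos_iff hs h1 h4] at h01
      obtain ⟨i, hi, hti⟩ := List.getElem_of_mem h01.2
      obtain ⟨y, hy, hk⟩ := hT.kids x hx _ _ _ ho i (by simpa using hi)
      have hk' := hk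
      obtain ⟨b', concl', γ', hp', hi', -, hyp, -⟩ := hk'
      rw [ho] at hp'
      cases hp'
      have hyst : r 1 = y.st := by
        rw [List.getElem_map] at hyp
        refine Prod.ext ?_ ?_
        · simp only [Leaf.st, hyp, ← hπ]
          exact h01.1
        · simp only [Leaf.st, hyp, hti]
      refine Or.inr (Or.inl ⟨y, hy, _, .next _ _ i _ hpo hk hyst, ⟨i, hk⟩, Or.inr rfl, ?_⟩)
      obtain ⟨-, -, -, ts', -, -, -, h⟩ := kid_next hk hpo
      rw [h]
      exact (sat_poised_iff _ hpo).1 hsat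
  · have hm := strat.localMove hpo
    generalize ho : strat.pick x = o at hm
    have hdone := hT.done x hx
    rw [ho] at hdone
    cases hm with
    | cross => exact absurd hsat (not_sat_cross hs ho hr)
    | check => exact Or.inl ⟨_, rfl⟩
    | call => simp at hdone
    | expand ψ Ls γ h1 h2 h3 =>
      obtain ⟨Ψ, hΨ, hsat'⟩ := (sat_expand_iff hs h1 h2 hr).1 hsat
      obtain ⟨i, hi, hti⟩ := List.getElem_of_mem hΨ
      obtain ⟨y, hy, hk⟩ := hT.kids x hx _ _ _ ho i (by simpa using hi)
      have hk' := hk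
      obtain ⟨b', concl', γ', hp', hi', -, hyp, -⟩ := hk'
      rw [ho] at hp'
      cases hp'
      rw [List.getElem_map, hti] at hyp
      exact Or.inr (Or.inl ⟨y, hy, _, .same _ _ i _ hpo hk, ⟨i, hk⟩, Or.inl rfl, by rwa [hyp]⟩)

end Steps

/-! ## Infinite walks -/

section Walks

variable {S A M AP : Type*} [Fintype S] [Fintype A] [Fintype M] {D : MDP S A AP}
  {ρ : PartialPolicy S M} {strat : Strategy D ρ} {l₀ : Leaf S A M AP} {P : Set (Leaf S A M AP)}

/-- An infinite walk through the tree along a path. -/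
structure Walk (strat : Strategy D ρ) (P : Set (Leaf S A M AP)) (x : ℕ → Leaf S A M AP)
    (r : ℕ → ℕ → M × S) : Prop where
  mem : ∀ n, x n ∈ P
  step : ∀ n, Move strat (x n) (r n) (x (n + 1)) (r (n + 1))
  start : r 0 0 = (x 0).st

/-- Used for targets of jumps: as an inner node, such a target is not closed. -/
theorem IsTree.union_of_above (hT : IsTree strat l₀ P) {x y : Leaf S A M AP} (hx : x ∈ P)
    (hy : y ∈ P) (h : y.name.Above x.name) : ∃ b concl γ, strat.pick y = .union b concl γ := by
  have := hT.induct hy (motive := fun z => z.name = y.name ∨ ∃ b concl γ, strat.pick y = .union b concl γ)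
    (Or.inl rfl) ?_ hx h.1
  · exact this.resolve_left fun he => h.2 he.symm
  · intro z hz w hw i _ hk ih
    right
    rcases ih with ih | ih
    · obtain ⟨b, concl, γ, hp, -⟩ := hk
      rw [hT.inj z hz y hy ih] at hp
      exact ⟨b, concl, γ, hp⟩
    · exact ih

namespace Walk

variable {x : ℕ → Leaf S A M AP} {r : ℕ → ℕ → M × S}

theorem st (hw : Walk strat P x r) (n : ℕ) : r n 0 = (x n).st := by
  induction n with
  | zero => exact hw.start
  | succ n ih => exact (hw.step n).st ih

/-- Without jumps the walk would descend forever in a finite tree. -/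
theorem exists_jump (hT : IsTree strat l₀ P) (hw : Walk strat P x r) (N : ℕ) :
    ∃ n ≥ N, (x n).pivot.Poised ∧ (x (n + 1)).name.Above (x n).name ∧
      (x (n + 1)).pivot = (x n).pivot ∧ (∃ γ k, strat.pick (x n) = .close γ k) ∧ r (n + 1) = r n := by
  by_contra h
  push Not at h
  refine hT.not_forall_kid x hw.mem N fun n hn => ?_
  have hst := hw.step n
  generalize hy : x (n + 1) = y at hst ⊢
  generalize hr : r (n + 1) = r' at hst
  cases hst with
  | same _ i _ _ h => exact ⟨i, h⟩
  | next _ i _ _ h => exact ⟨i, h⟩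
  | jump _ _ h1 h2 h3 h4 =>
    obtain ⟨γ, k, h4⟩ := h4
    exact absurd hr (h n hn h1 (by rw [hy]; exact h2) (by rw [hy]; exact h3) ⟨γ, k, h4⟩)

/-- A jump leads to a poised inner node, where the only possible move is a transition. So walks
consume the whole path. -/
theorem exists_next (hT : IsTree strat l₀ P) (hw : Walk strat P x r) (N : ℕ) :
    ∃ n ≥ N, (x n).pivot.Poised ∧ (∃ i, IsKid strat (x n) (x (n + 1)) i) ∧
      r (n + 1) = tail (r n) := by
  obtain ⟨n, hn, h1, h2, h3, -, -⟩ := hw.exists_jump hT N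
  refine ⟨n + 1, by omega, by rwa [h3], ?_⟩
  obtain ⟨b, concl, γ, hu⟩ := hT.union_of_above (hw.mem n) (hw.mem (n + 1)) h2
  have hst := hw.step (n + 1)
  have hpo : (x (n + 1)).pivot.Poised := by rwa [h3]
  generalize hy : x (n + 1 + 1) = y at hst ⊢
  generalize hr : r (n + 1 + 1) = r' at hst ⊢
  cases hst with
  | same _ i _ h _ => exact absurd hpo h
  | next _ i _ _ h => exact ⟨⟨i, h⟩, rfl⟩
  | jump _ _ _ _ _ h =>
    obtain ⟨γ', k, h⟩ := h
    rw [hu] at h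
    cases h

/-- Formulas other than `X`-formulas are expanded before the next transition. -/
theorem exists_expand (hT : IsTree strat l₀ P) (hw : Walk strat P x r) {n : ℕ} {ψ : Formula AP}
    (hψ : ψ ∈ (x n).pivot.fmls) (hX : ∀ χ, ψ ≠ .next χ) :
    ∃ m ≥ n, (∀ k, n ≤ k → k ≤ m + 1 → r k = r n) ∧ ∃ Ls,
      Expands (D.label (x m).pivot.state) (x m).dec ψ Ls ∧
      ∃ Ψ ∈ Ls, Ψ ⊆ (x (m + 1)).pivot.fmls := by
  obtain ⟨N, hN, hpo, -⟩ := hw.exists_next hT n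
  obtain ⟨d, rfl⟩ := Nat.exists_eq_add_of_le hN
  clear hN
  induction d generalizing n with
  | zero =>
    obtain ⟨χ, hχ⟩ := hpo.2 ψ hψ
    exact absurd hχ (hX χ)
  | succ d ih =>
    have hnp : ¬ (x n).pivot.Poised := fun h => by
      obtain ⟨χ, hχ⟩ := h.2 ψ hψ
      exact absurd hχ (hX χ)
    have hst := hw.step n
    generalize hy : x (n + 1) = y at hst
    generalize hr : r (n + 1) = r' at hst
    cases hst with
    | same _ i _ _ hk =>
      obtain ⟨χ, hχ, Ls, hE, Ψ, hΨ, hpiv⟩ := kid_local hk hnp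
      by_cases he : χ = ψ
      · subst he
        refine ⟨n, le_rfl, fun k h1 h2 => ?_, Ls, hE, Ψ, hΨ, ?_⟩
        · rcases Nat.le_succ_iff.1 h2 with h | rfl
          · rw [le_antisymm h h1]
          · exact hr
        · rw [hy, hpiv]
          exact Set.subset_union_left
      · obtain ⟨m, hm, h1, h2⟩ := ih (n := n + 1)
          (by rw [hy, hpiv]; exact Or.inr ⟨hψ, fun h => he h.symm⟩)
          (by rwa [Nat.add_right_comm, Nat.add_assoc])
        refine ⟨m, by omega, fun k hk1 hk2 => ?_, h2⟩
        rcases hk1.lt_or_eq with h | rfl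
        · rw [h1 k h hk2, hr]
        · rfl
    | next _ i _ h _ => exact absurd h hnp
    | jump _ _ h => exact absurd h hnp

/-- `X`-formulas are kept until the next transition. -/
theorem exists_unnext (hT : IsTree strat l₀ P) (hw : Walk strat P x r) {n : ℕ} {ψ : Formula AP}
    (hψ : .next ψ ∈ (x n).pivot.fmls) :
    ∃ m > n, (∀ k, n ≤ k → k < m → r k = r n) ∧ r m = tail (r n) ∧ ψ ∈ (x m).pivot.fmls := by
  obtain ⟨N, hN, hpo, ⟨i, hk⟩, hr⟩ := hw.exists_next hT n
  obtain ⟨d, rfl⟩ := Nat.exists_eq_add_of_le hN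
  clear hN
  induction d generalizing n with
  | zero =>
    refine ⟨n + 1, Nat.lt_succ_self n, fun k h1 h2 => ?_, hr, ?_⟩
    · rw [le_antisymm (Nat.le_of_lt_succ h2) h1]
    · obtain ⟨-, -, -, ts, -, -, -, h⟩ := kid_next hk hpo
      rw [Nat.add_zero] at h
      rw [h]
      exact hψ
  | succ d ih =>
    have key : r (n + 1) = r n → .next ψ ∈ (x (n + 1)).pivot.fmls → ∃ m > n,
        (∀ k, n ≤ k → k < m → r k = r n) ∧ r m = tail (r n) ∧ ψ ∈ (x m).pivot.fmls := by
      intro h1 h2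
      have e : n + (d + 1) = n + 1 + d := by omega
      rw [e] at hpo hk hr
      obtain ⟨m, hm, h3, h4, h5⟩ := ih h2 hpo hr hk
      refine ⟨m, by omega, fun k hk1 hk2 => ?_, by rw [h4, h1], h5⟩
      rcases hk1.lt_or_eq with h | rfl
      · rw [h3 k h hk2, h1]
      · rfl
    have hst := hw.step n
    generalize hy : x (n + 1) = y at hst key
    generalize hr' : r (n + 1) = r' at hst key
    cases hst with
    | same _ i _ hnp hk' =>
      obtain ⟨χ, hχ, Ls, hE, Ψ, hΨ, hpiv⟩ := kid_local hk' hnp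
      refine key rfl ?_
      rw [hpiv]
      refine Or.inr ⟨hψ, fun h => ?_⟩
      rw [← Set.mem_singleton_iff.1 h] at hE
      exact hE.not_next
    | next _ i _ h hk' =>
      refine ⟨n + 1, Nat.lt_succ_self n, fun k h1 h2 => ?_, hr', ?_⟩
      · rw [le_antisymm (Nat.le_of_lt_succ h2) h1]
      · obtain ⟨-, -, -, ts, -, -, -, h⟩ := kid_next hk' h
        rw [hy, h]
        exact hψ
    | jump _ _ _ _ h3 => exact key rfl (by rwa [h3])

/-- Walks whose pivots are true fulfil their until formulas. -/
theorem fair_of_sat (hT : IsTree strat l₀ P) (hw : Walk strat P x r) (C : Chain (M × S) AP)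
    (hsat : ∀ n, Sat C (x n).pivot.fmls (r n)) {n : ℕ} {ψ₁ ψ₂ : Formula AP}
    (h : .next (.untl ψ₁ ψ₂) ∈ (x n).pivot.fmls) : ∃ m > n, ψ₂ ∈ (x m).pivot.fmls := by
  -- Induction on a time `k` at which `ψ₂` is true on the path. For `k = 0` postponement is
  -- impossible, because it would put the negation of `ψ₂` into a true pivot.
  have key : ∀ k n, RunSat C ψ₂ (fun i => r n (k + i)) → .untl ψ₁ ψ₂ ∈ (x n).pivot.fmls →
      ∃ m > n, ψ₂ ∈ (x m).pivot.fmls := by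
    intro k
    induction k with
    | zero =>
      intro n hk hu
      obtain ⟨m, hm, hr, Ls, hE, Ψ, hΨ, hsub⟩ := hw.exists_expand hT hu (by simp)
      obtain rfl := hE.untl_cases
      simp only [List.mem_cons, List.not_mem_nil, or_false] at hΨ
      rcases hΨ with rfl | rfl
      · exact ⟨m + 1, by omega, hsub rfl⟩
      · refine absurd ?_ (hsat (m + 1) _ (hsub (Or.inr (Or.inl rfl))))
        rw [hr (m + 1) (by omega) le_rfl]
        simpa using hk
    | succ k ih =>
      intro n hk hu
      obtain ⟨m, hm, hr, Ls, hE, Ψ, hΨ, hsub⟩ := hw.exists_expand hT hu (by simp)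
      obtain rfl := hE.untl_cases
      simp only [List.mem_cons, List.not_mem_nil, or_false] at hΨ
      rcases hΨ with rfl | rfl
      · exact ⟨m + 1, by omega, hsub rfl⟩
      · obtain ⟨m', hm', -, hr', hu'⟩ := hw.exists_unnext hT (hsub (Or.inr (Or.inr rfl)))
        obtain ⟨m'', hm'', h''⟩ := ih m' (by
          rw [hr', hr (m + 1) (by omega) le_rfl]
          convert hk using 2 with i
          rw [tail_apply]
          congr 1
          omega) hu'
        exact ⟨m'', by omega, h''⟩
  obtain ⟨m, hm, -, hr, hu⟩ := hw.exists_unnext hT h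
  obtain ⟨k, hk, -⟩ := hsat m _ hu
  obtain ⟨m', hm', h'⟩ := key k m hk hu
  exact ⟨m', by omega, h'⟩

/-- The pivots of a walk that fulfils its until formulas are true. -/
theorem sat_of_fair (hT : IsTree strat l₀ P) (hw : Walk strat P x r) {π : Policy D M}
    (hs : ∀ n, Sound π (x n))
    (hfair : ∀ n ψ₁ ψ₂, .next (.untl ψ₁ ψ₂) ∈ (x n).pivot.fmls → ∃ m > n, ψ₂ ∈ (x m).pivot.fmls)
    (n : ℕ) : Sat (inducedChain D π) (x n).pivot.fmls (r n) := by
  intro ψ hψ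
  -- Expansions produce lighter formulas in the weight where `X` counts, except for until formulas
  -- and their negations, which reproduce themselves and need arguments of their own.
  induction hN : wt 1 ψ using Nat.strong_induction_on generalizing ψ n with
  | _ N ih =>
    subst hN
    have other : (∀ χ, ψ ≠ .next χ) → (∀ ψ₁ ψ₂, ψ ≠ .untl ψ₁ ψ₂) →
        (∀ ψ₁ ψ₂, ψ ≠ .neg (.untl ψ₁ ψ₂)) → RunSat (inducedChain D π) ψ (r n) := by
      intro h1 h2 h3
      obtain ⟨m, hm, hr, Ls, hE, Ψ, hΨ, hsub⟩ := hw.exists_expand hT hψ h1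
      have hrm := hr m hm (Nat.le_succ m)
      have hst := hw.st m
      rw [← hrm, hE.sat_iff (inducedChain D π) (r m) (by rw [hst]; rfl)
        (fun c z χ hd => by rw [hst]; exact (hs m).dec c z χ hd)]
      refine ⟨Ψ, hΨ, fun χ hχ => ?_⟩
      have := ih _ (hE.wt_lt hΨ hχ h2 h3) (m + 1) χ (hsub hχ) rfl
      rwa [hr (m + 1) (by omega) le_rfl, ← hrm] at this
    cases ψ with
    | next χ =>
      obtain ⟨m, hm, -, hr, hχ⟩ := hw.exists_unnext hT hψ
      have hlt : wt 1 χ < wt 1 (.next χ) := by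
        have := pw_le χ
        simp only [wt, fw, pw_next]
        omega
      have := ih _ hlt m χ hχ rfl
      rwa [hr] at this
    | untl ψ₁ ψ₂ =>
      have hlt1 : wt 1 ψ₁ < wt 1 (.untl ψ₁ ψ₂) := by
        have := pw_le ψ₁
        simp only [wt, fw, pw_untl]
        omega
      have hlt2 : wt 1 ψ₂ < wt 1 (.untl ψ₁ ψ₂) := by
        have := pw_le ψ₂
        simp only [wt, fw, pw_untl]
        omega
      -- Induction on the distance `d` to a pivot containing `ψ₂`. Either it occurs before the next
      -- transition, when the path is still the same, or the postponed formula is closer to it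
      -- afterwards.
      have key : ∀ d n, .untl ψ₁ ψ₂ ∈ (x n).pivot.fmls → ψ₂ ∈ (x (n + d)).pivot.fmls →
          RunSat (inducedChain D π) (.untl ψ₁ ψ₂) (r n) := by
        intro d
        induction d using Nat.strong_induction_on with
        | _ d ihd =>
          intro n hu hd
          rw [runSat_untl]
          obtain ⟨m, hm, hr, Ls, hE, Ψ, hΨ, hsub⟩ := hw.exists_expand hT hu (by simp)
          have hrm := hr (m + 1) (by omega) le_rfl
          obtain rfl := hE.untl_cases
          simp only [List.mem_cons, List.not_mem_nil, or_false] at hΨ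
          rcases hΨ with rfl | rfl
          · left
            have := ih _ hlt2 (m + 1) ψ₂ (hsub rfl) rfl
            rwa [hrm] at this
          · obtain ⟨m', hm', hk', hr', hu'⟩ := hw.exists_unnext hT (hsub (Or.inr (Or.inr rfl)))
            by_cases hlt : n + d < m'
            · left
              have := ih _ hlt2 (n + d) ψ₂ hd rfl
              by_cases hle : n + d ≤ m + 1
              · rwa [hr (n + d) (by omega) hle] at this
              · rwa [hk' (n + d) (by omega) hlt, hrm] at this
            · right
              have h1 := ih _ hlt1 (m + 1) ψ₁ (hsub (Or.inl rfl)) rfl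
              have h2 := ihd (n + d - m') (by omega) m' hu'
                (by rwa [show m' + (n + d - m') = n + d by omega])
              rw [hrm] at h1
              rw [hr', hrm] at h2
              exact ⟨h1, h2⟩
      obtain ⟨m, hm, hr, Ls, hE, Ψ, hΨ, hsub⟩ := hw.exists_expand hT hψ (by simp)
      obtain rfl := hE.untl_cases
      simp only [List.mem_cons, List.not_mem_nil, or_false] at hΨ
      rcases hΨ with rfl | rfl
      · exact key (m + 1 - n) n hψ (by
          rw [show n + (m + 1 - n) = m + 1 by omega]; exact hsub rfl)
      · obtain ⟨m', hm', h'⟩ := hfair (m + 1) ψ₁ ψ₂ (hsub (Or.inr (Or.inr rfl)))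
        exact key (m' - n) n hψ (by rwa [show n + (m' - n) = m' by omega])
    | neg χ =>
      cases χ with
      | untl ψ₁ ψ₂ =>
        have hlt1 : wt 1 (.neg ψ₁) < wt 1 (.neg (.untl ψ₁ ψ₂)) := by
          simp only [wt, fw, pw_neg]
          omega
        have hlt2 : wt 1 (.neg ψ₂) < wt 1 (.neg (.untl ψ₁ ψ₂)) := by
          simp only [wt, fw, pw_neg]
          omega
        -- A negated until formula needs no fairness, since postponing it forever makes it true. A
        -- witness `k` for the until formula is refuted by following the walk for `k` transitions.
        have key : ∀ k n, .neg (.untl ψ₁ ψ₂) ∈ (x n).pivot.fmls →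
            RunSat (inducedChain D π) ψ₂ (fun i => r n (k + i)) →
            (∀ j < k, RunSat (inducedChain D π) ψ₁ (fun i => r n (j + i))) → False := by
          intro k
          induction k with
          | zero =>
            intro n hu h2 _
            obtain ⟨m, hm, hr, Ls, hE, Ψ, hΨ, hsub⟩ := hw.exists_expand hT hu (by simp)
            obtain rfl := hE.negUntl_cases
            have hrm := hr (m + 1) (by omega) le_rfl
            have hin : .neg ψ₂ ∈ (x (m + 1)).pivot.fmls := by
              simp only [List.mem_cons, List.not_mem_nil, or_false] at hΨ
              rcases hΨ with rfl | rfl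
              · exact hsub (Or.inr rfl)
              · exact hsub (Or.inr (Or.inl rfl))
            have := ih _ hlt2 (m + 1) _ hin rfl
            rw [hrm] at this
            exact this (by simpa using h2)
          | succ k ihk =>
            intro n hu h2 h1
            obtain ⟨m, hm, hr, Ls, hE, Ψ, hΨ, hsub⟩ := hw.exists_expand hT hu (by simp)
            obtain rfl := hE.negUntl_cases
            have hrm := hr (m + 1) (by omega) le_rfl
            simp only [List.mem_cons, List.not_mem_nil, or_false] at hΨ
            rcases hΨ with rfl | rfl
            · have := ih _ hlt1 (m + 1) _ (hsub (Or.inl rfl)) rfl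
              rw [hrm] at this
              exact this (by simpa using h1 0 (Nat.succ_pos k))
            · obtain ⟨m', hm', hk', hr', hu'⟩ := hw.exists_unnext hT (hsub (Or.inr (Or.inr rfl)))
              have hshift : ∀ j, (fun i => r m' (j + i)) = fun i => r n (j + 1 + i) := by
                intro j
                funext i
                rw [hr', hrm, tail_apply]
                congr 1
                omega
              refine ihk m' hu' ?_ fun j hj => ?_
              · rw [hshift]; exact h2
              · rw [hshift]; exact h1 (j + 1) (Nat.succ_lt_succ hj)
        rintro ⟨k, hk2, hk1⟩
        exact key k n hψ hk2 hk1
      | _ => exact other (by simp) (by simp) (by simp)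
    | _ => exact other (by simp) (by simp) (by simp)

end Walk

end Walks

end PCTLSynth


namespace PCTLSynth

/-! ## Sets of runs determined up to an exit time -/

namespace Chain

section

attribute [local instance] discreteMS

variable {Q AP : Type*} [Fintype Q] {C C' : Chain Q AP} {X : Set Q}

/-- The sequences agree up to time `n` and up to the first exit from `X`. -/
def AgreeUntil (X : Set Q) (n : ℕ) (r r' : ℕ → Q) : Prop :=
  ∀ i ≤ n, (∀ j < i, r j ∈ X) → r i = r' i

theorem AgreeUntil.mono {n m : ℕ} {r r' : ℕ → Q} (h : AgreeUntil X n r r') (hm : m ≤ n) :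
    AgreeUntil X m r r' := fun i hi => h i (hi.trans hm)

theorem AgreeUntil.tail {n : ℕ} {r r' : ℕ → Q} (h : AgreeUntil X (n + 1) r r') (h0 : r 0 ∈ X) :
    AgreeUntil X n (tail r) (tail r') := by
  intro i hi hX
  rw [tail_apply, tail_apply]
  refine h (i + 1) (by omega) fun j hj => ?_
  cases j with
  | zero => exact h0
  | succ j =>
    have := hX j (by omega)
    rwa [tail_apply] at this

theorem AgreeUntil.cons {n : ℕ} {r r' : ℕ → Q} (h : AgreeUntil X n r r') (p : Q) :
    AgreeUntil X (n + 1) (cons p r) (cons p r') := by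
  intro i hi hX
  cases i with
  | zero => rfl
  | succ i => exact h i (by omega) fun j hj => hX (j + 1) (by omega)

/-- By conditioning on the first step: inside `X` the transition probabilities coincide, and from a
start outside of `X` the event depends on the start only. -/
theorem meas_and_pr_eq_of_agreeUntil (hC : ∀ p ∈ X, ∀ q, C.trans p q = C'.trans p q) {n : ℕ}
    {B : Set (ℕ → Q)} (hB : ∀ r r', AgreeUntil X n r r' → (r ∈ B → r' ∈ B)) :
    Meas B ∧ ∀ p, C.Pr p B = C'.Pr p B := by
  -- An event on which all paths from `p` agree has the same probability, zero or one, in both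
  -- chains.
  have const : ∀ p (B : Set (ℕ → Q)),
      (∀ r r' : ℕ → Q, r 0 = p → r' 0 = p → r ∈ B → r' ∈ B) → C.Pr p B = C'.Pr p B := by
    intro p B h
    by_cases hp : (fun _ => p) ∈ B
    · rw [Pr_eq_one _ fun r _ hr => h _ r rfl hr hp, Pr_eq_one _ fun r _ hr => h _ r rfl hr hp]
    · rw [Pr_eq_zero _ fun r _ hr hr' => hp (h r _ hr rfl hr'),
        Pr_eq_zero _ fun r _ hr hr' => hp (h r _ hr rfl hr')]
  induction n generalizing B with
  | zero =>
    have h0 : ∀ r r' : ℕ → Q, r 0 = r' 0 → r ∈ B → r' ∈ B := fun r r' h =>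
      hB r r' fun i hi _ => by rw [Nat.le_zero.1 hi, h]
    refine ⟨?_, fun p => const p B fun r r' h h' => h0 r r' (h.trans h'.symm)⟩
    have : B = {r | r 0 ∈ {q | (fun _ => q) ∈ B}} := by
      ext r
      exact ⟨h0 _ _ rfl, h0 _ _ rfl⟩
    rw [this]
    exact meas_coord 0 _
  | succ n ih =>
    have h1 : ∀ p, Meas (PCTLSynth.cons p ⁻¹' B) ∧ ∀ q, C.Pr q (PCTLSynth.cons p ⁻¹' B) =
        C'.Pr q (PCTLSynth.cons p ⁻¹' B) := fun p => ih fun r r' h => hB _ _ (h.cons p)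
    have hm : Meas B := by
      have : B = ⋃ p, ({r | r 0 ∈ ({p} : Set Q)} ∩ {r | PCTLSynth.tail r ∈ PCTLSynth.cons p ⁻¹' B}) := by
        ext r
        simp only [Set.mem_iUnion, Set.mem_inter_iff, Set.mem_ofPred_eq, Set.mem_singleton_iff,
          Set.mem_preimage, exists_eq_left', cons_tail]
      rw [this]
      exact Meas.iUnion fun p => (meas_coord 0 _).inter (meas_tail (h1 p).1)
    refine ⟨hm, fun p => ?_⟩
    by_cases hp : p ∈ X
    · rw [Pr_step _ p hm, Pr_step _ p hm]
      exact Finset.sum_congr rfl fun q _ => by rw [hC p hp, (h1 p).2]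
    · refine const p B fun r r' h h' => hB r r' fun i hi hX => ?_
      cases i with
      | zero => rw [h, h']
      | succ i => exact absurd (h ▸ hX 0 (Nat.succ_pos i)) hp

theorem meas_forall_mem (X : Set Q) : Meas {r : ℕ → Q | ∀ i, r i ∈ X} := by
  have : {r : ℕ → Q | ∀ i, r i ∈ X} = ⋂ i, {r | r i ∈ X} := by ext; simp
  rw [this]
  exact Meas.iInter fun i => meas_coord i X

theorem pr_inter_forall_eq_of_prefix (hC : ∀ p ∈ X, ∀ q, C.trans p q = C'.trans p q) (p : Q)
    (n : ℕ) (E : Set (ℕ → Q)) (hE : ∀ r r' : ℕ → Q, (∀ i ≤ n, r i = r' i) → r ∈ E → r' ∈ E) :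
    C.Pr p (E ∩ {r | ∀ i, r i ∈ X}) = C'.Pr p (E ∩ {r | ∀ i, r i ∈ X}) := by
  -- The offset `n` makes already the first of these events long enough to determine membership in
  -- `E`.
  have hE' : E ∩ {r | ∀ i, r i ∈ X} = ⋂ m, (E ∩ {r | ∀ i ≤ m + n, r i ∈ X}) := by
    ext r
    simp only [Set.mem_inter_iff, Set.mem_ofPred_eq, Set.mem_iInter]
    exact ⟨fun h m => ⟨h.1, fun i _ => h.2 i⟩, fun h => ⟨(h 0).1, fun i => (h i).2 i (by omega)⟩⟩
  have key := fun m => meas_and_pr_eq_of_agreeUntil (C := C) (C' := C') hC (n := m + n)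
    (B := E ∩ {r | ∀ i ≤ m + n, r i ∈ X}) (by
      rintro r r' h ⟨h1, h2⟩
      have h3 : ∀ i ≤ m + n, r i = r' i := fun i hi => h i hi fun j hj => h2 j (by omega)
      exact ⟨hE r r' (fun i hi => h3 i (by omega)) h1, fun i hi => h3 i hi ▸ h2 i hi⟩)
  rw [hE']
  refine Pr_iInter_congr (fun m => (key m).1) ?_ fun m => (key m).2 p
  intro m m' hm r hr
  exact ⟨hr.1, fun i hi => hr.2 i (by omega)⟩

/-- The events on which the chains agree within the paths that stay in `X` contain the cylinders and
are closed under complements and countable disjoint unions. -/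
theorem pr_inter_forall_eq (hC : ∀ p ∈ X, ∀ q, C.trans p q = C'.trans p q) {B : Set (ℕ → Q)}
    (hB : Meas B) (p : Q) :
    C.Pr p (B ∩ {r | ∀ i, r i ∈ X}) = C'.Pr p (B ∩ {r | ∀ i, r i ∈ X}) := by
  have hA := meas_forall_mem X
  refine MeasurableSpace.induction_on_inter (C := fun B _ => C.Pr p (B ∩ {r | ∀ i, r i ∈ X}) =
    C'.Pr p (B ∩ {r | ∀ i, r i ∈ X})) generateFrom_cyls isPiSystem_cyls ?_ ?_ ?_ ?_ B hB
  · simp only [Set.empty_inter, Pr_empty]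
  · rintro E (rfl | ⟨n, a, rfl⟩)
    · simp only [Set.empty_inter, Pr_empty]
    · refine pr_inter_forall_eq_of_prefix hC p n _ fun r r' h hr i hi => ?_
      rw [← h i hi]
      exact hr i hi
  · intro E hE ih
    have key : ∀ C : Chain Q AP, C.Pr p (Eᶜ ∩ {r | ∀ i, r i ∈ X}) =
        C.Pr p (Set.univ ∩ {r | ∀ i, r i ∈ X}) - C.Pr p (E ∩ {r | ∀ i, r i ∈ X}) := by
      intro C
      have h := Pr_union C (p := p) (E := Eᶜ ∩ {r | ∀ i, r i ∈ X})
        (E' := E ∩ {r | ∀ i, r i ∈ X}) (Meas.inter hE hA)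
        (fun r h1 h2 => h1.1 h2.1)
      rw [← Set.union_inter_distrib_right, Set.compl_union_self] at h
      linarith
    rw [key, key, ih, pr_inter_forall_eq_of_prefix hC p 0 Set.univ fun _ _ _ _ => Set.mem_univ _]
  · intro f hd hf ih
    rw [Set.iUnion_inter]
    have hu : ∀ g : ℕ → Set (ℕ → Q), ⋃ n, g n = ⋃ n, Set.accumulate g n := fun g =>
      Set.iUnion_accumulate.symm
    rw [hu]
    refine Pr_iUnion_congr Set.monotone_accumulate fun n => ?_
    induction n with
    | zero => simpa [Set.accumulate_zero_nat] using ih 0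
    | succ n ihn =>
      rw [Set.accumulate_succ]
      have hdis : ∀ r, r ∈ Set.accumulate (fun i => f i ∩ {r | ∀ i, r i ∈ X}) n →
          r ∈ f (n + 1) ∩ {r | ∀ i, r i ∈ X} → False := by
        intro r h1 h2
        obtain ⟨m, hm, h1⟩ := Set.mem_accumulate.1 h1
        exact Set.disjoint_left.1 (hd (by omega : m ≠ n + 1)) h1.1 h2.1
      rw [Pr_union _ (Meas.inter (hf _) hA) hdis, Pr_union _ (Meas.inter (hf _) hA) hdis, ihn, ih]

end

end Chain

/-! ## Nodes of the tableau -/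

section Nodes

variable {S A M AP : Type*} [Fintype S] [Fintype A] {D : MDP S A AP} {ρ : PartialPolicy S M}
  {strat : Strategy D ρ} {l₀ : Leaf S A M AP} {P : Set (Leaf S A M AP)}

namespace IsTree

theorem isChild_toNode (hT : IsTree strat l₀ P) {x : Leaf S A M AP} (hx : x ∈ P) {b : Bool}
    {n : TNode S A M AP} (hn : n ∈ tab strat P) (h : Tab.IsChild (x.toNode b) n) :
    (∃ y ∈ P, ∃ i, n = y.toNode (strat.byX y) ∧ IsKid strat x y i) ∨
      ∃ γ k, strat.pick x = .close γ k ∧ n = x.closed γ k := by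
  obtain ⟨i, hi⟩ := h
  rcases hn with ⟨y, hy, rfl⟩ | ⟨y, hy, γ, k, hp, rfl⟩
  · exact Or.inl ⟨y, hy, i, rfl, hT.isKid_of_name hx hy hi⟩
  · obtain ⟨h1, -⟩ := childName_inj hi
    obtain rfl := hT.inj y hy x hx h1
    exact Or.inr ⟨γ, k, hp, rfl⟩

theorem close_name (hT : IsTree strat l₀ P) {x y : Leaf S A M AP} (hx : x ∈ P) (hy : y ∈ P)
    {γ : Constr (Var S A M AP)} {k : Pseudo AP} (hp : strat.pick x = .close γ k) (i : ℕ) :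
    y.name ≠ childName x.name i := by
  intro h
  obtain ⟨b, concl, γ', hp', -⟩ := hT.isKid_of_name hx hy h
  rw [hp] at hp'
  cases hp'

theorem closed_above (hT : IsTree strat l₀ P) {x y : Leaf S A M AP} (hx : x ∈ P) (hy : y ∈ P)
    {γ : Constr (Var S A M AP)} {k : Pseudo AP} (hp : strat.pick x = .close γ k)
    (h : x.name <+: y.name) : y = x := by
  refine hT.induct hx (motive := fun y => y = x) rfl ?_ hy h
  rintro z - w hw i - hk rfl
  obtain ⟨b, concl, γ', hp', -⟩ := hk
  rw [hp] at hp'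
  cases hp'

theorem not_isChild_closed (hT : IsTree strat l₀ P) {x : Leaf S A M AP} (hx : x ∈ P)
    {γ : Constr (Var S A M AP)} {k : Pseudo AP} (hp : strat.pick x = .close γ k)
    {n : TNode S A M AP} (hn : n ∈ tab strat P) : ¬ Tab.IsChild (x.closed γ k) n := by
  rintro ⟨i, hi⟩
  rcases hn with ⟨y, hy, rfl⟩ | ⟨y, hy, γ', k', hp', rfl⟩
  · have hi' : y.name = childName (childName x.name 0) i := hi
    have := hT.closed_above hx hy hp (by
      rw [hi']; exact (prefix_childName _ _).trans (prefix_childName _ _))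
    rw [this] at hi'
    have := congrArg List.length hi'
    simp [childName] at this
  · obtain ⟨h1, -⟩ := childName_inj hi
    exact hT.close_name hx hy hp 0 h1

theorem isLeaf_closed (hT : IsTree strat l₀ P) {x : Leaf S A M AP} (hx : x ∈ P)
    {γ : Constr (Var S A M AP)} {k : Pseudo AP} (hp : strat.pick x = .close γ k) :
    (tab strat P).IsLeaf (x.closed γ k) :=
  ⟨Or.inr ⟨x, hx, γ, k, hp, rfl⟩, fun _ hn => hT.not_isChild_closed hx hp hn⟩

/-- The leaves of the tableau. -/
theorem isLeaf_cases (hT : IsTree strat l₀ P) {n : TNode S A M AP} (h : (tab strat P).IsLeaf n) :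
    (∃ x ∈ P, (∃ b γ, strat.pick x = .union b [] γ) ∧ n = x.toNode (strat.byX x)) ∨
      ∃ x ∈ P, ∃ γ k, strat.pick x = .close γ k ∧ n = x.closed γ k := by
  rcases h.1 with ⟨x, hx, rfl⟩ | h'
  · left
    refine ⟨x, hx, ?_, rfl⟩
    rcases hT.done x hx with ⟨γ, k, hp⟩ | ⟨b, concl, γ, hp⟩
    · exact absurd ⟨0, rfl⟩ (h.2 (x.closed γ k) (Or.inr ⟨x, hx, γ, k, hp, rfl⟩))
    · cases concl with
      -- If no action is prescribed, the transition rule has no conclusions and its node is a leaf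
      -- without being closed.
      | nil => exact ⟨b, γ, hp⟩
      | cons F concl =>
        obtain ⟨y, hy, hk⟩ := hT.kids x hx _ _ _ hp 0 (by simp)
        obtain ⟨b', concl', γ', hp', hi, hn, -⟩ := hk
        exact absurd ⟨0, hn⟩ (h.2 (y.toNode (strat.byX y)) (Or.inl ⟨y, hy, rfl⟩))
  · exact Or.inr h'

/-- Every program of the tree is contained in the program of some leaf of the tableau. -/
theorem prog_subset_gamma (hT : IsTree strat l₀ P) {x : Leaf S A M AP} (hx : x ∈ P) :
    x.prog ⊆ (tab strat P).gamma := by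
  obtain ⟨B, hB⟩ := (hT.fin.image fun x => x.name.length).bddAbove
  have key : ∀ d, ∀ x ∈ P, B - x.name.length = d → x.prog ⊆ (tab strat P).gamma := by
    intro d
    induction d using Nat.strong_induction_on with
    | _ d ih =>
      intro x hx hd
      rcases hT.done x hx with ⟨γ, k, hp⟩ | ⟨b, concl, γ, hp⟩
      · exact fun γ' hγ' => Or.inl ⟨_, hT.isLeaf_closed hx hp, Or.inl hγ'⟩
      · cases concl with
        | nil =>
          refine fun γ' hγ' => Or.inl ⟨x.toNode (strat.byX x), ⟨Or.inl ⟨x, hx, rfl⟩, ?_⟩, hγ'⟩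
          intro n hn hc
          rcases hT.isChild_toNode hx hn hc with ⟨y, hy, i, -, b', concl', γ', hp', hi, -⟩ |
            ⟨γ', k, hp', -⟩
          · rw [hp] at hp'
            cases hp'
            simp at hi
          · rw [hp] at hp'
            cases hp'
        | cons F concl =>
          obtain ⟨y, hy, hk⟩ := hT.kids x hx _ _ _ hp 0 (by simp)
          have hl := hk.length
          have hy' : y.name.length ≤ B := hB ⟨y, hy, rfl⟩
          obtain ⟨b', concl', γ', hp', hi, hn, -, -, hsub⟩ := hk
          exact hsub.trans (ih _ (by omega) y hy rfl)
  exact key _ x hx rfl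

end IsTree

/-- The shape of the equations that are added when a leaf is closed or branches. -/
def Constr.IsPivotEq (γ : Constr (Var S A M AP)) : Prop := γ.rel = .eq ∧ ∃ u F, γ.lhs = xF u F

theorem Strategy.isPivotEq (strat : Strategy D ρ) {l : Leaf S A M AP} :
    (∀ γ k, strat.pick l = .close γ k → γ.IsPivotEq) ∧
      ∀ b concl γ, strat.pick l = .union b concl γ → γ.IsPivotEq := by
  obtain ⟨n, hr, -⟩ := strat.admissible l
  generalize strat.pick l = o at hr
  cases hr <;> refine ⟨?_, ?_⟩ <;> intros <;> rename_i h <;>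
    simp only [Leaf.one, Leaf.two, nextOutcome, reduceCtorEq, Outcome.close.injEq,
      Outcome.union.injEq] at h <;>
    first
    | (obtain ⟨rfl, -⟩ := h; exact ⟨rfl, _, _, rfl⟩)
    | (obtain ⟨-, -, rfl⟩ := h; exact ⟨rfl, _, _, rfl⟩)

/-- Closing and forcing contribute only equations for variables of pivots, which decide nothing
about actions or `P`-formulas. -/
theorem IsTree.gamma_cases (hT : IsTree strat l₀ P) {γ : Constr (Var S A M AP)}
    (h : γ ∈ (tab strat P).gamma) : (∃ x ∈ P, γ ∈ x.prog) ∨ γ.IsPivotEq := by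
  rcases h with ⟨n, hn, hγ⟩ | ⟨u, F, -, ⟨-, rfl⟩ | ⟨-, rfl⟩⟩
  · rcases hT.isLeaf_cases hn with ⟨x, hx, -, rfl⟩ | ⟨x, hx, γ', k, hp, rfl⟩
    · exact Or.inl ⟨x, hx, hγ⟩
    · rcases hγ with hγ | rfl
      · exact Or.inl ⟨x, hx, hγ⟩
      · exact Or.inr (strat.isPivotEq.1 _ _ hp)
  · exact Or.inr ⟨rfl, _, _, rfl⟩
  · exact Or.inr ⟨rfl, _, _, rfl⟩

end Nodes

end PCTLSynth


namespace PCTLSynth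

/-! ## Existence of walks -/

theorem exists_seq_of_forall {α : Type*} {I : α → Prop} {R : α → α → Prop} {a : α} (ha : I a)
    (h : ∀ a, I a → ∃ b, R a b ∧ I b) : ∃ f : ℕ → α, f 0 = a ∧ ∀ n, I (f n) ∧ R (f n) (f (n + 1)) := by
  choose! g hg using h
  have hI : ∀ n, I (g^[n] a) := fun n => by
    induction n with
    | zero => exact ha
    | succ n ih =>
      rw [Function.iterate_succ_apply']
      exact (hg _ ih).2
  refine ⟨fun n => g^[n] a, rfl, fun n => ⟨hI n, ?_⟩⟩
  simp only [Function.iterate_succ_apply']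
  exact (hg _ (hI n)).1

section Coupling

variable {S A M AP : Type*} [Fintype S] [Fintype A] [Fintype M] {D : MDP S A AP}
  {ρ : PartialPolicy S M} {strat : Strategy D ρ} {l₀ : Leaf S A M AP} {P : Set (Leaf S A M AP)}

theorem exists_walk {I : Leaf S A M AP → (ℕ → M × S) → Prop}
    {R : Leaf S A M AP → (ℕ → M × S) → Leaf S A M AP → (ℕ → M × S) → Prop}
    (hI : ∀ x r, I x r → x ∈ P ∧ ∃ y r', R x r y r' ∧ I y r') (hR : ∀ x r y r', R x r y r' →
      Move strat x r y r')
    {x : Leaf S A M AP} {r : ℕ → M × S} (h : I x r) (hr : r 0 = x.st) :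
    ∃ xs rs, Walk strat P xs rs ∧ xs 0 = x ∧ rs 0 = r ∧
      ∀ n, I (xs n) (rs n) ∧ R (xs n) (rs n) (xs (n + 1)) (rs (n + 1)) := by
  obtain ⟨f, hf0, hf⟩ := exists_seq_of_forall (I := fun p => I p.1 p.2)
    (R := fun p q : Leaf S A M AP × (ℕ → M × S) => R p.1 p.2 q.1 q.2) (a := (x, r)) h
    (fun p hp => by
      obtain ⟨-, y, r', h1, h2⟩ := hI _ _ hp
      exact ⟨(y, r'), h1, h2⟩)
  refine ⟨fun n => (f n).1, fun n => (f n).2, ⟨fun n => (hI _ _ (hf n).1).1,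
    fun n => hR _ _ _ _ (hf n).2, ?_⟩, congrArg Prod.fst hf0, congrArg Prod.snd hf0, hf⟩
  simpa only [hf0] using hr

/-- The transition of a walk that leaves the current path. -/
theorem Walk.exists_transition (hT : IsTree strat l₀ P) {x : ℕ → Leaf S A M AP}
    {r : ℕ → ℕ → M × S} (hw : Walk strat P x r) (n : ℕ) :
    ∃ m ≥ n, (x m).pivot.Poised ∧ (∃ i, IsKid strat (x m) (x (m + 1)) i) ∧ r m = r n ∧
      r (m + 1) = tail (r n) := by
  obtain ⟨N, hN, hpo, hk, hr⟩ := hw.exists_next hT n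
  obtain ⟨d, rfl⟩ := Nat.exists_eq_add_of_le hN
  clear hN
  induction d generalizing n with
  | zero => exact ⟨n, le_rfl, hpo, hk, rfl, hr⟩
  | succ d ih =>
    have e : n + (d + 1) = n + 1 + d := by omega
    rw [e] at hpo hk hr
    have key : r (n + 1) = r n → ∃ m ≥ n, (x m).pivot.Poised ∧
        (∃ i, IsKid strat (x m) (x (m + 1)) i) ∧ r m = r n ∧ r (m + 1) = tail (r n) := by
      intro h
      obtain ⟨m, hm, h1, h2, h3, h4⟩ := ih (n + 1) hpo hk hr
      exact ⟨m, by omega, h1, h2, h3.trans h, by rw [h4, h]⟩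
    have hst := hw.step n
    generalize hy : x (n + 1) = y at hst
    generalize hr' : r (n + 1) = r' at hst key
    cases hst with
    | same => exact key rfl
    | next _ i _ h hk' => exact ⟨n, le_rfl, h, ⟨i, by rwa [hy]⟩, rfl, hr'⟩
    | jump => exact key rfl

/-- Every state of the path is left by a transition of the walk, which takes place at a poised node
where the actions are decided. -/
theorem Walk.forall_mem (hT : IsTree strat l₀ P) {X : Set (M × S)}
    (hX : ∀ x ∈ P, x.pivot.Poised → x.Decided D → x.st ∈ X) {x : ℕ → Leaf S A M AP}
    {r : ℕ → ℕ → M × S} (hw : Walk strat P x r) (i n : ℕ) : r n i ∈ X := by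
  induction i generalizing n with
  | zero =>
    obtain ⟨m, -, hpo, ⟨i, hk⟩, hr, -⟩ := hw.exists_transition hT n
    rw [← hr, hw.st m]
    exact hX _ (hw.mem m) hpo (kid_next hk hpo).1
  | succ i ih =>
    obtain ⟨m, -, -, -, -, hr⟩ := hw.exists_transition hT n
    have := ih (m + 1)
    rwa [hr, tail_apply] at this

/-- A leaf of the given kind is reachable along a path in at most the given number of moves. -/
inductive Reaches (strat : Strategy D ρ) (P : Set (Leaf S A M AP)) (B : Leaf S A M AP → Prop) :
    ℕ → Leaf S A M AP → (ℕ → M × S) → Prop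
  | base (n x r) : x ∈ P → B x → Reaches strat P B n x r
  | move (n x r y r') : x ∈ P → Move strat x r y r' → Reaches strat P B n y r' →
      Reaches strat P B (n + 1) x r

/-- The selected inference closes the leaf with a check. -/
def IsCheck (strat : Strategy D ρ) (x : Leaf S A M AP) : Prop := ∃ γ, strat.pick x = .close γ .check

theorem Reaches.succ {B : Leaf S A M AP → Prop} {n : ℕ} {x : Leaf S A M AP} {r : ℕ → M × S}
    (h : Reaches strat P B n x r) : Reaches strat P B (n + 1) x r := by
  induction h with
  | base n x r h1 h2 => exact .base _ _ _ h1 h2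
  | move n x r y r' h1 h2 _ ih => exact .move _ _ _ _ _ h1 h2 ih

/-- Moves look one state ahead only at transitions, and these start in `X`. So what can be reached
in `n` moves depends on the path up to time `n` and the exit from `X`. -/
theorem Reaches.congr {B : Leaf S A M AP → Prop} {X : Set (M × S)}
    (hX : ∀ x ∈ P, x.pivot.Poised → x.Decided D → x.st ∈ X) {n : ℕ} {x : Leaf S A M AP}
    {r r' : ℕ → M × S} (h : Reaches strat P B n x r) (hr : r 0 = x.st)
    (hrr' : Chain.AgreeUntil X n r r') : Reaches strat P B n x r' := by
  induction h generalizing r' with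
  | base n x r h1 h2 => exact .base _ _ _ h1 h2
  | move n x r y r₁ h1 h2 _ ih =>
    have hy := h2.st hr
    cases h2 with
    | same _ i _ h3 h4 =>
      exact .move _ _ _ _ _ h1 (.same _ _ _ _ h3 h4) (ih hy (hrr'.mono (Nat.le_succ n)))
    | next _ i _ h3 h4 h5 =>
      have h0 : r 0 ∈ X := by
        rw [hr]
        exact hX x h1 h3 (kid_next h4 h3).1
      refine .move _ _ _ _ _ h1 (.next _ _ i _ h3 h4 ?_) (ih hy (hrr'.tail h0))
      rw [← h5]
      refine (hrr' 1 (by omega) fun j hj => ?_).symm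
      rwa [Nat.lt_one_iff.1 hj]
    | jump _ _ h3 h4 h5 h6 =>
      exact .move _ _ _ _ _ h1 (.jump _ _ _ h3 h4 h5 h6) (ih hy (hrr'.mono (Nat.le_succ n)))

theorem Reaches.sat {π : Policy D M} (hs : ∀ x ∈ P, Sound π x) {n : ℕ} {x : Leaf S A M AP}
    {r : ℕ → M × S} (h : Reaches strat P (IsCheck strat) n x r) (hr : r 0 = x.st) :
    Sat (inducedChain D π) x.pivot.fmls r := by
  induction h with
  | base n x r h1 h2 =>
    obtain ⟨γ, h2⟩ := h2
    rw [check_empty h2]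
    exact fun _ h => h.elim
  | move n x r y r' h1 h2 _ ih => exact h2.sat_back (hs x h1) hr (ih (h2.st hr))

theorem isRun_tail {Q : Type*} [Fintype Q] {C : Chain Q AP} {r : ℕ → Q} (h : C.IsRun r) :
    C.IsRun (tail r) := fun i => by
  rw [tail_apply, tail_apply]
  exact h (i + 1)

/-- A loop can be followed to any of the ancestors with the same pivot. -/
theorem IsLoop.exists_target (hT : IsTree strat l₀ P) (h0 : l₀.anc = []) {x : Leaf S A M AP}
    (hx : x ∈ P) {v : Anc S M AP} (h : IsLoop strat x v) (r : ℕ → M × S) :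
    ∃ y ∈ P, y.toAnc = v ∧ Move strat x r y r ∧ y.pivot = x.pivot := by
  obtain ⟨h1, h2⟩ := h.target
  obtain ⟨y, hy, rfl, ha⟩ := (hT.mem_anc h0 hx).1 h1
  exact ⟨y, hy, rfl, .jump _ _ _ h.1 ha h2 h.close, h2⟩

/-- A run satisfying the pivot of a node reaches a check leaf or is followed by an infinite walk. -/
theorem reaches_or_walk (hT : IsTree strat l₀ P) (h0 : l₀.anc = []) {π : Policy D M}
    (hπ : π.toPartialPolicy = ρ) (hs : ∀ x ∈ P, Sound π x) {x : Leaf S A M AP} (hx : x ∈ P)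
    {r : ℕ → M × S} (hrun : (inducedChain D π).IsRun r) (hr : r 0 = x.st)
    (hsat : Sat (inducedChain D π) x.pivot.fmls r) : (∃ n, Reaches strat P (IsCheck strat) n x r) ∨
      ∃ xs rs, Walk strat P xs rs ∧ xs 0 = x ∧ rs 0 = r ∧
        ∀ n, Sat (inducedChain D π) (xs n).pivot.fmls (rs n) := by
  by_cases hH : ∃ n, Reaches strat P (IsCheck strat) n x r
  · exact Or.inl hH
  right
  -- The invariant includes that no check leaf is reachable, which leaves a child or a loop as the
  -- next move.
  obtain ⟨xs, rs, h1, h2, h3, h4⟩ := exists_walk (strat := strat) (P := P) (R := Move strat)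
    (I := fun x r => x ∈ P ∧ (inducedChain D π).IsRun r ∧ r 0 = x.st ∧
      Sat (inducedChain D π) x.pivot.fmls r ∧ ¬ ∃ n, Reaches strat P (IsCheck strat) n x r) (by
      rintro x r ⟨hx, hrun, hr, hsat, hH⟩
      refine ⟨hx, ?_⟩
      have next : ∀ y ∈ P, ∀ r', Move strat x r y r' → (r' = r ∨ r' = tail r) →
          Sat (inducedChain D π) y.pivot.fmls r' →
          ∃ y r', Move strat x r y r' ∧ y ∈ P ∧ (inducedChain D π).IsRun r' ∧ r' 0 = y.st ∧
            Sat (inducedChain D π) y.pivot.fmls r' ∧ ¬ ∃ n, Reaches strat P (IsCheck strat) n y r' := by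
        intro y hy r' hm hr' hsy
        refine ⟨y, r', hm, hy, ?_, hm.st hr, hsy, fun ⟨n, hn⟩ => hH ⟨_, .move _ _ _ _ _ hx hm hn⟩⟩
        rcases hr' with rfl | rfl
        exacts [hrun, isRun_tail hrun]
      rcases exists_step hT hπ hx (hs x hx) hrun hr hsat with ⟨γ, h⟩ |
        ⟨y, hy, r', hm, -, hr', hsy⟩ | ⟨v, hv⟩
      · exact absurd ⟨0, .base _ _ _ hx ⟨γ, h⟩⟩ hH
      · exact next y hy r' hm hr' hsy
      · obtain ⟨y, hy, -, hm, hpiv⟩ := hv.exists_target hT h0 hx r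
        exact next y hy r hm (Or.inl rfl) (by rwa [hpiv]))
    (fun _ _ _ _ h => h) ⟨hx, hrun, hr, hsat, hH⟩ hr
  exact ⟨xs, rs, h1, h2, h3, fun n => (h4 n).1.2.2.2.1⟩

/-- Policies that agree where a tree has decided about actions give the same probability to the
pivots of the tree, provided that the programs are right about both. -/
theorem pr_eq_of_sound (hT : IsTree strat l₀ P) (h0 : l₀.anc = []) {π π' : Policy D M}
    (hπ : π.toPartialPolicy = ρ) (hπ' : π'.toPartialPolicy = ρ) (hs : ∀ x ∈ P, Sound π x)
    (hs' : ∀ x ∈ P, Sound π' x)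
    (hact : ∀ x ∈ P, x.Decided D → ∀ α, π.act x.pivot.mode x.pivot.state α =
      π'.act x.pivot.mode x.pivot.state α) {x : Leaf S A M AP} (hx : x ∈ P)
    (hfin : x.pivot.fmls.Finite) :
    (inducedChain D π).Pr x.st {r | Sat (inducedChain D π) x.pivot.fmls r} =
      (inducedChain D π').Pr x.st {r | Sat (inducedChain D π') x.pivot.fmls r} := by
  classical
  set C := inducedChain D π with hC
  set C' := inducedChain D π' with hC'
  -- The chains coincide on `X`, and `X` contains the policy states of all decided nodes.
  set X : Set (M × S) := {p | ∀ α, π.act p.1 p.2 α = π'.act p.1 p.2 α} with hXdef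
  have hX : ∀ x ∈ P, x.pivot.Poised → x.Decided D → x.st ∈ X := fun x hx _ hd => hact x hx hd
  have hCC : ∀ p ∈ X, ∀ q, C.trans p q = C'.trans p q := by
    intro p hp q
    have hdelta : π.delta = π'.delta := by rw [hπ, hπ']
    simp only [hC, hC', inducedChain, hdelta]
    congr 1
    exact Finset.sum_congr rfl fun α _ => by rw [hp α]
  set H : ℕ → Set (ℕ → M × S) := fun n => {r | r 0 = x.st ∧ Reaches strat P (IsCheck strat) n x r} with hH
  have hdet := fun n : ℕ => Chain.meas_and_pr_eq_of_agreeUntil (C := C) (C' := C') hCC (n := n)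
    (B := H n) (by
      rintro r r' h ⟨h1, h2⟩
      refine ⟨?_, h2.congr hX h1 h⟩
      rw [← h 0 (Nat.zero_le n) fun j hj => absurd hj (Nat.not_lt_zero j), h1])
  have hHm : Chain.Meas (⋃ n, H n) := Chain.Meas.iUnion fun n => (hdet n).1
  have hHeq : C.Pr x.st (⋃ n, H n) = C'.Pr x.st (⋃ n, H n) := by
    refine Chain.Pr_iUnion_congr ?_ fun n => (hdet n).2 x.st
    exact monotone_nat_of_le_succ fun n r hr => ⟨hr.1, hr.2.succ⟩
  -- Asking for truth under both policies makes this one measurable event that can be compared in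
  -- the two chains.
  set B : Set (ℕ → M × S) := {r | Sat C x.pivot.fmls r} ∩ {r | Sat C' x.pivot.fmls r} ∩
    (⋃ n, H n)ᶜ with hB
  have hBm : Chain.Meas B := ((meas_sat _ hfin).inter (meas_sat _ hfin)).inter hHm.compl
  -- Truth along a walk under the first policy gives fulfilment of its until formulas, a property of
  -- the walk alone, and this gives truth under the second policy.
  have key : ∀ π₁ π₂ : Policy D M, π₁.toPartialPolicy = ρ → (∀ x ∈ P, Sound π₁ x) →
      (∀ x ∈ P, Sound π₂ x) → ∀ r, (inducedChain D π₁).IsRun r → r 0 = x.st →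
      Sat (inducedChain D π₁) x.pivot.fmls r → r ∉ (⋃ n, H n) →
      Sat (inducedChain D π₂) x.pivot.fmls r ∧ ∀ i, r i ∈ X := by
    intro π₁ π₂ hπ₁ hs₁ hs₂ r hrun hr hsat hnot
    rcases reaches_or_walk hT h0 hπ₁ hs₁ hx hrun hr hsat with ⟨n, hn⟩ |
      ⟨xs, rs, hw, hx0, hr0, hws⟩
    · exact (hnot (Set.mem_iUnion.2 ⟨n, hr, hn⟩)).elim
    · have hf := hw.sat_of_fair hT (π := π₂) (fun n => hs₂ _ (hw.mem n))
        (fun n ψ₁ ψ₂ h => hw.fair_of_sat hT _ hws h) 0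
      rw [hx0, hr0] at hf
      refine ⟨hf, fun i => ?_⟩
      have := hw.forall_mem hT hX i 0
      rwa [hr0] at this
  have split : C.Pr x.st {r | Sat C x.pivot.fmls r} =
      C.Pr x.st (⋃ n, H n) + C.Pr x.st (B ∩ {r | ∀ i, r i ∈ X}) := by
    rw [← Chain.Pr_union C (hBm.inter (Chain.meas_forall_mem X)) fun r h1 h2 => h2.1.2 h1]
    refine Chain.Pr_congr _ fun r hrun hr => ⟨fun h => ?_, ?_⟩
    · by_cases hin : r ∈ ⋃ n, H n
      · exact Or.inl hin
      · obtain ⟨h1, h2⟩ := key π π' hπ hs hs' r hrun hr h hin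
        exact Or.inr ⟨⟨⟨h, h1⟩, hin⟩, h2⟩
    · rintro (h | h)
      · obtain ⟨n, h1, h2⟩ := Set.mem_iUnion.1 h
        exact h2.sat hs h1
      · exact h.1.1.1
  have split' : C'.Pr x.st {r | Sat C' x.pivot.fmls r} =
      C'.Pr x.st (⋃ n, H n) + C'.Pr x.st (B ∩ {r | ∀ i, r i ∈ X}) := by
    rw [← Chain.Pr_union C' (hBm.inter (Chain.meas_forall_mem X)) fun r h1 h2 => h2.1.2 h1]
    refine Chain.Pr_congr _ fun r hrun hr => ⟨fun h => ?_, ?_⟩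
    · by_cases hin : r ∈ ⋃ n, H n
      · exact Or.inl hin
      · obtain ⟨h1, h2⟩ := key π' π hπ' hs' hs r hrun hr h hin
        exact Or.inr ⟨⟨⟨h1, h⟩, hin⟩, h2⟩
    · rintro (h | h)
      · obtain ⟨n, h1, h2⟩ := Set.mem_iUnion.1 h
        exact h2.sat hs' h1
      · exact h.1.1.2
  rw [split, split', hHeq, Chain.pr_inter_forall_eq hCC hBm]

end Coupling

/-! ## Right programs -/

section Right

variable {S A M AP : Type*} [Fintype S] [Fintype A] [Fintype M] {D : MDP S A AP}
  {ρ : PartialPolicy S M} {strat : Strategy D ρ}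

/-- The decisions in a program about actions and `P`-formulas are those of the policy. -/
structure Program.Right (Γ : Program S A M AP) (π : Policy D M) : Prop where
  dec : ∀ m s c z ψ, HasCmp Γ m s ψ c z →
    c.Holds ((inducedChain D π).Pr (m, s) {r | RunSat (inducedChain D π) ψ r}) z
  zero : ∀ m s α, actZero m s α ∈ Γ → π.act m s α = 0
  pos : ∀ m s α, actPos m s α ∈ Γ → 0 < π.act m s α

theorem Program.Right.sound {x : Leaf S A M AP} {π : Policy D M} (h : Program.Right x.prog π) :
    Sound π x :=
  ⟨fun c z ψ hd => h.dec _ _ c z ψ hd, fun α => h.zero _ _ α, fun α => h.pos _ _ α⟩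

/-- The extra equations decide nothing. In particular a sum expression is never a single variable,
as even a sum of one term ends with `+ 0`. -/
theorem Program.Right.mono {Γ Γ' : Program S A M AP} {π : Policy D M} (h : Program.Right Γ π)
    (hsub : ∀ γ ∈ Γ', γ ∈ Γ ∨ γ.IsPivotEq ∨ ∃ m s, ∃ Δ : Program S A M AP, γ = prescribedConstr Δ m s) :
    Program.Right Γ' π := by
  have sum_ne : ∀ (s : Finset A) (e : A → Expr (Var S A M AP)) v, Expr.sum s e ≠ .var v := by
    intro s e v
    unfold Expr.sum
    cases s.toList.map e <;> simp
  refine ⟨?_, ?_, ?_⟩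
  · rintro m s c z ψ ⟨u, hu⟩
    rcases hsub _ hu with hu | ⟨hu, -⟩ | ⟨m', s', Δ, hu⟩
    · exact h.dec _ _ _ _ _ ⟨u, hu⟩
    · cases hu
    · cases congrArg Constr.rel hu
  · rintro m s α hu
    rcases hsub _ hu with hu | ⟨-, u, F, hu⟩ | ⟨m', s', Δ, hu⟩
    · exact h.zero _ _ _ hu
    · cases hu
    · exact absurd (congrArg Constr.lhs hu).symm (sum_ne _ _ _)
  · rintro m s α hu
    rcases hsub _ hu with hu | ⟨hu, -⟩ | ⟨m', s', Δ, hu⟩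
    · exact h.pos _ _ _ hu
    · cases hu
    · cases congrArg Constr.rel hu

theorem Program.Right.union {Γ Γ' : Program S A M AP} {π : Policy D M} (h : Program.Right Γ π)
    (h' : Program.Right Γ' π) : Program.Right (Γ ∪ Γ') π := by
  refine ⟨?_, ?_, ?_⟩
  · rintro m s c z ψ ⟨u, hu | hu⟩
    exacts [h.dec _ _ _ _ _ ⟨u, hu⟩, h'.dec _ _ _ _ _ ⟨u, hu⟩]
  · rintro m s α (hu | hu)
    exacts [h.zero _ _ _ hu, h'.zero _ _ _ hu]
  · rintro m s α (hu | hu)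
    exacts [h.pos _ _ _ hu, h'.pos _ _ _ hu]

theorem Program.Right.empty {π : Policy D M} : Program.Right (∅ : Program S A M AP) π :=
  ⟨fun _ _ _ _ _ ⟨_, h⟩ => h.elim, fun _ _ _ h => h.elim, fun _ _ _ h => h.elim⟩

theorem Program.Right.gamma {l₀ : Leaf S A M AP} {P : Set (Leaf S A M AP)} {π : Policy D M}
    (hT : IsTree strat l₀ P) (h : ∀ x ∈ P, Program.Right x.prog π) :
    Program.Right (tab strat P).gamma π := by
  have : Program.Right {γ | ∃ x ∈ P, γ ∈ x.prog} π := by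
    refine ⟨?_, ?_, ?_⟩
    · rintro m s c z ψ ⟨u, x, hx, hu⟩
      exact (h x hx).dec _ _ _ _ _ ⟨u, hu⟩
    · rintro m s α ⟨x, hx, hu⟩
      exact (h x hx).zero _ _ _ hu
    · rintro m s α ⟨x, hx, hu⟩
      exact (h x hx).pos _ _ _ hu
  refine this.mono fun γ hγ => ?_
  rcases hT.gamma_cases hγ with h | h
  · exact Or.inl h
  · exact Or.inr (Or.inl h)

/-- The valuation given by a policy. -/
noncomputable def Policy.val (π : Policy D M) : Var S A M AP → ℝ
  | .prob _ F => (inducedChain D π).Pr (F.mode, F.state) {r | Sat (inducedChain D π) F.fmls r}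
  | .act m s α => π.act m s α

theorem sat_singleton {Q : Type*} [Fintype Q] (C : Chain Q AP) (ψ : Formula AP) :
    {r | Sat C {ψ} r} = {r | RunSat C ψ r} := by
  ext r
  simp [Sat]

theorem Leaf.Decided.mem_policyDomain {x : Leaf S A M AP} (h : x.Decided D) {Γ : Program S A M AP}
    (hΓ : x.prog ⊆ Γ) : (x.pivot.mode, x.pivot.state) ∈ policyDomain Γ := by
  obtain ⟨α, hα⟩ := D.enabled_nonempty x.pivot.state
  rcases h α hα with h | h
  · exact ⟨_, hΓ h, α, Or.inl rfl⟩
  · exact ⟨_, hΓ h, α, Or.inl rfl⟩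

theorem policyDomain_mono {Γ Γ' : Program S A M AP} (h : Γ ⊆ Γ') :
    policyDomain Γ ⊆ policyDomain Γ' := fun _ ⟨γ, hγ, h'⟩ => ⟨γ, h hγ, h'⟩

theorem Strategy.dontKnow_cases (strat : Strategy D ρ) {l : Leaf S A M AP}
    {γ γ' : Constr (Var S A M AP)} (h : strat.pick l = .dontKnow γ γ') : ∃ m s α,
    γ = actZero m s α ∧ γ' = actPos m s α := by
  obtain ⟨n, hr, -⟩ := strat.admissible l
  rw [h] at hr
  generalize ho : Outcome.dontKnow γ γ' = o at hr
  cases hr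
  case a α h1 h2 h3 h4 => cases ho; exact ⟨_, _, _, rfl, rfl⟩
  all_goals cases ho

theorem Strategy.extend_cases (strat : Strategy D ρ) {l : Leaf S A M AP}
    {γ : Constr (Var S A M AP)} (h : strat.pick l = .extend γ) :
    γ = prescribedConstr l.prog l.pivot.mode l.pivot.state := by
  obtain ⟨n, hr, -⟩ := strat.admissible l
  rw [h] at hr
  generalize ho : Outcome.extend γ = o at hr
  cases hr
  case prescribed h1 h2 => cases ho; rfl
  all_goals cases ho

theorem Program.Right.actZero {π : Policy D M} {m : M} {s : S} {α : A} (h : π.act m s α = 0) :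
    Program.Right {PCTLSynth.actZero m s α} π where
  dec _ _ _ _ _ := fun ⟨_, hu⟩ => by cases hu
  zero _ _ _ hu := by cases hu; exact h
  pos _ _ _ hu := by cases hu

theorem Program.Right.actPos {π : Policy D M} {m : M} {s : S} {α : A} (h : 0 < π.act m s α) :
    Program.Right {PCTLSynth.actPos m s α} π where
  dec _ _ _ _ _ := fun ⟨_, hu⟩ => by cases hu
  zero _ _ _ hu := by cases hu
  pos _ _ _ hu := by cases hu; exact h

theorem Program.Right.cmpConstr {π : Policy D M} {u : Name AP} {m : M} {s : S} {ψ : Formula AP}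
    {c : Cmp} {z : unitInterval}
    (h : c.Holds ((inducedChain D π).Pr (m, s) {r | RunSat (inducedChain D π) ψ r}) z) :
    Program.Right ({PCTLSynth.cmpConstr u m s ψ c z} : Program S A M AP) π where
  dec m' s' c' z' ψ' := fun ⟨v, hu⟩ => by
    simp only [PCTLSynth.cmpConstr, Set.mem_singleton_iff, Constr.mk.injEq, xF, Expr.var.injEq,
      Var.prob.injEq, LForm.mk.injEq, CRel.cmp.injEq, Expr.const.injEq, Set.singleton_eq_singleton_iff,
      Subtype.val_inj] at hu
    obtain ⟨⟨-, rfl, rfl, rfl⟩, rfl, rfl⟩ := hu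
    exact h
  zero _ _ _ hu := by cases hu
  pos _ _ _ hu := by cases hu

/-- In a derivation guided by a policy all programs are right about this policy and about all
policies that agree with it on the policy domain. -/
theorem Guided.right {π π' : Policy D M} (hπ : π.toPartialPolicy = ρ)
    (hπ' : π'.toPartialPolicy = ρ) {l : Leaf S A M AP} {P : Set (Leaf S A M AP)}
    (h : Guided strat π.val l P)
    (hdom : ∀ x ∈ P, ∀ m s, (m, s) ∈ policyDomain x.prog → ∀ α, π.act m s α = π'.act m s α)
    (hl : Program.Right l.prog π) (hl' : Program.Right l.prog π') :
    ∀ x ∈ P, Program.Right x.prog π ∧ Program.Right x.prog π' := by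
  induction h with
  | close l γ k hp =>
    rintro x rfl
    exact ⟨hl, hl'⟩
  | union l byX concl γ Ps hp hPs ih =>
    rintro x (rfl | hx)
    · exact ⟨hl, hl'⟩
    · obtain ⟨i, hx⟩ := Set.mem_iUnion.1 hx
      have hsub : ∀ γ' ∈ (l.child concl γ i).prog, γ' ∈ l.prog ∨ γ'.IsPivotEq ∨
          ∃ m s, ∃ Δ : Program S A M AP, γ' = prescribedConstr Δ m s := by
        rintro γ' (h | ⟨-, rfl⟩)
        · exact Or.inl h
        · exact Or.inr (Or.inl (strat.isPivotEq.2 _ _ _ hp))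
      exact ih i (fun y hy => hdom y (Or.inr (Set.mem_iUnion.2 ⟨i, hy⟩))) (hl.mono hsub)
        (hl'.mono hsub) x hx
  | choose l γl γr γ P hp hγ hsat hg ih =>
    obtain ⟨y, hy, hey⟩ := hg.isTree.root
    -- The decision survives in the program of a node of the tree; hence its policy state is in the
    -- policy domain, where both policies agree.
    have hin : γ ∈ y.prog := hey.2.2.2 (Or.inr rfl)
    obtain ⟨m, s, α, rfl, rfl⟩ := strat.dontKnow_cases hp
    have hagree : π.act m s α = π'.act m s α := by
      refine hdom y hy m s ⟨γ, hin, α, Or.inl ?_⟩ α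
      rcases hγ with rfl | rfl <;> rfl
    have key : Program.Right {γ} π ∧ Program.Right {γ} π' := by
      rcases hγ with rfl | rfl
      · exact ⟨.actZero hsat, .actZero (hagree ▸ hsat)⟩
      · exact ⟨.actPos hsat, .actPos (hagree ▸ hsat)⟩
    exact ih hdom (hl.union key.1) (hl'.union key.2)
  | extend l γ P hp hg ih =>
    have hsub : ∀ γ' ∈ (l.addConstrs {γ}).prog, γ' ∈ l.prog ∨ γ'.IsPivotEq ∨
        ∃ m s, ∃ Δ : Program S A M AP, γ' = prescribedConstr Δ m s := by
      rintro γ' (h | rfl)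
      · exact Or.inl h
      · exact Or.inr (Or.inr ⟨_, _, _, strat.extend_cases hp⟩)
    exact ih hdom (hl.mono hsub) (hl'.mono hsub)
  | call l c z ψ d P' P hp hd hsat hg' hg ih' ih =>
    have hT' := hg'.isTree
    obtain ⟨y, hy, hey⟩ := hg.isTree.root
    -- The result of the call becomes part of the calling program, so the policies also agree on the
    -- policy domains occurring in the call.
    have hin : (tab strat P').gamma ⊆ y.prog := fun γ hγ => hey.2.2.2 (Or.inr (Or.inl hγ))
    have hdom' : ∀ x ∈ P', ∀ m s, (m, s) ∈ policyDomain x.prog → ∀ α,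
        π.act m s α = π'.act m s α := fun x hx m s h =>
      hdom y hy m s (policyDomain_mono ((hT'.prog_subset_gamma hx).trans hin) h)
    have hR := ih' hdom' .empty .empty
    have hg1 := Program.Right.gamma hT' fun x hx => (hR x hx).1
    have hg2 := Program.Right.gamma hT' fun x hx => (hR x hx).2
    have hc : d.Holds ((inducedChain D π).Pr (l.pivot.mode, l.pivot.state)
        {r | RunSat (inducedChain D π) ψ r}) z := by
      rw [← sat_singleton]
      exact hsat
    obtain ⟨w, hw, hew⟩ := hT'.root
    -- The root of the call has the same probability under both policies, so the comparison chosen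
    -- for `π` is true for `π'`.
    have heq := pr_eq_of_sound hT' rfl hπ hπ' (fun x hx => (hR x hx).1.sound)
      (fun x hx => (hR x hx).2.sound)
      (fun x hx hdec => hdom' x hx _ _ (hdec.mem_policyDomain subset_rfl)) hw
      (by rw [hew.2.1]; exact Set.finite_singleton _)
    have hst : w.st = (l.pivot.mode, l.pivot.state) := by
      rw [Leaf.st, hew.2.1]
      rfl
    have hfm : w.pivot.fmls = {ψ} := by
      rw [hew.2.1]
      rfl
    rw [hst, hfm, sat_singleton, sat_singleton] at heq
    exact ih hdom (hl.union (hg1.union (.cmpConstr hc)))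
      (hl'.union (hg2.union (.cmpConstr (heq ▸ hc))))

end Right

end PCTLSynth


namespace PCTLSynth

/-! ## Pending until formulas -/

section Pending

variable {S A M AP : Type*} [Fintype S] [Fintype A] [Fintype M] {D : MDP S A AP}
  {ρ : PartialPolicy S M} {strat : Strategy D ρ} {l₀ : Leaf S A M AP} {P : Set (Leaf S A M AP)}

/-- The until formula, or its postponement, belongs to the pivot. -/
def LForm.Pending (F : LForm S M AP) (ψ₁ ψ₂ : Formula AP) : Prop :=
  .next (.untl ψ₁ ψ₂) ∈ F.fmls ∨ .untl ψ₁ ψ₂ ∈ F.fmls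

theorem LForm.Pending.next {F : LForm S M AP} {ψ₁ ψ₂ : Formula AP} (h : F.Pending ψ₁ ψ₂)
    (hF : F.Poised) : .next (.untl ψ₁ ψ₂) ∈ F.fmls := by
  refine h.resolve_right fun h => ?_
  obtain ⟨χ, hχ⟩ := hF.2 _ h
  cases hχ

/-- Only its own unfolding removes an until formula, and this yields `ψ₂` or a postponement. -/
theorem IsKid.pending {x y : Leaf S A M AP} {i : ℕ} (hk : IsKid strat x y i) {ψ₁ ψ₂ : Formula AP}
    (h : x.pivot.Pending ψ₁ ψ₂) : y.pivot.Pending ψ₁ ψ₂ ∨ ψ₂ ∈ y.pivot.fmls := by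
  by_cases hpo : x.pivot.Poised
  · obtain ⟨-, -, -, ts, -, -, -, hy⟩ := kid_next hk hpo
    refine Or.inl (Or.inr ?_)
    rw [hy]
    exact h.next hpo
  · obtain ⟨ψ, hψ, Ls, hE, Ψ, hΨ, hy⟩ := kid_local hk hpo
    rw [hy]
    rcases h with h | h
    · refine Or.inl (Or.inl (Or.inr ⟨h, fun he => ?_⟩))
      rw [← Set.mem_singleton_iff.1 he] at hE
      exact hE.not_next
    · by_cases he : .untl ψ₁ ψ₂ = ψ
      · subst he
        obtain rfl := hE.untl_cases
        simp only [List.mem_cons, List.not_mem_nil, or_false] at hΨ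
        rcases hΨ with rfl | rfl
        · exact Or.inr (Or.inl rfl)
        · exact Or.inl (Or.inl (Or.inl (Or.inr (Or.inr rfl))))
      · exact Or.inl (Or.inr (Or.inr ⟨h, he⟩))

theorem Move.pending {x y : Leaf S A M AP} {r r' : ℕ → M × S} (hm : Move strat x r y r')
    {ψ₁ ψ₂ : Formula AP} (h : x.pivot.Pending ψ₁ ψ₂) :
    y.pivot.Pending ψ₁ ψ₂ ∨ ψ₂ ∈ y.pivot.fmls := by
  cases hm with
  | same _ i _ _ hk => exact hk.pending h
  | next _ i _ _ hk => exact hk.pending h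
  | jump _ _ _ _ hp => exact Or.inl (by rwa [hp])

/-- On the way from a node to a poised node below it, an until formula is fulfilled or remains
pending. -/
theorem IsTree.pending (hT : IsTree strat l₀ P) {x y : Leaf S A M AP} (hx : x ∈ P) (hy : y ∈ P)
    (hxy : x.name <+: y.name) (hpo : y.pivot.Poised) {ψ₁ ψ₂ : Formula AP}
    (h : .next (.untl ψ₁ ψ₂) ∈ x.pivot.fmls) : .next (.untl ψ₁ ψ₂) ∈ y.pivot.fmls ∨
      ∃ z ∈ P, x.name.Above z.name ∧ z.name <+: y.name ∧ ψ₂ ∈ z.pivot.fmls := by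
  have := hT.induct hx (motive := fun y => y.pivot.Pending ψ₁ ψ₂ ∨
    ∃ z ∈ P, x.name.Above z.name ∧ z.name <+: y.name ∧ ψ₂ ∈ z.pivot.fmls) (Or.inl (Or.inl h)) ?_ hy hxy
  · exact this.imp_left fun h => h.next hpo
  · rintro y hy w hw i hxy hk (h | ⟨z, hz, h1, h2, h3⟩)
    · rcases hk.pending h with h | h
      · exact Or.inl h
      · refine Or.inr ⟨w, hw, ⟨hxy.trans hk.prefix, fun he => ?_⟩, List.prefix_rfl, h⟩
        have h1 := hk.length
        have h2 := hxy.length_le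
        rw [he] at h2
        omega
    · exact Or.inr ⟨z, hz, h1, h2.trans hk.prefix, h3⟩

theorem Walk.pending {x : ℕ → Leaf S A M AP} {r : ℕ → ℕ → M × S} (hw : Walk strat P x r) {n m : ℕ}
    (hnm : n ≤ m) (hpo : (x m).pivot.Poised) {ψ₁ ψ₂ : Formula AP}
    (h : .next (.untl ψ₁ ψ₂) ∈ (x n).pivot.fmls) : .next (.untl ψ₁ ψ₂) ∈ (x m).pivot.fmls ∨
      ∃ k > n, ψ₂ ∈ (x k).pivot.fmls := by
  have : (x m).pivot.Pending ψ₁ ψ₂ ∨ ∃ k > n, ψ₂ ∈ (x k).pivot.fmls := by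
    clear hpo
    induction m, hnm using Nat.le_induction with
    | base => exact Or.inl (Or.inl h)
    | succ m hm ih =>
      rcases ih with ih | ih
      · rcases (hw.step m).pending ih with h | h
        · exact Or.inl h
        · exact Or.inr ⟨m + 1, by omega, h⟩
      · exact Or.inr ih
  exact this.imp_left fun h => h.next hpo

end Pending

/-! ## Bottom strongly connected components -/

section Components

variable {S A M AP : Type*} [Fintype S] [Fintype A] [Fintype M] {D : MDP S A AP}
  {ρ : PartialPolicy S M} {strat : Strategy D ρ} {l₀ : Leaf S A M AP} {P : Set (Leaf S A M AP)}

/-- The node of a leaf in the tableau. -/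
def Strategy.node (strat : Strategy D ρ) (x : Leaf S A M AP) : TNode S A M AP :=
  x.toNode (strat.byX x)

theorem node_mem_tab {x : Leaf S A M AP} (hx : x ∈ P) : strat.node x ∈ tab strat P :=
  Or.inl ⟨x, hx, rfl⟩

theorem closed_mem_tab {x : Leaf S A M AP} (hx : x ∈ P) {γ : Constr (Var S A M AP)} {k : Pseudo AP}
    (hp : strat.pick x = .close γ k) : x.closed γ k ∈ tab strat P :=
  Or.inr ⟨x, hx, γ, k, hp, rfl⟩

theorem Tab.mem_zero_of_prefix {T : Tab S A M AP} {a b : TNode S A M AP} (h : a ∈ T.zero)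
    (hb : b ∈ T) (hab : a.name <+: b.name) : b ∈ T.zero := by
  obtain ⟨d, hd, ha⟩ := h
  exact ⟨d, hd, hb, ha.2.trans hab⟩

theorem byX_of_kid {x y : Leaf S A M AP} {i : ℕ} (hk : IsKid strat x y i) (hx : x.pivot.Poised) :
    strat.byX x = true := by
  obtain ⟨b, concl, γ, hp, hi, -⟩ := hk
  have hm := strat.poisedMove hx
  generalize ho : strat.pick x = o at hm
  cases hm with
  | next ts =>
    obtain ⟨γ', hγ'⟩ := exists_nextOutcome D ρ x ts
    simp [Strategy.byX, ho, hγ']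
  | _ => rw [hp] at ho; cases ho

theorem IsKid.isChild {x y : Leaf S A M AP} {i : ℕ} (hk : IsKid strat x y i) :
    Tab.IsChild (strat.node x) (strat.node y) := by
  obtain ⟨b, concl, γ, hp, hi, hn, -⟩ := hk
  exact ⟨i, hn⟩

namespace IsTree

/-- Nodes with a poised pivot do not belong to 0-deadends. -/
theorem not_zero_of_poised (hT : IsTree strat l₀ P) {x : Leaf S A M AP} (hx : x ∈ P)
    (hpo : x.pivot.Poised) : strat.node x ∉ (tab strat P).zero := by
  rintro ⟨d, ⟨-, hd1, hd2⟩, hxd⟩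
  -- A poised node cannot be closed by a cross, and a transition from it yields an `X`-successor or
  -- an unclosed leaf; nothing of this fits into a 0-deadend.
  rcases hT.done x hx with ⟨γ, k, hp⟩ | ⟨b, concl, γ, hp⟩
  · have hc := hd2 (x.closed γ k)
      ⟨closed_mem_tab hx hp, hxd.2.trans (prefix_childName _ _)⟩ (hT.isLeaf_closed hx hp)
    have hk : k = .cross := by
      simpa [Leaf.closed] using hc
    subst hk
    have hm := strat.poisedMove hpo
    rw [hp] at hm
    generalize ho : Outcome.close γ .cross = o at hm
    cases hm with
    | next ts => obtain ⟨γ', hγ'⟩ := exists_nextOutcome D ρ x ts; rw [hγ'] at ho; cases ho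
    | _ => cases ho
  · cases concl with
    | nil =>
      have hl : (tab strat P).IsLeaf (strat.node x) := by
        refine ⟨node_mem_tab hx, fun n hn hc => ?_⟩
        rcases hT.isChild_toNode hx hn hc with ⟨y, hy, i, -, b', concl', γ', hp', hi, -⟩ |
          ⟨γ', k, hp', -⟩
        · rw [hp] at hp'
          cases hp'
          simp at hi
        · rw [hp] at hp'
          cases hp'
      have := hd2 _ hxd hl
      simp [Strategy.node, Leaf.toNode] at this
    | cons G concl =>
      obtain ⟨y, hy, hk⟩ := hT.kids x hx _ _ _ hp 0 (by simp)
      exact hd1 _ hxd (strat.node y) ⟨node_mem_tab hy, hxd.2.trans hk.prefix⟩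
        ⟨node_mem_tab hx, node_mem_tab hy, byX_of_kid hk hpo, hk.isChild⟩

theorem not_kid_of_close {x y : Leaf S A M AP} {i : ℕ} {γ : Constr (Var S A M AP)} {k : Pseudo AP}
    (hp : strat.pick x = .close γ k) : ¬ IsKid strat x y i := by
  rintro ⟨b, concl, γ', hp', -⟩
  rw [hp] at hp'
  cases hp'

/-- A child in a 0-deadend of a node outside of the 0-deadends is a 0-deadend. -/
theorem zeroDeadend_of_kid {x y : Leaf S A M AP} (hx : x ∈ P) (hy : y ∈ P)
    {i : ℕ} (hk : IsKid strat x y i) (hx0 : strat.node x ∉ (tab strat P).zero)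
    (hy0 : strat.node y ∈ (tab strat P).zero) : (tab strat P).ZeroDeadend (strat.node y) := by
  obtain ⟨d, ⟨hd, hd1, hd2⟩, -, hyd⟩ := hy0
  have hn : (strat.node y).name = childName x.name i := by
    obtain ⟨b, concl, γ, hp, hi, hn, -⟩ := hk
    exact hn
  have hsub : (tab strat P).subtree d = (tab strat P).subtree (strat.node y) := by
    rw [hn] at hyd
    -- The root of the 0-deadend around the child is the child itself; otherwise it would also cover
    -- the parent.
    rcases List.prefix_concat_iff.1 hyd with h | h
    · simp only [Tab.subtree, hn, h]
      rfl
    · exact absurd ⟨d, ⟨hd, hd1, hd2⟩, node_mem_tab hx, h⟩ hx0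
  refine ⟨node_mem_tab hy, ?_⟩
  rw [← hsub]
  exact ⟨hd1, hd2⟩

end IsTree

/-- The component below the root of a bottom strongly connected component, as a set of leaves. -/
def component (strat : Strategy D ρ) (P : Set (Leaf S A M AP)) (x₀ : Leaf S A M AP) :
    Set (Leaf S A M AP) :=
  {x | x ∈ P ∧ x₀.name <+: x.name ∧ strat.node x ∉ (tab strat P).zero}

theorem mem_component_iff {x x₀ : Leaf S A M AP} : x ∈ component strat P x₀ ↔
    x ∈ P ∧ strat.node x ∈ (tab strat P).subtree (strat.node x₀) \ (tab strat P).zero :=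
  ⟨fun h => ⟨h.1, ⟨node_mem_tab h.1, h.2.1⟩, h.2.2⟩, fun h => ⟨h.1, h.2.1.2, h.2.2⟩⟩

theorem exists_leaf_of_isBsccRoot {u : TNode S A M AP} {F : LForm S M AP}
    (h : (tab strat P).IsBsccRoot u F) : ∃ x ∈ P, u = strat.node x ∧ x.pivot = F := by
  obtain ⟨hu, hl, -⟩ := h
  rcases hu with ⟨x, hx, rfl⟩ | ⟨x, hx, γ, k, hp, rfl⟩
  · exact ⟨x, hx, rfl, by simpa [Leaf.toNode] using hl⟩
  · simp [Leaf.closed] at hl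

/-- The properties of a bottom strongly connected component, in terms of leaves. -/
structure IsComponent (strat : Strategy D ρ) (P : Set (Leaf S A M AP)) (x₀ : Leaf S A M AP) :
    Prop where
  root : x₀ ∈ component strat P x₀
  not_check : ∀ x ∈ P, x₀.name <+: x.name → ¬ IsCheck strat x
  kid : ∀ x ∈ component strat P x₀, x.pivot.Poised → ∀ y ∈ P, ∀ i, IsKid strat x y i →
    y ∈ component strat P x₀
  loop : ∀ x ∈ P, x₀.name <+: x.name → ∀ v, IsLoop strat x v → ∀ y ∈ P, y.toAnc = v →
    y ∈ component strat P x₀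
  -- Strong connectedness as an induction principle that avoids paths through pseudo-sequents: a set
  -- closed under children and loops contains everything once it contains one node.
  connected : ∀ x ∈ component strat P x₀, ∀ w ∈ component strat P x₀, ∀ K : Set (Leaf S A M AP),
    x ∈ K → (∀ x ∈ K, ∀ y ∈ component strat P x₀, ∀ i, IsKid strat x y i → y ∈ K) →
    (∀ x ∈ K, ∀ v, IsLoop strat x v → ∀ y ∈ P, y.toAnc = v → y ∈ K) → w ∈ K

theorem IsLoop.of_close {x : Leaf S A M AP} {γ : Constr (Var S A M AP)}
    {n : Name AP} (h : strat.pick x = .close γ (.yesLoop n) ∨ strat.pick x = .close γ (.noLoop n)) :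
    ∃ v, IsLoop strat x v ∧ v.name = n := by
  by_cases hpo : x.pivot.Poised
  · have hm := strat.poisedMove hpo
    generalize ho : strat.pick x = o at hm h
    cases hm with
    | act => simp at h
    | prescribed => simp at h
    | next ts =>
      obtain ⟨γ', hγ'⟩ := exists_nextOutcome D ρ x ts
      simp [hγ'] at h
    | yesLoop v h1 h2 =>
      simp only [Outcome.close.injEq, Pseudo.yesLoop.injEq, reduceCtorEq, and_false, or_false] at h
      exact ⟨v, ⟨hpo, h1, Or.inl ⟨_, ho, h2⟩⟩, h.2⟩
    | noLoop v h1 h2 h3 =>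
      simp only [Outcome.close.injEq, Pseudo.noLoop.injEq, reduceCtorEq, and_false, false_or] at h
      exact ⟨v, ⟨hpo, h1, Or.inr ⟨_, ho, h2, h3⟩⟩, h.2⟩
  · have hm := strat.localMove hpo
    generalize ho : strat.pick x = o at hm h
    cases hm <;> simp at h

theorem IsLoop.label {x : Leaf S A M AP} {v : Anc S M AP} (h : IsLoop strat x v) :
    ∃ γ k, strat.pick x = .close γ k ∧ (k = .yesLoop v.name ∨ k = .noLoop v.name) := by
  rcases h.2.2 with ⟨γ, h, -⟩ | ⟨γ, h, -⟩
  exacts [⟨γ, _, h, Or.inl rfl⟩, ⟨γ, _, h, Or.inr rfl⟩]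

/-- Ambiguity excludes check leaves and keeps all `X`-successors out of the 0-deadends; being a
bottom component keeps the targets of loops below the root. -/
theorem IsTree.isComponent (hT : IsTree strat l₀ P) (h0 : l₀.anc = []) {x₀ : Leaf S A M AP}
    (hx₀ : x₀ ∈ P) {F : LForm S M AP} (h : (tab strat P).IsBsccRoot (strat.node x₀) F) :
    IsComponent strat P x₀ := by
  obtain ⟨-, hl, hF, ⟨hA1, hA2⟩, hsub, hconn, -, hbot⟩ := h
  have hpiv : x₀.pivot = F := by simpa [Strategy.node, Leaf.toNode] using hl
  rw [← hpiv] at hF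
  have closed_mem : ∀ x ∈ P, x₀.name <+: x.name → ∀ v, IsLoop strat x v → ∀ γ k,
      strat.pick x = .close γ k → x.closed γ k ∈
        (tab strat P).subtree (strat.node x₀) \ (tab strat P).zero := by
    intro x hx hxx v hv γ k hp
    refine ⟨⟨closed_mem_tab hx hp, hxx.trans (prefix_childName _ _)⟩, ?_⟩
    rintro ⟨d, hd, hcd⟩
    have := hd.2.2 _ hcd (hT.isLeaf_closed hx hp)
    obtain ⟨γ', k', hp', hk'⟩ := hv.label
    rw [hp] at hp'
    cases hp'
    rcases hk' with rfl | rfl <;> simp [Leaf.closed] at this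
  have notCheck : ∀ x ∈ P, x₀.name <+: x.name → ¬ IsCheck strat x := by
    rintro x hx hxx ⟨γ, hp⟩
    exact hA1 (x.closed γ .check) ⟨closed_mem_tab hx hp, hxx.trans (prefix_childName _ _)⟩ rfl
  refine ⟨⟨hx₀, List.prefix_rfl, hT.not_zero_of_poised hx₀ hF⟩, notCheck, ?_, ?_, ?_⟩
  · rintro x ⟨hx, hxx, hx0⟩ hpo y hy i hk
    refine ⟨hy, hxx.trans hk.prefix, fun hy0 => ?_⟩
    exact hA2 (strat.node y) ⟨node_mem_tab hy, hxx.trans hk.prefix⟩ ⟨strat.node x, node_mem_tab hx,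
      node_mem_tab hy, byX_of_kid hk hpo, hk.isChild⟩ (IsTree.zeroDeadend_of_kid hx hy hk hx0 hy0)
  · rintro x hx hxx v hv y hy rfl
    obtain ⟨γ, k, hp, hk⟩ := hv.label
    have hc := closed_mem x hx hxx _ hv γ k hp
    have hyx : y.name <+: x.name := by
      obtain ⟨z, hz, hzy, ha⟩ := (hT.mem_anc h0 hx).1 hv.target.1
      have : z.name = y.name := congrArg Anc.name hzy
      rw [← this]
      exact ha.1
    have hy0 : strat.node y ∉ (tab strat P).zero := fun h =>
      hc.2 (Tab.mem_zero_of_prefix h hc.1.1 (hyx.trans (prefix_childName _ _)))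
    have := hbot _ hc (strat.node y) (.single ⟨⟨hc.1.1, hc.2⟩, ⟨node_mem_tab hy, hy0⟩, ?_⟩)
    · exact ⟨hy, this.1.2, hy0⟩
    · rcases hk with rfl | rfl
      exacts [Or.inr (Or.inl rfl), Or.inr (Or.inr rfl)]
  · intro x hx w hw K hxK hkid hloop
    have hx' := mem_component_iff.1 hx
    have hw' := mem_component_iff.1 hw
    have path := hconn _ hx'.2 _ hw'.2
    -- Along a path of the graph, a pseudo-sequent stands for the leaf it closes; its only outgoing
    -- edge is the backlink of that leaf.
    have main : ∀ n, Relation.ReflTransGen (fun a b => a ∈ (tab strat P).subtree (strat.node x₀) \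
        (tab strat P).zero ∧ b ∈ (tab strat P).subtree (strat.node x₀) \ (tab strat P).zero ∧
        (tab strat P).Edge a b) n (strat.node w) →
        ((∃ x ∈ P, x ∈ K ∧ n = strat.node x) ∨
          ∃ x ∈ P, x ∈ K ∧ ∃ γ k, strat.pick x = .close γ k ∧ n = x.closed γ k) → w ∈ K := by
      intro n hn
      induction hn using Relation.ReflTransGen.head_induction_on with
      | refl =>
        rintro (⟨x, hx, hK, he⟩ | ⟨x, hx, hK, γ, k, hp, he⟩)
        · rwa [hT.inj w hw.1 x hx (congrArg TNode.name he)]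
        · have := congrArg TNode.label he
          simp [Strategy.node, Leaf.toNode, Leaf.closed] at this
      | head hstep hrest ih =>
        rename_i a b
        obtain ⟨ha, hb, -, -, he⟩ := hstep
        rintro (⟨x, hx, hK, rfl⟩ | ⟨x, hx, hK, γ, k, hp, rfl⟩)
        · rcases he with he | he | he
          · rcases hT.isChild_toNode hx hb.1.1 he with ⟨y, hy, i, rfl, hk⟩ | ⟨γ, k, hp, rfl⟩
            · exact ih (Or.inl ⟨y, hy, hkid x hK y (mem_component_iff.2 ⟨hy, hb⟩) i hk, rfl⟩)
            · exact ih (Or.inr ⟨x, hx, hK, γ, k, hp, rfl⟩)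
          · simp [Strategy.node, Leaf.toNode] at he
          · simp [Strategy.node, Leaf.toNode] at he
        · have hcl : strat.pick x = .close γ (.yesLoop b.name) ∨
              strat.pick x = .close γ (.noLoop b.name) := by
            rcases he with he | he | he
            · exact absurd he (hT.not_isChild_closed hx hp hb.1.1)
            · left
              have : k = .yesLoop b.name := by simpa [Leaf.closed] using he
              rw [hp, this]
            · right
              have : k = .noLoop b.name := by simpa [Leaf.closed] using he
              rw [hp, this]
          obtain ⟨v, hv, hvn⟩ := IsLoop.of_close hcl
          obtain ⟨y, hy, hyv, -⟩ := (hT.mem_anc h0 hx).1 hv.target.1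
          have hyn : y.name = b.name := (congrArg Anc.name hyv).trans hvn
          refine ih (Or.inl ⟨y, hy, hloop x hK v hv y hy hyv, ?_⟩)
          rcases hb.1.1 with ⟨z, hz, rfl⟩ | ⟨z, hz, γ', k', hp', rfl⟩
          · rw [hT.inj y hy z hz hyn]
            rfl
          · exact absurd hyn (hT.close_name hz hy hp' 0)
    exact main _ path (Or.inl ⟨x, hx.1, hxK, rfl⟩)

end Components

end PCTLSynth


namespace PCTLSynth

/-! ## Components without yes-loops -/

section NoLoops

variable {S A M AP : Type*} [Fintype S] [Fintype A] [Fintype M] {D : MDP S A AP}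
  {ρ : PartialPolicy S M} {strat : Strategy D ρ} {l₀ : Leaf S A M AP} {P : Set (Leaf S A M AP)}

theorem IsTree.mem_branch (hT : IsTree strat l₀ P) (h0 : l₀.anc = []) {x : Leaf S A M AP}
    (hx : x ∈ P) {a : Anc S M AP} :
    a ∈ x.toAnc :: x.anc ↔ ∃ y ∈ P, y.toAnc = a ∧ y.name <+: x.name := by
  rw [List.mem_cons, hT.mem_anc h0 hx]
  constructor
  · rintro (rfl | ⟨y, hy, h1, h2⟩)
    · exact ⟨x, hx, rfl, List.prefix_rfl⟩
    · exact ⟨y, hy, h1, h2.1⟩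
  · rintro ⟨y, hy, rfl, h⟩
    by_cases he : y.name = x.name
    · rw [hT.inj y hy x hx he]
      exact Or.inl rfl
    · exact Or.inr ⟨y, hy, rfl, h, he⟩

/-- A jump from `x` to `y`, where `x` is no-blocked by `u` and `y` is the node between them. -/
structure NoJump (P : Set (Leaf S A M AP)) (x y u : Leaf S A M AP) : Prop where
  mem : u ∈ P
  above : u.name.Above y.name
  above' : y.name.Above x.name
  pivot : u.pivot = x.pivot
  pivot' : y.pivot = x.pivot
  not_yes : ∀ v, ¬ x.YesBlocked v
  blocked : ∀ ψ₁ ψ₂, .next (.untl ψ₁ ψ₂) ∈ u.pivot.fmls →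
    (∃ z ∈ P, y.name.Above z.name ∧ z.name <+: x.name ∧ ψ₂ ∈ z.pivot.fmls) →
    ∃ z ∈ P, u.name.Above z.name ∧ z.name <+: y.name ∧ ψ₂ ∈ z.pivot.fmls

theorem NoJump.of_noBlocked (hT : IsTree strat l₀ P) (h0 : l₀.anc = []) {x : Leaf S A M AP}
    (hx : x ∈ P) {a : Anc S M AP} (hyes : ∀ v, ¬ x.YesBlocked v) (h : x.NoBlocked a) :
    ∃ u y, u.toAnc = a ∧ y ∈ P ∧ NoJump P x y u := by
  obtain ⟨h1, b, hb, h2, h3, h4, h5⟩ := h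
  obtain ⟨u, hu, rfl, hux⟩ := (hT.mem_anc h0 hx).1 h1
  obtain ⟨y, hy, rfl, hyx⟩ := (hT.mem_anc h0 hx).1 hb
  refine ⟨u, y, rfl, hy, hu, h2, hyx, h3.trans h4, h4, hyes, fun ψ₁ ψ₂ hψ ⟨z, hz, hz1, hz2, hz3⟩ => ?_⟩
  obtain ⟨c, hc, hc1, hc2, hc3⟩ := h5 ψ₁ ψ₂ hψ
    ⟨z.toAnc, (hT.mem_branch h0 hx).2 ⟨z, hz, rfl, hz2⟩, hz1, hz3⟩
  obtain ⟨w, hw, rfl, -⟩ := (hT.mem_branch h0 hx).1 hc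
  refine ⟨w, hw, hc1, ?_, hc3⟩
  rcases hc2 with hc2 | hc2
  · rw [hc2]
  · exact hc2.1

/-- There is no infinite true walk all of whose jumps are no-loops. -/
theorem Walk.not_forall_noJump (hT : IsTree strat l₀ P) (h0 : l₀.anc = [])
    (hfin : ∀ x ∈ P, x.pivot.fmls.Finite) {x : ℕ → Leaf S A M AP} {r : ℕ → ℕ → M × S}
    (hw : Walk strat P x r) (C : Chain (M × S) AP) (hsat : ∀ n, Sat C (x n).pivot.fmls (r n))
    (hj : ∀ n, (∃ i, IsKid strat (x n) (x (n + 1)) i) ∨ ∃ u, NoJump P (x n) (x (n + 1)) u) :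
    False := by
  have hjumps : ∃ᶠ n in Filter.atTop, ∃ u ∈ P, NoJump P (x n) (x (n + 1)) u := by
    rw [Filter.frequently_atTop]
    intro N
    by_contra hN
    push Not at hN
    refine hT.not_forall_kid x hw.mem N fun n hn => (hj n).resolve_right ?_
    rintro ⟨u, hu⟩
    exact hN n hn u hu.mem hu
  -- Let `b` be the highest node that blocks infinitely many of the jumps. The plan is that `b`
  -- eventually yes-blocks such a jump.
  have hlen : ∃ k, ∃ u ∈ P, u.name.length = k ∧ ∃ᶠ n in Filter.atTop, NoJump P (x n) (x (n + 1)) u := by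
    by_contra hno
    push Not at hno
    refine hjumps ?_
    have : ∀ᶠ n in Filter.atTop, ∀ u ∈ P, ¬ NoJump P (x n) (x (n + 1)) u :=
      (Filter.eventually_all_finite hT.fin).2 fun u hu =>
        hno _ u hu rfl
    filter_upwards [this] with n hn ⟨u, hu, hu'⟩
    exact hn u hu hu'
  classical
  obtain ⟨b, hb, hbk, hbf⟩ := Nat.find_spec hlen
  have hmin : ∀ᶠ n in Filter.atTop, ∀ u ∈ P, u.name.length < b.name.length →
      ¬ NoJump P (x n) (x (n + 1)) u := by
    refine (Filter.eventually_all_finite hT.fin).2 fun u hu => ?_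
    by_cases hlt : u.name.length < b.name.length
    · have := Nat.find_min hlen (hbk ▸ hlt)
      push Not at this
      filter_upwards [this u hu rfl] with n hn _
      exact hn
    · exact Filter.Eventually.of_forall fun n h => absurd h hlt
  obtain ⟨N₀, hN₀⟩ := Filter.eventually_atTop.1 hmin
  obtain ⟨n₁, hn₁, hjb⟩ := Filter.frequently_atTop.1 hbf N₀
  have above_trans : ∀ {u v w : Name AP}, u <+: v → v.Above w → u.Above w := by
    intro u v w h1 h2
    refine ⟨h1.trans h2.1, fun he => ?_⟩
    have h3 := h1.length_le
    have h4 := h2.length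
    rw [he] at h3
    omega
  have prefix_top : ∀ n ≥ N₀, b.name.Above (x n).name → ∀ u, NoJump P (x n) (x (n + 1)) u →
      b.name <+: u.name := by
    intro n hn hbn u hu
    refine List.prefix_of_prefix_length_le hbn.1 (hu.above.1.trans hu.above'.1) (not_lt.1 fun h => ?_)
    exact hN₀ n hn u hu.mem h hu
  -- Once nodes above `b` have ceased to block, jumps end strictly below a blocking node that is `b`
  -- or below `b`.
  have hbelow : ∀ n > n₁, b.name.Above (x n).name := by
    intro n hn
    induction n, hn using Nat.le_induction with
    | base => exact hjb.above
    | succ n hn ih =>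
      rcases hj n with ⟨i, hk⟩ | ⟨u, hu⟩
      · exact ih.trans_le hk.prefix
      · exact above_trans (prefix_top n (by omega) ih u hu) hu.above
  have hbpo : b.pivot.Poised := by
    have hst := hw.step n₁
    generalize hy : x (n₁ + 1) = y at hst hjb
    generalize r (n₁ + 1) = r' at hst
    cases hst with
    | same _ i _ _ hk =>
      have h1 := hk.length
      have h2 := hjb.above'.length
      omega
    | next _ i _ h _ => rw [hjb.pivot]; exact h
    | jump _ _ h => rw [hjb.pivot]; exact h
  -- A fulfilment between `b` and the current node is never lost: if a jump cuts it off, the until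
  -- formula was already fulfilled between `b` and `u`, or the condition of no-blocking supplies a
  -- fulfilment between `u` and the target.
  have hmono : ∀ n > n₁, ∀ ψ₁ ψ₂, .next (.untl ψ₁ ψ₂) ∈ b.pivot.fmls →
      (∃ z ∈ P, b.name.Above z.name ∧ z.name <+: (x n).name ∧ ψ₂ ∈ z.pivot.fmls) →
      ∃ z ∈ P, b.name.Above z.name ∧ z.name <+: (x (n + 1)).name ∧ ψ₂ ∈ z.pivot.fmls := by
    rintro n hn ψ₁ ψ₂ hψ ⟨z, hz, h1, h2, h3⟩
    rcases hj n with ⟨i, hk⟩ | ⟨u, hu⟩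
    · exact ⟨z, hz, h1, h2.trans hk.prefix, h3⟩
    · have hbu := prefix_top n (by omega) (hbelow n hn) u hu
      have hupo : u.pivot.Poised := by
        have hst := hw.step n
        generalize x (n + 1) = y at hst hu
        generalize r (n + 1) = r' at hst
        cases hst with
        | same _ i _ _ hk =>
          have h1 := hk.length
          have h2 := hu.above'.length
          omega
        | next _ i _ h _ => rw [hu.pivot]; exact h
        | jump _ _ h => rw [hu.pivot]; exact h
      rcases hT.pending hb hu.mem hbu hupo hψ with h | ⟨w, hw', hw1, hw2, hw3⟩
      · by_cases hzy : z.name <+: (x (n + 1)).name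
        · exact ⟨z, hz, h1, hzy, h3⟩
        · have hyz : (x (n + 1)).name.Above z.name := by
            refine ⟨(List.prefix_or_prefix_of_prefix h2 hu.above'.1).resolve_left hzy, fun he => ?_⟩
            rw [he] at hzy
            exact hzy List.prefix_rfl
          obtain ⟨w, hw', hw1, hw2, hw3⟩ := hu.blocked ψ₁ ψ₂ h ⟨z, hz, hyz, h2, h3⟩
          exact ⟨w, hw', above_trans hbu hw1, hw2, hw3⟩
      · exact ⟨w, hw', hw1, hw2.trans hu.above.1, hw3⟩
  -- Truth of the walk makes each until formula of `b` fulfilled at some time; there are finitely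
  -- many, and fulfilments persist.
  have hfull : ∀ᶠ n in Filter.atTop, ∀ ψ ∈ b.pivot.fmls, ∀ ψ₁ ψ₂, ψ = .next (.untl ψ₁ ψ₂) →
      ∃ z ∈ P, b.name.Above z.name ∧ z.name <+: (x n).name ∧ ψ₂ ∈ z.pivot.fmls := by
    refine (Filter.eventually_all_finite (hfin b hb)).2 fun ψ hψ => ?_
    by_cases hu : ∃ ψ₁ ψ₂, ψ = .next (.untl ψ₁ ψ₂)
    · obtain ⟨ψ₁, ψ₂, rfl⟩ := hu
      have hex : ∃ m > n₁, ∃ z ∈ P, b.name.Above z.name ∧ z.name <+: (x m).name ∧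
          ψ₂ ∈ z.pivot.fmls := by
        obtain ⟨n, hn, hpo, -⟩ := hw.exists_next hT (n₁ + 1)
        rcases hT.pending hb (hw.mem n) (hbelow n hn).1 hpo hψ with h | h
        · obtain ⟨m, hm, h⟩ := hw.fair_of_sat hT C hsat h
          exact ⟨m, by omega, x m, hw.mem m, hbelow m (by omega), List.prefix_rfl, h⟩
        · exact ⟨n, hn, h⟩
      obtain ⟨m, hm, hz⟩ := hex
      refine Filter.eventually_atTop.2 ⟨m, fun n hn => ?_⟩
      rintro _ _ ⟨⟩
      induction n, hn using Nat.le_induction with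
      | base => exact hz
      | succ n hn ih => exact hmono n (by omega) ψ₁ ψ₂ hψ ih
    · exact Filter.Eventually.of_forall fun n ψ₁ ψ₂ h => absurd ⟨ψ₁, ψ₂, h⟩ hu
  -- At a late jump blocked by `b`, all until formulas are fulfilled below `b`, so the node is
  -- yes-blocked, contrary to the choice of a no-loop.
  obtain ⟨n, hjn, hn⟩ := (hbf.and_eventually hfull).exists
  refine hjn.not_yes b.toAnc ⟨(hT.mem_anc h0 (hw.mem n)).2 ⟨b, hb, rfl,
    hjn.above.trans_le hjn.above'.1⟩, hjn.pivot, fun ψ₁ ψ₂ hψ => ?_⟩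
  obtain ⟨z, hz, h1, h2, h3⟩ := hn _ hψ ψ₁ ψ₂ rfl
  exact ⟨z.toAnc, (hT.mem_branch h0 (hw.mem n)).2 ⟨z, hz, rfl, h2⟩, h1, h3⟩

/-- A satisfying run would give an infinite true walk below `x₀`, since there are no check leaves.
Following each no-loop to its middle node, such a walk is impossible. -/
theorem IsComponent.pr_eq_zero (hT : IsTree strat l₀ P) (h0 : l₀.anc = [])
    (hfin : ∀ x ∈ P, x.pivot.fmls.Finite) {π : Policy D M} (hπ : π.toPartialPolicy = ρ)
    (hs : ∀ x ∈ P, Sound π x) {x₀ : Leaf S A M AP} (hc : IsComponent strat P x₀)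
    (hno : ∀ x ∈ P, x₀.name <+: x.name → ∀ γ v, strat.pick x ≠ .close γ (.yesLoop v)) :
    (inducedChain D π).Pr x₀.st {r | Sat (inducedChain D π) x₀.pivot.fmls r} = 0 := by
  refine Chain.Pr_eq_zero _ fun r hrun hr hsat => ?_
  obtain ⟨xs, rs, hw, -, -, h⟩ := exists_walk (strat := strat) (P := P)
    (R := fun x r y r' => Move strat x r y r' ∧ ((∃ i, IsKid strat x y i) ∨ ∃ u, NoJump P x y u))
    (I := fun x r => x ∈ P ∧ x₀.name <+: x.name ∧ (inducedChain D π).IsRun r ∧ r 0 = x.st ∧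
      Sat (inducedChain D π) x.pivot.fmls r) (by
      rintro x r ⟨hx, hxx, hrun, hr, hsat⟩
      refine ⟨hx, ?_⟩
      rcases exists_step hT hπ hx (hs x hx) hrun hr hsat with hk |
        ⟨y, hy, r', hm, ⟨i, hk⟩, hr', hsy⟩ | ⟨v, hv⟩
      · exact absurd hk (hc.not_check x hx hxx)
      · refine ⟨y, r', ⟨hm, Or.inl ⟨i, hk⟩⟩, hy, hxx.trans hk.prefix, ?_, hm.st hr, hsy⟩
        rcases hr' with rfl | rfl
        exacts [hrun, isRun_tail hrun]
      · rcases hv.2.2 with ⟨γ, h, -⟩ | ⟨γ, h, h1, h2⟩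
        · exact absurd h (hno x hx hxx γ _)
        · obtain ⟨u, y, rfl, hy, hj⟩ := NoJump.of_noBlocked hT h0 hx h1 h2
          have hu := (hc.loop x hx hxx _ hv u hj.mem rfl).2.1
          refine ⟨y, r, ⟨.jump _ _ _ hv.1 hj.above' hj.pivot' hv.close, Or.inr ⟨u, hj⟩⟩, hy,
            hu.trans hj.above.1, hrun, ?_, ?_⟩
          · rw [hr]
            simp [Leaf.st, hj.pivot']
          · rwa [hj.pivot'])
    (fun _ _ _ _ h => h.1) ⟨hc.root.1, List.prefix_rfl, hrun, hr, hsat⟩ hr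
  exact hw.not_forall_noJump hT h0 hfin _ (fun n => (h n).1.2.2.2.2) fun n => (h n).2.2

end NoLoops

end PCTLSynth


namespace PCTLSynth

/-! ## Components with yes-loops -/

namespace Chain

variable {Q AP : Type*} [Fintype Q] (C : Chain Q AP)

/-- An event that is null from every state is null after every shift. -/
theorem Pr_shift_eq_zero {B : Set (ℕ → Q)} (hB : Meas B) (h : ∀ q, C.Pr q B = 0) (n : ℕ) (p : Q) :
    C.Pr p {r | (fun i => r (n + i)) ∈ B} = 0 := by
  induction n generalizing p with
  | zero =>
    simp only [Nat.zero_add]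
    exact h p
  | succ n ih =>
    have : {r : ℕ → Q | (fun i => r (n + 1 + i)) ∈ B} =
        {r | tail r ∈ {r : ℕ → Q | (fun i => r (n + i)) ∈ B}} := by
      ext r
      have : (fun i => r (n + 1 + i)) = fun i => tail r (n + i) := by
        funext i
        rw [tail_apply]
        congr 1
        omega
      simp only [Set.mem_ofPred_eq, this]
    rw [this, Pr_tail _ _ (meas_shift n hB)]
    exact Finset.sum_eq_zero fun q _ => by rw [ih, mul_zero]

end Chain

section YesLoops

variable {S A M AP : Type*} [Fintype S] [Fintype A] [Fintype M] {D : MDP S A AP}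
  {ρ : PartialPolicy S M} {strat : Strategy D ρ} {l₀ : Leaf S A M AP} {P : Set (Leaf S A M AP)}

/-- The paths from the policy state of `x` along which a leaf of the given kind is reachable. -/
def reachSet (strat : Strategy D ρ) (W : Set (Leaf S A M AP)) (B : Leaf S A M AP → Prop)
    (x : Leaf S A M AP) : Set (ℕ → M × S) :=
  {r | r 0 = x.st ∧ ∃ n, Reaches strat W B n x r}

/-- Reaching a leaf in `n` moves depends on finitely many states; with `X = univ` no exit occurs. -/
theorem meas_reachSet (C : Chain (M × S) AP) (W : Set (Leaf S A M AP)) (B : Leaf S A M AP → Prop)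
    (x : Leaf S A M AP) : Chain.Meas (reachSet strat W B x) := by
  have : reachSet strat W B x = ⋃ n, {r | r 0 = x.st ∧ Reaches strat W B n x r} := by
    ext r
    simp [reachSet]
  rw [this]
  refine Chain.Meas.iUnion fun n => (Chain.meas_and_pr_eq_of_agreeUntil (C := C) (C' := C)
    (X := Set.univ) (fun _ _ _ => rfl) (n := n) ?_).1
  rintro r r' h ⟨h1, h2⟩
  refine ⟨?_, h2.congr (X := Set.univ) (fun _ _ _ _ => trivial) h1 h⟩
  rw [← h 0 (Nat.zero_le n) fun j hj => absurd hj (Nat.not_lt_zero j), h1]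

theorem reachSet_of_move {W : Set (Leaf S A M AP)} {B : Leaf S A M AP → Prop}
    {x y : Leaf S A M AP} (hx : x ∈ W) {r r' : ℕ → M × S} (hr : r 0 = x.st)
    (hm : Move strat x r y r') (h : r' ∈ reachSet strat W B y) : r ∈ reachSet strat W B x := by
  obtain ⟨-, n, hn⟩ := h
  exact ⟨hr, n + 1, .move _ _ _ _ _ hx hm hn⟩

theorem exists_kid_of_trans_pos (hT : IsTree strat l₀ P) {π : Policy D M}
    (hπ : π.toPartialPolicy = ρ) {x : Leaf S A M AP} (hx : x ∈ P) (hs : Sound π x)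
    (hpo : x.pivot.Poised) (hloop : ∀ v, ¬ IsLoop strat x v) {q : M × S}
    (hq : 0 < (inducedChain D π).trans x.st q) : ∃ y ∈ P, ∃ i, IsKid strat x y i ∧ y.st = q := by
  have hm := strat.poisedMove hpo
  generalize ho : strat.pick x = o at hm
  have hdone := hT.done x hx
  rw [ho] at hdone
  cases hm with
  | act => simp at hdone
  | prescribed => simp at hdone
  | yesLoop v h1 h2 => exact absurd ⟨hpo, h1, Or.inl ⟨_, ho, h2⟩⟩ (hloop v)
  | noLoop v h1 h2 h3 => exact absurd ⟨hpo, h1, Or.inr ⟨_, ho, h2, h3⟩⟩ (hloop v)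
  | next ts h1 h2 h3 h4 =>
    obtain ⟨γ, hγ⟩ := exists_nextOutcome D ρ x ts
    rw [hγ] at ho
    rw [trans_pos_iff hs h1 h4] at hq
    obtain ⟨i, hi, hti⟩ := List.getElem_of_mem hq.2
    obtain ⟨y, hy, hk⟩ := hT.kids x hx _ _ _ ho i (by simpa using hi)
    refine ⟨y, hy, i, hk, ?_⟩
    obtain ⟨b', concl', γ', hp', hi', -, hyp, -⟩ := hk
    rw [ho] at hp'
    cases hp'
    rw [List.getElem_map] at hyp
    refine Prod.ext ?_ ?_
    · simp only [Leaf.st, hyp, ← hπ]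
      exact hq.1.symm
    · simp only [Leaf.st, hyp, hti]

theorem trans_pos_of_kid {π : Policy D M} (hπ : π.toPartialPolicy = ρ) {x y : Leaf S A M AP}
    (hs : Sound π x) (hpo : x.pivot.Poised) {i : ℕ} (hk : IsKid strat x y i) :
    0 < (inducedChain D π).trans x.st y.st := by
  obtain ⟨h1, -, -, ts, h2, h3, h4, -⟩ := kid_next hk hpo
  rw [trans_pos_iff hs h1 h2]
  refine ⟨?_, h4⟩
  rw [hπ]
  exact h3

/-- Within a bottom strongly connected component, every node is reached almost surely. -/
theorem IsComponent.pr_reachSet (hT : IsTree strat l₀ P) (h0 : l₀.anc = []) {π : Policy D M}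
    (hπ : π.toPartialPolicy = ρ) (hs : ∀ x ∈ P, Sound π x) {x₀ : Leaf S A M AP}
    (hc : IsComponent strat P x₀) {w : Leaf S A M AP} (hw : w ∈ component strat P x₀)
    {x : Leaf S A M AP} (hx : x ∈ component strat P x₀) :
    (inducedChain D π).Pr x.st (reachSet strat (component strat P x₀) (· = w) x) = 1 := by
  set C := inducedChain D π with hC
  set W := component strat P x₀ with hW
  set f : Leaf S A M AP → ℝ := fun x => C.Pr x.st (reachSet strat W (· = w) x) with hf
  have hWP : ∀ x ∈ W, x ∈ P := fun x hx => hx.1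
  have hfw : f w = 1 := Chain.Pr_eq_one _ fun r _ hr => ⟨hr, 0, .base _ _ _ hw rfl⟩
  -- A minimum principle: the nodes with minimal reaching probability are closed under children and
  -- loops, up to `w`. By strong connectedness they lead to `w`, where the probability is one.
  obtain ⟨y, hyW, hmin⟩ := Set.exists_min_image W f (hT.fin.subset hWP) ⟨x, hx⟩
  have hwK : w ∈ {z | z ∈ W ∧ (f z = f y ∨ f w ≤ f y)} := by
    refine hc.connected y hyW w hw _ ⟨hyW, Or.inl rfl⟩ ?_ ?_
    · rintro z ⟨hz, hz'⟩ z' hz'W i hk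
      refine ⟨hz'W, ?_⟩
      rcases hz' with hz' | hz'
      · by_cases hzw : z = w
        · subst hzw
          exact Or.inr hz'.le
        left
        refine le_antisymm ?_ (hmin z' hz'W)
        rw [← hz']
        by_cases hpo : z.pivot.Poised
        · have hmeas := meas_reachSet (strat := strat) C W (· = w) z
          have hstep := C.Pr_step z.st hmeas
          have hsub : ∀ v ∈ W, ∀ j, IsKid strat z v j →
              f v ≤ C.Pr v.st (cons z.st ⁻¹' reachSet strat W (· = w) z) := by
            intro v hv j hkv
            refine Chain.Pr_mono _ fun r hr => ?_
            refine reachSet_of_move hz rfl (.next _ _ j _ hpo hkv ?_) (by rwa [tail_cons])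
            exact hr.1
          have hloop : ∀ v, ¬ IsLoop strat z v := by
            intro v hv
            obtain ⟨γ, k, hp⟩ := hv.close
            exact IsTree.not_kid_of_close hp hk
          have hge : ∀ q, 0 < C.trans z.st q →
              f y ≤ C.Pr q (cons z.st ⁻¹' reachSet strat W (· = w) z) := by
            intro q hq
            obtain ⟨v, hv, j, hkv, rfl⟩ :=
              exists_kid_of_trans_pos hT hπ hz.1 (hs z hz.1) hpo hloop hq
            have hvW := hc.kid z hz hpo v hv j hkv
            exact (hmin v hvW).trans (hsub v hvW j hkv)
          -- An average of values that are at least the minimum equals the minimum only if all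
          -- values of positive weight do.
          have hzero : ∑ q, C.trans z.st q *
              (C.Pr q (cons z.st ⁻¹' reachSet strat W (· = w) z) - f y) = 0 := by
            simp only [mul_sub, Finset.sum_sub_distrib]
            rw [← hstep, ← Finset.sum_mul, C.trans_sum, one_mul, sub_eq_zero]
            exact hz'
          have hall := (Finset.sum_eq_zero_iff_of_nonneg fun q _ => by
            rcases (C.trans_nonneg z.st q).eq_or_lt with h | h
            · rw [← h, zero_mul]
            · exact mul_nonneg h.le (sub_nonneg.2 (hge q h))).1 hzero z'.st (Finset.mem_univ _)
          have htr := trans_pos_of_kid hπ (hs z hz.1) hpo hk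
          have := (mul_eq_zero.1 hall).resolve_left htr.ne'
          rw [hz']
          exact (hsub z' hz'W i hk).trans (sub_eq_zero.1 this).le
        · have hst := st_local hk hpo
          simp only [hf]
          rw [hst]
          exact Chain.Pr_mono _ fun r hr =>
            reachSet_of_move hz (hr.1.trans hst) (.same _ _ i _ hpo hk) hr
      · exact Or.inr hz'
    · rintro z ⟨hz, hz'⟩ v hv z' hz'P hz'v
      have hz'W := hc.loop z hz.1 hz.2.1 v hv z' hz'P hz'v
      refine ⟨hz'W, ?_⟩
      rcases hz' with hz' | hz'
      · by_cases hzw : z = w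
        · subst hzw
          exact Or.inr hz'.le
        left
        refine le_antisymm ?_ (hmin z' hz'W)
        rw [← hz']
        have hpv : z'.pivot = z.pivot := by
          rw [← hv.target.2, ← hz'v]
        have hst : z'.st = z.st := by simp [Leaf.st, hpv]
        obtain ⟨z'', hz''P, hz''v, hab⟩ := (hT.mem_anc h0 hz.1).1 hv.target.1
        have hnn : z''.name = z'.name := congrArg Anc.name (hz''v.trans hz'v.symm)
        simp only [hf]
        rw [hst]
        exact Chain.Pr_mono _ fun r hr => reachSet_of_move hz (hr.1.trans hst)
          (.jump _ _ _ hv.1 (hnn ▸ hab) hpv hv.close) hr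
      · exact Or.inr hz'
  have hle : f w ≤ f y := hwK.2.elim (fun h => h.le) id
  exact le_antisymm (Chain.Pr_le_one _ _ _) (hfw ▸ hle.trans (hmin x hx))

/-- The counter will be the number of moves still allowed for reaching the yes-loop; it is reset
when the loop is taken. -/
theorem frequently_of_countdown {A : ℕ → Prop} {c : ℕ → ℕ} (h : ∀ n, A n ∨ c n = c (n + 1) + 1)
    (n : ℕ) : ∃ m ≥ n, A m := by
  induction hk : c n generalizing n with
  | zero =>
    rcases h n with h | h
    · exact ⟨n, le_rfl, h⟩
    · omega
  | succ k ih =>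
    rcases h n with h | h
    · exact ⟨n, le_rfl, h⟩
    · obtain ⟨m, hm, hA⟩ := ih (n + 1) (by omega)
      exact ⟨m, by omega, hA⟩

/-- A walk that follows a yes-loop infinitely often fulfils its until formulas. -/
theorem Walk.fair_of_yesLoop (hT : IsTree strat l₀ P) (h0 : l₀.anc = []) {x : ℕ → Leaf S A M AP}
    {r : ℕ → ℕ → M × S} (hw : Walk strat P x r) {w v : Leaf S A M AP} (hwP : w ∈ P) (hv : v ∈ P)
    (hwpo : w.pivot.Poised) (hyes : w.YesBlocked v.toAnc)
    (hio : ∀ n, ∃ m ≥ n, x m = w ∧ x (m + 1) = v) {n : ℕ} {ψ₁ ψ₂ : Formula AP}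
    (h : .next (.untl ψ₁ ψ₂) ∈ (x n).pivot.fmls) : ∃ m > n, ψ₂ ∈ (x m).pivot.fmls := by
  obtain ⟨t, ht, htw, htv⟩ := hio n
  rcases hw.pending ht (by rwa [htw]) h with hp | hp
  · rw [htw] at hp
    obtain ⟨-, hpv, hful⟩ := hyes
    obtain ⟨a, ha, hva, hψ⟩ := hful ψ₁ ψ₂ (by rw [hpv]; exact hp)
    obtain ⟨z, hz, rfl, hzw⟩ := (hT.mem_branch h0 hwP).1 ha
    obtain ⟨s, hs, hsw, -⟩ := hio (t + 1)
    -- After the jump to `v` the walk returns to `w`, which lies in the subtree of `z`. Jumps go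
    -- upwards, so that subtree is first entered at `z` itself, where `ψ₂` belongs to the pivot.
    have hex : ∃ k, z.name <+: (x (t + 1 + k)).name :=
      ⟨s - (t + 1), by rw [show t + 1 + (s - (t + 1)) = s by omega, hsw]; exact hzw⟩
    classical
    have hk := Nat.find_spec hex
    set k := Nat.find hex with hkdef
    have hk0 : k ≠ 0 := by
      intro hk0
      rw [hk0, Nat.add_zero, htv] at hk
      exact hva.2 (hva.1.eq_of_length (le_antisymm hva.1.length_le hk.length_le))
    obtain ⟨j, hj⟩ := Nat.exists_eq_succ_of_ne_zero hk0
    have hnot : ¬ z.name <+: (x (t + 1 + j)).name := Nat.find_min hex (by omega)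
    have hstep := hw.step (t + 1 + j)
    rw [hj, Nat.succ_eq_add_one, ← Nat.add_assoc] at hk
    have kid : ∀ i, IsKid strat (x (t + 1 + j)) (x (t + 1 + j + 1)) i →
        ∃ m > n, ψ₂ ∈ (x m).pivot.fmls := by
      intro i hki
      have := (hki.prefix_or_eq hk).resolve_left hnot
      rw [hT.inj z hz _ (hw.mem _) this] at hψ
      exact ⟨t + 1 + j + 1, by omega, hψ⟩
    generalize hy : x (t + 1 + j + 1) = y at hstep kid hk
    generalize r (t + 1 + j + 1) = r' at hstep
    cases hstep with
    | same _ i _ _ hki => exact kid i hki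
    | next _ i _ _ hki => exact kid i hki
    | jump _ _ _ hab => exact absurd (hk.trans hab.1) hnot
  · exact hp

/-- Almost every run admits a walk that takes the yes-loop infinitely often, and such a walk fulfils
all its until formulas. -/
theorem IsComponent.pr_eq_one (hT : IsTree strat l₀ P) (h0 : l₀.anc = []) {π : Policy D M}
    (hπ : π.toPartialPolicy = ρ) (hs : ∀ x ∈ P, Sound π x) {x₀ : Leaf S A M AP}
    (hc : IsComponent strat P x₀) (hfin : x₀.pivot.fmls.Finite)
    (hex : ∃ w ∈ P, x₀.name <+: w.name ∧ ∃ γ n, strat.pick w = .close γ (.yesLoop n)) :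
    (inducedChain D π).Pr x₀.st {r | Sat (inducedChain D π) x₀.pivot.fmls r} = 1 := by
  obtain ⟨w, hwP, hxw, γ, n, hp⟩ := hex
  obtain ⟨a, ha, rfl⟩ := IsLoop.of_close (Or.inl hp)
  have hyes : w.YesBlocked a := by
    rcases ha.2.2 with ⟨γ', h, h'⟩ | ⟨γ', h, -⟩
    · exact h'
    · rw [hp] at h
      cases h
  obtain ⟨v, hvP, rfl, hvw⟩ := (hT.mem_anc h0 hwP).1 ha.target.1
  set C := inducedChain D π with hC
  set W := component strat P x₀ with hW
  have hw : w ∈ W := ⟨hwP, hxw, hT.not_zero_of_poised hwP ha.1⟩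
  have hv : v ∈ W := hc.loop w hwP hxw _ ha v hvP rfl
  have hfinW : W.Finite := hT.fin.subset fun x hx => hx.1
  have := hfinW.to_subtype
  -- The paths that at time `k.1` are in the state of a node of the component from which `w` cannot
  -- be reached along the rest. These countably many events are null.
  set bad : ℕ × W → Set (ℕ → M × S) := fun k =>
    {r | (fun i => r (k.1 + i)) ∈ {r | r 0 ∈ ({k.2.1.st} : Set (M × S))} ∩
      (reachSet strat W (· = w) k.2.1)ᶜ} with hbad
  have hnull : C.Pr x₀.st (⋃ k, bad k) = 0 := by
    refine Chain.Pr_iUnion_zero _ fun k => ?_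
    have hm := meas_reachSet (strat := strat) C W (· = w) k.2.1
    refine Chain.Pr_shift_eq_zero C ((Chain.meas_coord 0 _).inter hm.compl) (fun q => ?_) k.1 _
    by_cases hq : q = k.2.1.st
    · subst hq
      refine le_antisymm ?_ (Chain.Pr_nonneg _ _ _)
      refine (Chain.Pr_mono C (Set.inter_subset_right)).trans ?_
      rw [Chain.Pr_compl C hm, hc.pr_reachSet hT h0 hπ hs hw k.2.2, sub_self]
    · exact Chain.Pr_eq_zero _ fun r _ hr h => hq (hr.symm.trans h.1)
  have hmain : ∀ r, r 0 = x₀.st → r ∉ (⋃ k, bad k) → Sat C x₀.pivot.fmls r := by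
    intro r hr hgood
    set Good : (ℕ → M × S) → Prop := fun r => ∀ k, ∀ x ∈ W, r k = x.st →
      (fun i => r (k + i)) ∈ reachSet strat W (· = w) x with hGood
    have hg : Good r := by
      intro k x hx hk
      by_contra hn
      exact hgood (Set.mem_iUnion.2 ⟨(k, ⟨x, hx⟩), hk, hn⟩)
    have hgt : ∀ r, Good r → Good (tail r) := by
      intro r hr k x hx hk
      rw [tail_apply] at hk
      have := hr (k + 1) x hx hk
      convert this using 2 with i
      rw [tail_apply]
      congr 1
      omega
    have hgr : ∀ r, Good r → ∀ x ∈ W, r 0 = x.st → ∃ n, Reaches strat W (· = w) n x r := by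
      intro r hr x hx hrx
      have := (hr 0 x hx hrx).2
      simpa using this
    obtain ⟨N, hN⟩ := hgr r hg x₀ hc.root hr
    -- The states are triples of a move budget, a node and a path. At `w` the walk jumps to `v` and
    -- gets a new budget; elsewhere it spends one move towards `w`.
    obtain ⟨f, hf0, hf⟩ := exists_seq_of_forall
      (I := fun a : ℕ × Leaf S A M AP × (ℕ → M × S) =>
        Good a.2.2 ∧ a.2.2 0 = a.2.1.st ∧ Reaches strat W (· = w) a.1 a.2.1 a.2.2)
      (R := fun a b => Move strat a.2.1 a.2.2 b.2.1 b.2.2 ∧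
        ((a.2.1 = w ∧ b.2.1 = v) ∨ a.1 = b.1 + 1)) (a := (N, x₀, r)) ⟨hg, hr, hN⟩ (by
        rintro ⟨n, x, r⟩ ⟨hg, hr, hn⟩
        cases hn with
        | base _ _ _ hx hxw =>
          subst hxw
          have hm : Move strat x r v r := .jump _ _ _ ha.1 hvw ha.target.2 ha.close
          obtain ⟨n', hn'⟩ := hgr r hg v hv (hm.st hr)
          exact ⟨(n', v, r), ⟨hm, Or.inl ⟨rfl, rfl⟩⟩, hg, hm.st hr, hn'⟩
        | move n _ _ y r' hx hm hn' =>
          refine ⟨(n, y, r'), ⟨hm, Or.inr rfl⟩, ?_, hm.st hr, hn'⟩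
          cases hm with
          | same => exact hg
          | next => exact hgt _ hg
          | jump => exact hg)
    have hreach : ∀ n x r, Reaches strat W (· = w) n x r → x ∈ P := by
      intro n x r h
      cases h with
      | base _ _ _ hx => exact hx.1
      | move _ _ _ _ _ hx => exact hx.1
    have hwalk : Walk strat P (fun n => (f n).2.1) fun n => (f n).2.2 :=
      ⟨fun n => hreach _ _ _ (hf n).1.2.2, fun n => (hf n).2.1, (hf 0).1.2.1⟩
    have hio := frequently_of_countdown fun n => (hf n).2.2
    have := hwalk.sat_of_fair hT (π := π) (fun n => hs _ (hwalk.mem n))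
      (fun n ψ₁ ψ₂ h => hwalk.fair_of_yesLoop hT h0 hwP hvP ha.1 hyes hio h) 0
    simpa only [hf0] using this
  have h1 : C.Pr x₀.st {r | Sat C x₀.pivot.fmls r}ᶜ = 0 := by
    refine le_antisymm ?_ (Chain.Pr_nonneg _ _ _)
    rw [← hnull, Chain.Pr_congr C (E' := {r | Sat C x₀.pivot.fmls r}ᶜ ∩ ⋃ k, bad k)
      fun r _ hr => ⟨fun h => ⟨h, by_contra fun hn => h (hmain r hr hn)⟩, fun h => h.1⟩]
    exact Chain.Pr_mono _ Set.inter_subset_right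
  rw [Chain.Pr_compl C (meas_sat C hfin)] at h1
  linarith

/-- The forcing constraints are satisfied by the probabilities under a policy that the programs
of the tree are right about. -/
theorem IsTree.sat_force (hT : IsTree strat l₀ P) (h0 : l₀.anc = [])
    (hfin : ∀ x ∈ P, x.pivot.fmls.Finite) {π : Policy D M} (hπ : π.toPartialPolicy = ρ)
    (hs : ∀ x ∈ P, Sound π x) {γ : Constr (Var S A M AP)} (hγ : γ ∈ (tab strat P).force) :
    γ.Sat π.val := by
  obtain ⟨u, F, hroot, hγ⟩ := hγ
  obtain ⟨x₀, hx₀, rfl, rfl⟩ := exists_leaf_of_isBsccRoot hroot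
  have hc := hT.isComponent h0 hx₀ hroot
  rcases hγ with ⟨⟨n, ⟨hn, hxn⟩, v, hlab⟩, rfl⟩ | ⟨hno, rfl⟩
  · refine hc.pr_eq_one hT h0 hπ hs (hfin x₀ hx₀) ?_
    rcases hn with ⟨y, hy, rfl⟩ | ⟨y, hy, γ, k, hp, rfl⟩
    · simp [Leaf.toNode] at hlab
    · have hk : k = .yesLoop v := by simpa [Leaf.closed] using hlab
      subst hk
      refine ⟨y, hy, ?_, γ, v, hp⟩
      rcases List.prefix_concat_iff.1 hxn with h | h
      · exact absurd h (hT.close_name hy hx₀ hp 0)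
      · exact h
  · refine hc.pr_eq_zero hT h0 hfin hπ hs fun x hx hxx γ v hp => hno ?_
    exact ⟨x.closed γ (.yesLoop v), ⟨closed_mem_tab hx hp, hxx.trans (prefix_childName _ _)⟩, v, rfl⟩

end YesLoops

end PCTLSynth


namespace PCTLSynth

/-! ## The probabilities under the policy solve the program -/

section Solution

variable {S A M AP : Type*} [Fintype S] [Fintype A] [Fintype M] {D : MDP S A AP}
  {ρ : PartialPolicy S M} {strat : Strategy D ρ}

theorem Chain.Pr_exists_mem_list {Q : Type*} [Fintype Q] (C : Chain Q AP) (p : Q) {ι : Type*}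
    (L : List ι) (E : ι → Set (ℕ → Q)) (hE : ∀ i ∈ L, Chain.Meas (E i))
    (hd : ∀ r, L.Pairwise fun i j => r ∈ E i → r ∈ E j → False) :
    C.Pr p {r | ∃ i ∈ L, r ∈ E i} = (L.map fun i => C.Pr p (E i)).sum := by
  induction L with
  | nil => simp [Chain.Pr_empty]
  | cons i L ih =>
    have hL : ∀ r, L.Pairwise fun i j => r ∈ E i → r ∈ E j → False := fun r =>
      (List.pairwise_cons.1 (hd r)).2
    have h1 : {r | ∃ j ∈ i :: L, r ∈ E j} = {r | ∃ j ∈ L, r ∈ E j} ∪ E i := by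
      ext r
      simp [or_comm]
    rw [h1, Chain.Pr_union C (hE i (by simp)), ih (fun j hj => hE j (by simp [hj])) hL,
      List.map_cons, List.sum_cons, add_comm]
    rintro r ⟨j, hj, hrj⟩ hri
    exact (List.pairwise_cons.1 (hd r)).1 j hj hri hrj

theorem Expr.eval_sum {V ι : Type*} (σ : V → ℝ) (s : Finset ι) (e : ι → Expr V) :
    (Expr.sum s e).eval σ = ∑ i ∈ s, (e i).eval σ := by
  have : ∀ L : List (Expr V), (L.foldr Expr.add (.const 0)).eval σ = (L.map (Expr.eval σ)).sum := by
    intro L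
    induction L with
    | nil => rfl
    | cons e L ih => simp only [List.foldr_cons, Expr.eval, ih, List.map_cons, List.sum_cons]
  rw [Expr.sum, this, List.map_map, ← Finset.sum_map_toList]
  rfl

theorem finite_replace {l : Leaf S A M AP} {ψ : Formula AP} {Ls : List (Set (Formula AP))}
    (h : Expands (D.label l.pivot.state) l.dec ψ Ls) (hfin : l.pivot.fmls.Finite)
    {Ψ : Set (Formula AP)} (hΨ : Ψ ∈ Ls) : (l.replace ψ Ψ).fmls.Finite := by
  obtain ⟨s, rfl, -⟩ := h.exists_finset hΨ
  exact s.finite_toSet.union (hfin.subset Set.sdiff_subset)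

theorem finite_unnext {F : LForm S M AP} (h : F.fmls.Finite) : F.unnext.Finite :=
  h.preimage fun _ _ _ _ h => Formula.next.inj h

theorem finite_child {l : Leaf S A M AP} {b : Bool} {concl : List (LForm S M AP)}
    {γ : Constr (Var S A M AP)} (hp : strat.pick l = .union b concl γ) (hfin : l.pivot.fmls.Finite)
    {F : LForm S M AP} (hF : F ∈ concl) : F.fmls.Finite := by
  by_cases hpo : l.pivot.Poised
  · have hm := strat.poisedMove hpo
    generalize ho : strat.pick l = o at hm
    cases hm with
    | next ts =>
      obtain ⟨γ', hγ'⟩ := exists_nextOutcome D ρ l ts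
      rw [hp, hγ'] at ho
      cases ho
      obtain ⟨t, -, rfl⟩ := List.mem_map.1 hF
      exact finite_unnext hfin
    | _ => rw [hp] at ho; cases ho
  · have hm := strat.localMove hpo
    rw [hp] at hm
    cases hm with
    | expand ψ Ls γ h1 h2 h3 =>
      obtain ⟨Ψ, hΨ, rfl⟩ := List.mem_map.1 hF
      exact finite_replace h2 hfin hΨ

/-- Finite pivots make the event `Sat` measurable. -/
theorem Guided.finite {σ : Var S A M AP → ℝ} {l : Leaf S A M AP} {P : Set (Leaf S A M AP)}
    (h : Guided strat σ l P) (hl : l.pivot.fmls.Finite) : ∀ x ∈ P, x.pivot.fmls.Finite := by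
  induction h with
  | close l γ k hp =>
    rintro x rfl
    exact hl
  | union l byX concl γ Ps hp _ ih =>
    rintro x (rfl | hx)
    · exact hl
    · obtain ⟨i, hx⟩ := Set.mem_iUnion.1 hx
      exact ih i (finite_child hp hl (List.get_mem _ _)) x hx
  | choose _ _ _ _ _ _ _ _ _ ih => exact ih hl
  | extend _ _ _ _ _ ih => exact ih hl
  | call _ _ _ _ _ _ _ _ _ _ _ _ _ ih => exact ih hl

/-- Loop equations are trivial here, as the valuation does not see node names. -/
theorem sat_close {π : Policy D M} {l : Leaf S A M AP} (hs : Sound π l)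
    {γ : Constr (Var S A M AP)} {k : Pseudo AP} (hp : strat.pick l = .close γ k) :
    γ.Sat π.val := by
  by_cases hpo : l.pivot.Poised
  · have hm := strat.poisedMove hpo
    generalize ho : strat.pick l = o at hm
    cases hm with
    | next ts =>
      obtain ⟨γ', hγ'⟩ := exists_nextOutcome D ρ l ts
      rw [hp, hγ'] at ho
      cases ho
    | act => rw [hp] at ho; cases ho
    | prescribed => rw [hp] at ho; cases ho
    | yesLoop => rw [hp] at ho; cases ho; rfl
    | noLoop => rw [hp] at ho; cases ho; rfl
  · have hm := strat.localMove hpo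
    generalize ho : strat.pick l = o at hm
    cases hm with
    | cross ψ =>
      rw [hp] at ho
      cases ho
      exact Chain.Pr_eq_zero _ fun r _ hr => not_sat_cross hs hp hr
    | check h =>
      rw [hp] at ho
      cases ho
      refine Chain.Pr_eq_one _ fun r _ hr => ?_
      rw [h]
      exact fun _ h => h.elim
    | _ => rw [hp] at ho; cases ho

theorem Policy.act_eq_zero (π : Policy D M) {m : M} {s : S} {α : A} (h : α ∉ D.enabled s) :
    π.act m s α = 0 :=
  le_antisymm (not_lt.1 fun h' => h (π.act_enabled _ _ _ h')) (π.act_nonneg _ _ _)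

theorem Sound.act_eq_zero {π : Policy D M} {l : Leaf S A M AP} (hs : Sound π l)
    (hd : l.Decided D) {α : A} (h : α ∉ prescribed l.prog l.pivot.mode l.pivot.state) :
    π.act l.pivot.mode l.pivot.state α = 0 := by
  classical
  by_cases hα : α ∈ D.enabled l.pivot.state
  · rcases hd α hα with h' | h'
    · exact hs.zero α h'
    · exact absurd (Finset.mem_filter.2 ⟨Finset.mem_univ α, h'⟩) h
  · exact π.act_eq_zero hα

theorem sat_prescribed {π : Policy D M} {l : Leaf S A M AP} (hs : Sound π l) (hd : l.Decided D) :
    (prescribedConstr l.prog l.pivot.mode l.pivot.state).Sat π.val := by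
  change (Expr.sum _ _).eval _ = 1
  rw [Expr.eval_sum, ← π.act_sum l.pivot.mode l.pivot.state]
  exact Finset.sum_subset (Finset.subset_univ _) fun α _ hα => hs.act_eq_zero hd hα

/-- The law of total probability, with the sums restricted to the actions and successors of nonzero
probability. -/
theorem pr_next {π : Policy D M} {l : Leaf S A M AP} (hs : Sound π l) (hd : l.Decided D)
    {E : Set (ℕ → M × S)} (hE : Chain.Meas E) : (inducedChain D π).Pr l.st {r | tail r ∈ E} =
      ∑ α ∈ prescribed l.prog l.pivot.mode l.pivot.state,
        π.act l.pivot.mode l.pivot.state α * ∑ t ∈ succ D l.pivot.state α, D.P l.pivot.state α t *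
          (inducedChain D π).Pr (π.delta l.pivot.mode l.pivot.state, t) E := by
  classical
  rw [Chain.Pr_tail _ _ hE, Fintype.sum_prod_type, Finset.sum_comm]
  simp only [inducedChain, Leaf.st, ite_mul, zero_mul, Finset.sum_ite_eq', Finset.mem_univ, if_true]
  simp only [Finset.sum_mul]
  rw [Finset.sum_comm]
  have hsub : prescribed l.prog l.pivot.mode l.pivot.state ⊆
      Finset.univ.filter (fun α => α ∈ D.enabled l.pivot.state) := by
    intro α hα
    refine Finset.mem_filter.2 ⟨Finset.mem_univ _, ?_⟩
    exact π.act_enabled _ _ _ (hs.pos α (Finset.mem_filter.1 hα).2)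
  rw [← Finset.sum_subset hsub fun α _ hα => by simp [hs.act_eq_zero hd hα]]
  refine Finset.sum_congr rfl fun α _ => ?_
  rw [Finset.mul_sum]
  simp only [← mul_assoc]
  symm
  refine Finset.sum_subset (Finset.subset_univ _) fun t _ ht => ?_
  have : D.P l.pivot.state α t = 0 := by
    refine le_antisymm (not_lt.1 fun h => ht ?_) (D.P_nonneg _ _ _)
    exact Finset.mem_filter.2 ⟨Finset.mem_univ _, h⟩
  simp [this]

theorem sat_union {π : Policy D M} (hπ : π.toPartialPolicy = ρ) {l : Leaf S A M AP}
    (hs : Sound π l) (hfin : l.pivot.fmls.Finite) {b : Bool} {concl : List (LForm S M AP)}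
    {γ : Constr (Var S A M AP)} (hp : strat.pick l = .union b concl γ) : γ.Sat π.val := by
  by_cases hpo : l.pivot.Poised
  · have hm := strat.poisedMove hpo
    generalize ho : strat.pick l = o at hm
    cases hm with
    | next ts h1 h2 h3 h4 =>
      rw [hp] at ho
      simp only [nextOutcome, Outcome.union.injEq] at ho
      obtain ⟨-, -, rfl⟩ := ho
      change (inducedChain D π).Pr l.st {r | Sat (inducedChain D π) l.pivot.fmls r} =
        (Expr.sum _ _).eval _
      have hset : {r | Sat (inducedChain D π) l.pivot.fmls r} =
          {r | tail r ∈ {r | Sat (inducedChain D π) l.pivot.unnext r}} := by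
        ext r
        exact sat_poised_iff _ hpo
      rw [hset, pr_next hs h1 (meas_sat _ (finite_unnext hfin)), Expr.eval_sum]
      refine Finset.sum_congr rfl fun α _ => ?_
      simp only [Expr.eval, Expr.eval_sum]
      subst hπ
      rfl
    | _ => rw [hp] at ho; cases ho
  · have hm := strat.localMove hpo
    rw [hp] at hm
    cases hm with
    | expand ψ Ls γ h1 h2 h3 =>
      set C := inducedChain D π with hC
      refine (h3 π.val (fun F => C.Pr (F.mode, F.state) {r | Sat C F.fmls r}) fun u F => rfl).2 ?_
      rw [List.map_map]
      have := C.Pr_exists_mem_list l.st Ls (fun Ψ => {r | Sat C (l.replace ψ Ψ).fmls r})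
        (fun Ψ hΨ => meas_sat C (finite_replace h2 hfin hΨ)) fun r =>
        (h2.disjoint C r).imp fun h ha hb => h (sat_replace C |>.1 ha).1 (sat_replace C |>.1 hb).1
      refine Eq.trans ?_ this
      exact Chain.Pr_congr C fun r _ hr => sat_expand_iff hs h1 h2 hr

theorem IsTree.sat_gamma {l₀ : Leaf S A M AP} {P : Set (Leaf S A M AP)} (hT : IsTree strat l₀ P)
    (h0 : l₀.anc = []) (hfin : ∀ x ∈ P, x.pivot.fmls.Finite) {π : Policy D M}
    (hπ : π.toPartialPolicy = ρ) (hs : ∀ x ∈ P, Sound π x) (hprog : ∀ x ∈ P, ∀ γ ∈ x.prog, γ.Sat π.val)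
    {γ : Constr (Var S A M AP)} (hγ : γ ∈ (tab strat P).gamma) : γ.Sat π.val := by
  rcases hγ with ⟨n, hn, hγ⟩ | hγ
  · rcases hT.isLeaf_cases hn with ⟨x, hx, -, rfl⟩ | ⟨x, hx, γ', k, hp, rfl⟩
    · exact hprog x hx γ hγ
    · rcases hγ with hγ | rfl
      · exact hprog x hx γ hγ
      · exact sat_close (hs x hx) hp
  · exact hT.sat_force h0 hfin hπ hs hγ

/-- Makes soundness available for intermediate leaves, whose programs are still to be enlarged. -/
theorem Sound.of_extends {π : Policy D M} {l x : Leaf S A M AP} (h : l.Extends x) (hx : Sound π x) :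
    Sound π l := by
  obtain ⟨-, h2, -, h4⟩ := h
  refine ⟨fun c z ψ ⟨u, hu⟩ => ?_, fun α hα => ?_, fun α hα => ?_⟩
  · have := hx.dec c z ψ ⟨u, by rw [h2]; exact h4 hu⟩
    rwa [Leaf.st, h2] at this
  · rw [← h2]
    exact hx.zero α (by rw [h2]; exact h4 hα)
  · rw [← h2]
    exact hx.pos α (by rw [h2]; exact h4 hα)

theorem Leaf.addConstrs_extends {l x : Leaf S A M AP} {Γ : Program S A M AP}
    (h : (l.addConstrs Γ).Extends x) : l.Extends x :=
  ⟨h.1, h.2.1, h.2.2.1, fun γ hγ => h.2.2.2 (Or.inl hγ)⟩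

/-- The programs of a derivation guided by a policy are satisfied by the probabilities under
this policy. -/
theorem Guided.sat {π : Policy D M} (hπ : π.toPartialPolicy = ρ) {l : Leaf S A M AP}
    {P : Set (Leaf S A M AP)} (h : Guided strat π.val l P) (hs : ∀ x ∈ P, Sound π x)
    (hfin : l.pivot.fmls.Finite) (hl : ∀ γ ∈ l.prog, γ.Sat π.val) :
    ∀ x ∈ P, ∀ γ ∈ x.prog, γ.Sat π.val := by
  induction h with
  | close l γ k hp =>
    rintro x rfl
    exact hl
  | union l byX concl γ Ps hp hPs ih =>
    rintro x (rfl | hx)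
    · exact hl
    · obtain ⟨i, hx⟩ := Set.mem_iUnion.1 hx
      refine ih i (fun y hy => hs y (Or.inr (Set.mem_iUnion.2 ⟨i, hy⟩)))
        (finite_child hp hfin (List.get_mem _ _)) ?_ x hx
      rintro γ' (hγ' | ⟨-, rfl⟩)
      · exact hl γ' hγ'
      · exact sat_union hπ (hs l (Or.inl rfl)) hfin hp
  | choose l γl γr γ P hp hγ hsat hg ih =>
    refine ih hs hfin ?_
    rintro γ' (hγ' | rfl)
    exacts [hl γ' hγ', hsat]
  | extend l γ P hp hg ih =>
    refine ih hs hfin ?_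
    rintro γ' (hγ' | rfl)
    · exact hl γ' hγ'
    · obtain ⟨y, hy, hey⟩ := hg.isTree.root
      have hsl := Sound.of_extends (Leaf.addConstrs_extends hey) (hs y hy)
      by_cases hpo : l.pivot.Poised
      · have hm := strat.poisedMove hpo
        generalize ho : strat.pick l = o at hm
        cases hm with
        | prescribed h1 h2 =>
          rw [hp] at ho
          cases ho
          exact sat_prescribed hsl h1
        | next ts =>
          obtain ⟨γ'', hγ''⟩ := exists_nextOutcome D ρ l ts
          rw [hp, hγ''] at ho
          cases ho
        | _ => rw [hp] at ho; cases ho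
      · have hm := strat.localMove hpo
        rw [hp] at hm
        cases hm
  | call l c z ψ d P' P hp hd hsat hg' hg ih' ih =>
    -- The recursive tableau starts with the empty program and is guided by `π`; comparing `π` with
    -- itself gives its soundness.
    have hR := fun x hx => ((hg'.right hπ hπ (fun _ _ _ _ _ _ => rfl) .empty .empty) x hx).1.sound
    have hfin' : ({ψ} : Set (Formula AP)).Finite := Set.finite_singleton ψ
    refine ih hs hfin ?_
    rintro γ' (hγ' | hγ' | rfl)
    · exact hl γ' hγ'
    · exact hg'.isTree.sat_gamma rfl (hg'.finite hfin') hπ hR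
        (ih' hR hfin' fun _ h => h.elim) hγ'
    · exact hsat

theorem Policy.val_mem (π : Policy D M) (x : Var S A M AP) : π.val x ∈ Set.Icc (0 : ℝ) 1 := by
  cases x with
  | prob u F => exact ⟨Chain.Pr_nonneg _ _ _, Chain.Pr_le_one _ _ _⟩
  | act m s α =>
    refine ⟨π.act_nonneg m s α, ?_⟩
    rw [← π.act_sum m s]
    exact Finset.single_le_sum (fun β _ => π.act_nonneg m s β) (Finset.mem_univ α)

theorem pr_eq_one_iff_stateSat {Q : Type*} [Fintype Q] (C : Chain Q AP) (p : Q) {φ : Formula AP}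
    (hφ : φ.IsState) : C.Pr p {r | Sat C {φ} r} = 1 ↔ StateSat C p φ := by
  rw [sat_singleton]
  constructor
  · intro h
    by_contra hn
    rw [Chain.Pr_eq_zero C fun r _ hr hs => hn (by
      rw [← hr]
      exact (runSat_iff_stateSat C r φ hφ).1 hs)] at h
    exact zero_ne_one h
  · exact fun h => Chain.Pr_eq_one C fun r _ hr => (runSat_iff_stateSat C r φ hφ).2 (hr ▸ h)

end Solution

end PCTLSynth

/-! ### The completeness theorem. -/

open PCTLSynth

theorem theorem2 {S A AP M : Type*} [Fintype S] [Fintype A] [Fintype M]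
    (D : MDP S A AP) (π : Policy D M) (φ : Formula AP) (hφ : φ.IsState)
    (hsat : Models D π φ) (strat : Strategy D π.toPartialPolicy) :
    ∃ Γ : Program S A M AP, IsFinalProgram strat φ Γ ∧
      ∃ σ : Var S A M AP → ℝ, IsSolution Γ σ ∧
        (∀ m s, (m, s) ∈ policyDomain Γ → ∀ α, σ (.act m s α) = π.act m s α) ∧
        ∀ π' : Policy D M, IsCompletedBy π.toPartialPolicy Γ σ π' → Models D π' φ := by
  obtain ⟨P, hP⟩ := exists_guided strat (σ := π.val) (fun m s α => π.act_nonneg m s α)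
    (pdepth φ + 1) (cl φ) (finite_cl φ) (closed_cl φ)
    (fun χ hχ => Nat.lt_succ_of_le (pdepth_le hχ)) (initialLeaf D π.toPartialPolicy φ)
    (fun _ h => absurd h List.not_mem_nil) (Set.singleton_subset_iff.2 (mem_cl φ).1)
  have hT := hP.isTree
  have hfin : (initialLeaf (A := A) D π.toPartialPolicy φ).pivot.fmls.Finite :=
    Set.finite_singleton φ
  have hone := (pr_eq_one_iff_stateSat (inducedChain D π) (π.start D.init, D.init) hφ).2 hsat
  -- The initial program is one equation for a pivot and decides nothing, so it is right about every
  -- policy.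
  have hright : ∀ π' : Policy D M,
      Program.Right (initialLeaf D π.toPartialPolicy φ : Leaf S A M AP).prog π' := by
    refine fun π' => Program.Right.empty.mono ?_
    rintro γ rfl
    exact Or.inr (Or.inl ⟨rfl, _, _, rfl⟩)
  have hsound : ∀ x ∈ P, Sound π x := fun x hx =>
    (hP.right rfl rfl (fun _ _ _ _ _ _ => rfl) (hright π) (hright π) x hx).1.sound
  refine ⟨_, ⟨_, hP.derives, rfl⟩, π.val, ⟨π.val_mem, fun γ hγ => ?_⟩, fun _ _ _ _ => rfl, ?_⟩
  · refine hT.sat_gamma rfl (hP.finite hfin) rfl hsound (hP.sat rfl hsound hfin ?_) hγ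
    rintro γ rfl
    exact hone
  · rintro π' ⟨hπ', hact⟩
    have hdom : ∀ x ∈ P, ∀ m s, (m, s) ∈ policyDomain x.prog → ∀ α,
        π.act m s α = π'.act m s α := fun x hx m s h α =>
      (hact m s (policyDomain_mono (hT.prog_subset_gamma hx) h) α).symm
    have hR := hP.right rfl hπ' hdom (hright π) (hright π')
    obtain ⟨x, hx, hex⟩ := hT.root
    -- The root pivot has probability one under `π`, hence under `π'`; for a state formula this
    -- means truth in the initial state.
    have heq := pr_eq_of_sound hT rfl rfl hπ' hsound (fun x hx => (hR x hx).2.sound)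
      (fun x hx hd => hdom x hx _ _ (hd.mem_policyDomain subset_rfl)) hx (hP.finite hfin x hx)
    have hst : x.st = (π.start D.init, D.init) := by
      rw [Leaf.st, hex.2.1]
      rfl
    have hfm : x.pivot.fmls = {φ} := by
      rw [hex.2.1]
      rfl
    rw [hst, hfm, hone] at heq
    have hstart : π'.start = π.start := by rw [hπ']
    rw [Models, hstart]
    exact (pr_eq_one_iff_stateSat _ _ hφ).1 heq.symm
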